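/- Let $L>0$, $d\ge 1$, let $U=[-\frac L2,\frac L2]^d$ be the flat torus of side length $L$, and let $D\in W^{2,\infty}(U)$ (as a function on the torus) be an interaction potential and $\kappa>0$. Let $\Omega$ be a topological space with its Borel $\sigma$-algebra and $\mu$ a Borel probability measure on $\Omega$ with $\operatorname{supp}\mu=\Omega$. A *graphop* is a bounded linear operator $A:L^\infty(\Omega,\mu)\to L^1(\Omega,\mu)$ (real-valued functions) that is positivity preserving ($f\ge 0\Rightarrow Af\ge0$) and self-adjoint ($\int_\Omega g\,Af\,d\mu=\int_\Omega f\,Ag\,d\mu$ for $f,g\in L^\infty$). Suppose that $A$ is a graphop with $$\|A\|_{2\to2}=\sup_{v\in L^\infty(\Omega)}\frac{\|Av\|_{L^2(\Omega)}}{\|v\|_{L^2(\Omega)}}<\infty ,$$ extend it to a bounded operator on $L^2(\Omega,\mu)$, and let $n(A)=\sup\{(Af,f)_{L^2}:\ f\in L^2(\Omega),\ \|f\|_{L^2}=1\}<\infty$ be its numerical radius. To a nonnegative measurable $f$ on $\Omega$, $A$ is applied as the monotone limit $Af=\lim_n A(\min(f,n))$, which is consistent with $A$ on $L^\infty(\Omega)$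 and on $L^2(\Omega)$. Consider the graphop McKean–Vlasov equation for $\rho=\rho(t,x,\xi)\ge0$, $t\geq 0$, $x\in U$, $\xi\in\Omega$, $$\partial_t\rho=\kappa\,\mathrm{div}_x\big(\rho\,V[A](\rho)\big)+\Delta_x\rho,\qquad \rho(0)=\rho_0,\qquad V[A](\rho)(t,x,\xi)=\int_U\nabla D(x-\tilde x)\,[A\rho(t,\tilde x,\cdot)](\xi)\,d\tilde x .$$ Let $\rho_0$ be an admissible initial datum: $\rho_0$ is measurable on $U\times\Omega$, for a.e. $\xi$ the function $\rho_0(\cdot,\xi)$ lies in $H^{3+d}(U)$ and is a probability density on $U$, and $\rho_0(x,\cdot)\in L^\infty(\Omega,\mu)$ for each $x$. Put $\rho_\infty=\frac1{L^d}$ (the splay state) and $$\hat H(\rho|\rho_\infty)=\int_\Omega\int_U\rho\log\frac{\rho}{\rho_\infty}\,dx\,d\mu(\xi),$$ and assume $\hat H(\rho_0|\rho_\infty)<\infty$ and $$\kappa<\frac{2\pi^2}{L^2\,\|\Delta D\|_{L^\infty(U)}\,n(A)}$$ (the right-hand side is $+\infty$ if its denominator is $0$). Let $\rho\ge 0$ be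 a classical solution with initial datum $\rho_0$, that is: $\rho(t,\cdot,\cdot)$ is measurable on $U\times\Omega$ for each $t\ge0$, and for a.e. $\xi$ the function $\rho(\cdot,\cdot,\xi)$ is continuous on $[0,\infty)\times U$, is $C^1$ in $t$ and $C^2$ in $x$ with these derivatives continuous on $(0,\infty)\times U$, equals $\rho_0(\cdot,\xi)$ at $t=0$, and satisfies the equation pointwise for all $t>0$, where $A\rho(t,\cdot,\cdot)$ is measurable and $[A\rho(t,\cdot,\cdot)](\xi)\in L^1(U)$ for a.e. $\xi$ and all $t>0$. Then $\hat\alpha(A):=\frac{4\pi^2}{L^2}-2\kappa\,\|\Delta D\|_{L^\infty(U)}\,n(A)>0$, and for all $t\ge0$ the entropy $\hat H(\rho(t)|\rho_\infty)$ is finite and $$\hat H(\rho(t)|\rho_\infty)\le e^{-\hat\alpha(A)\,t}\,\hat H(\rho_0|\rho_\infty).$$ -/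

import Mathlib

open MeasureTheory Set Filter Topology
open scoped ENNReal ContDiff InnerProductSpace Laplacian

noncomputable section

namespace McKeanVlasov

/-! ### The flat torus

Functions on the flat torus of side length `L` are `L`-periodic functions on `ℝ^d`; integrals over the
torus are integrals over the cube `[-L/2, L/2]^d`. -/

/-- The Euclidean space `ℝ^d`. -/
abbrev E (d : ℕ) : Type := EuclideanSpace ℝ (Fin d)

/-- The `i`-th standard unit vector of `ℝ^d`. -/
def e {d : ℕ} (i : Fin d) : E d := EuclideanSpace.single i 1

/-- The cube `U = [-L/2, L/2]^d`. -/
def box (d : ℕ) (L : ℝ) : Set (E d) := {x | ∀ i, x i ∈ Icc (-(L / 2)) (L / 2)}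

/-- Lebesgue measure on `U`. -/
def vol (d : ℕ) (L : ℝ) : Measure (E d) := (volume : Measure (E d)).restrict (box d L)

/-- `f` is `L`-periodic in every coordinate direction. -/
def IsPeriodic {d : ℕ} (L : ℝ) (f : E d → ℝ) : Prop :=
  ∀ (x : E d) (i : Fin d), f (x + L • e i) = f x

/-! ### Sobolev spaces on the torus -/

/-- `g` is a (periodic, `p`-integrable) weak partial derivative `∂_{s 0} ⋯ ∂_{s (m-1)} f` of `f`. -/
def IsWeakPartial {d : ℕ} (L : ℝ) (p : ℝ≥0∞) {m : ℕ} (s : Fin m → Fin d) (f g : E d → ℝ) : Prop :=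
  IsPeriodic L g ∧ MemLp g p (vol d L) ∧
    ∀ φ : E d → ℝ, ContDiff ℝ ∞ φ → HasCompactSupport φ →
      ∫ x, f x * iteratedFDeriv ℝ m φ x (fun j => e (s j)) = (-1) ^ m * ∫ x, g x * φ x

/-- The periodic Sobolev space `W^{k,p}(U)`: `f` and its weak partial derivatives up to order `k`
are in `L^p(U)`. -/
def MemSobolev {d : ℕ} (L : ℝ) (k : ℕ) (p : ℝ≥0∞) (f : E d → ℝ) : Prop :=
  IsPeriodic L f ∧ MemLp f p (vol d L) ∧
    ∀ m ≤ k, ∀ s : Fin m → Fin d, ∃ g, IsWeakPartial L p s f g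

/-- A representative in `L^p(U)` of the weak partial derivative `∂_{s 0} ⋯ ∂_{s (m-1)} f`
(meaningful if there is one; it is then unique up to a null set). -/
def weakPartial {d : ℕ} (L : ℝ) (p : ℝ≥0∞) {m : ℕ} (s : Fin m → Fin d) (f : E d → ℝ) : E d → ℝ :=
  Classical.epsilon (IsWeakPartial L p s f)

/-- The weak gradient of `D ∈ W^{2,∞}(U)`. -/
def weakGrad {d : ℕ} (L : ℝ) (D : E d → ℝ) (x : E d) : E d :=
  WithLp.toLp 2 fun i => weakPartial L ⊤ ![i] D x

/-- The weak Laplacian of `D ∈ W^{2,∞}(U)`. -/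
def weakLaplacian {d : ℕ} (L : ℝ) (D : E d → ℝ) (x : E d) : ℝ :=
  ∑ i, weakPartial L ⊤ ![i, i] D x

/-- `‖ΔD‖_{L^∞(U)}`. -/
def normLaplacian {d : ℕ} (L : ℝ) (D : E d → ℝ) : ℝ :=
  (eLpNorm (weakLaplacian L D) ⊤ (vol d L)).toReal

/-- `f` is the density of an absolutely continuous probability measure on `U`. -/
def IsProbDensity {d : ℕ} (L : ℝ) (f : E d → ℝ) : Prop :=
  Integrable f (vol d L) ∧ 0 ≤ᵐ[vol d L] f ∧ ∫ x, f x ∂(vol d L) = 1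

/-! ### Graphops -/

section Graphop

variable {Ω : Type*} [MeasurableSpace Ω] {μ : Measure Ω}

/-- `P`-operators are bounded linear operators `L^∞(Ω) → L^1(Ω)`. -/
abbrev POperator (μ : Measure Ω) : Type _ := Lp ℝ ⊤ μ →L[ℝ] Lp ℝ 1 μ

/-- Graphops are self-adjoint and positivity preserving `P`-operators. -/
structure IsGraphop (A : POperator μ) : Prop where
  self_adjoint : ∀ f g : Lp ℝ ⊤ μ, ∫ ξ, g ξ * A f ξ ∂μ = ∫ ξ, f ξ * A g ξ ∂μ
  positivity : ∀ f : Lp ℝ ⊤ μ, 0 ≤ᵐ[μ] f → 0 ≤ᵐ[μ] A f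

/-- The norm `‖A‖_{p → q}`, the supremum of `‖A v‖_q / ‖v‖_p` over `v ∈ L^∞(Ω)`. -/
def pqNorm (A : POperator μ) (p q : ℝ≥0∞) : ℝ≥0∞ :=
  ⨆ v : Lp ℝ ⊤ μ, eLpNorm (A v) q μ / eLpNorm v p μ

/-- `A ∈ B_{p,q}(Ω)`. -/
def MemB (A : POperator μ) (p q : ℝ≥0∞) : Prop := pqNorm A p q < ⊤

variable [IsProbabilityMeasure μ]

/-- The inclusion `L^∞(Ω) ⊆ L^2(Ω)`. -/
def incl (μ : Measure Ω) [IsProbabilityMeasure μ] : Lp ℝ ⊤ μ →ₗ[ℝ] Lp ℝ 2 μ where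
  toFun v := ((Lp.memLp v).mono_exponent le_top).toLp v
  map_add' v w := by
    rw [← MemLp.toLp_add]
    exact MemLp.toLp_congr _ _ (Lp.coeFn_add v w)
  map_smul' c v := by
    rw [RingHom.id_apply, ← MemLp.toLp_const_smul]
    exact MemLp.toLp_congr _ _ (Lp.coeFn_smul c v)

lemma eLpNorm_le_pqNorm (A : POperator μ) (v : Lp ℝ ⊤ μ) :
    eLpNorm (A v) 2 μ ≤ pqNorm A 2 2 * eLpNorm v 2 μ := by
  have h : eLpNorm (A v) 2 μ / eLpNorm v 2 μ ≤ pqNorm A 2 2 :=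
    le_iSup (fun v : Lp ℝ ⊤ μ => eLpNorm (A v) 2 μ / eLpNorm v 2 μ) v
  have hfin : eLpNorm v 2 μ ≠ ⊤ := ((Lp.memLp v).mono_exponent le_top).2.ne
  by_cases h0 : eLpNorm v 2 μ = 0
  · have hv : v = 0 := by
      rw [eLpNorm_eq_zero_iff (Lp.aestronglyMeasurable v) (by norm_num)] at h0
      exact Lp.eq_zero_iff_ae_eq_zero.2 h0
    subst hv
    rw [map_zero, eLpNorm_congr_ae (Lp.coeFn_zero ℝ 1 μ)]
    simp
  · exact (ENNReal.div_le_iff h0 hfin).1 h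

lemma memLp_of_memB {A : POperator μ} (hA : MemB A 2 2) (v : Lp ℝ ⊤ μ) : MemLp (A v) 2 μ :=
  ⟨Lp.aestronglyMeasurable _, (eLpNorm_le_pqNorm A v).trans_lt
    (ENNReal.mul_lt_top (show pqNorm A 2 2 < ⊤ from hA) ((Lp.memLp v).mono_exponent le_top).2)⟩

/-- `A ∈ B_{2,2}(Ω)` as a map `L^∞(Ω) → L^2(Ω)`. -/
def toL2 (A : POperator μ) (hA : MemB A 2 2) : Lp ℝ ⊤ μ →ₗ[ℝ] Lp ℝ 2 μ where
  toFun v := (memLp_of_memB hA v).toLp (A v)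
  map_add' v w := by
    rw [← MemLp.toLp_add]
    refine MemLp.toLp_congr _ _ ?_
    rw [map_add]
    exact Lp.coeFn_add _ _
  map_smul' c v := by
    rw [RingHom.id_apply, ← MemLp.toLp_const_smul]
    refine MemLp.toLp_congr _ _ ?_
    rw [map_smul]
    exact Lp.coeFn_smul _ _

/-- The extension of `A ∈ B_{2,2}(Ω)` to a bounded operator `L^2(Ω) → L^2(Ω)`. -/
def extL2 (A : POperator μ) (hA : MemB A 2 2) : Lp ℝ 2 μ →L[ℝ] Lp ℝ 2 μ :=
  (toL2 A hA).extendOfNorm (incl μ)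

/-- The extension does extend `A`. -/
lemma extL2_incl (A : POperator μ) (hA : MemB A 2 2) (v : Lp ℝ ⊤ μ) :
    extL2 A hA (incl μ v) = toL2 A hA v := by
  refine LinearMap.extendOfNorm_eq ?_ ⟨(pqNorm A 2 2).toReal, fun v => ?_⟩ v
  · refine (Lp.simpleFunc.denseRange (E := ℝ) (μ := μ) (p := 2) (by norm_num)).mono ?_
    rintro _ ⟨f, rfl⟩
    have hs : MemLp (Lp.simpleFunc.toSimpleFunc f) ⊤ μ := SimpleFunc.memLp_top _ _
    refine ⟨hs.toLp _, ?_⟩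
    refine Lp.ext ?_
    exact (((Lp.memLp (hs.toLp _)).mono_exponent le_top).coeFn_toLp).trans (hs.coeFn_toLp.trans (Lp.simpleFunc.toSimpleFunc_eq_toFun f))
  · change ‖(memLp_of_memB hA v).toLp (A v)‖ ≤ _ * ‖((Lp.memLp v).mono_exponent le_top).toLp v‖
    rw [Lp.norm_toLp, Lp.norm_toLp, ← ENNReal.toReal_mul]
    exact ENNReal.toReal_mono
      (ENNReal.mul_lt_top (show pqNorm A 2 2 < ⊤ from hA) ((Lp.memLp v).mono_exponent le_top).2).ne (eLpNorm_le_pqNorm A v)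

/-- The numerical radius `n(A) = sup {(A f, f) | f ∈ L^2(Ω), ‖f‖ = 1}` of `A ∈ B_{2,2}(Ω)`. -/
def numericalRadius (A : POperator μ) (hA : MemB A 2 2) : ℝ :=
  sSup {r : ℝ | ∃ f : Lp ℝ 2 μ, ‖f‖ = 1 ∧ r = ⟪extL2 A hA f, f⟫_ℝ}

/-- The numerical radius of `A ∈ B_{2,2}(Ω)` is finite. -/
lemma numericalRadius_bddAbove (A : POperator μ) (hA : MemB A 2 2) :
    BddAbove {r : ℝ | ∃ f : Lp ℝ 2 μ, ‖f‖ = 1 ∧ r = ⟪extL2 A hA f, f⟫_ℝ} := by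
  refine ⟨‖extL2 A hA‖, ?_⟩
  rintro r ⟨f, hf, rfl⟩
  calc ⟪extL2 A hA f, f⟫_ℝ ≤ ‖extL2 A hA f‖ * ‖f‖ := real_inner_le_norm _ _
    _ ≤ ‖extL2 A hA‖ * ‖f‖ * ‖f‖ := by gcongr; exact (extL2 A hA).le_opNorm f
    _ = ‖extL2 A hA‖ := by rw [hf]; ring


end Graphop

section Image

variable {Ω : Type*} [MeasurableSpace Ω] {μ : Measure Ω}

/-- `h = A f` for a nonnegative measurable `f`, where the positivity preserving operator `A` is
extended from `L^∞(Ω)` to nonnegative functions by monotone limits: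
`A f = lim_n A (min f n)` almost everywhere. For `f ∈ L^∞(Ω)` this is `A` itself, and for
`f ∈ L^2(Ω)` and `A ∈ B_{2,2}(Ω)` it is the bounded extension of `A` to `L^2(Ω)`. -/
def IsImage (A : POperator μ) (f h : Ω → ℝ) : Prop :=
  0 ≤ᵐ[μ] f ∧ ∃ v : ℕ → Lp ℝ ⊤ μ, (∀ n, v n =ᵐ[μ] fun ξ => min (f ξ) n) ∧
    ∀ᵐ ξ ∂μ, Tendsto (fun n => A (v n) ξ) atTop (𝓝 (h ξ))

/-! ### Relative entropy -/

/-- The splay state `ρ_∞ = 1 / L^d`. -/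
def splay (d : ℕ) (L : ℝ) : ℝ := 1 / L ^ d

/-- The averaged relative entropy `Ĥ(ρ | ρ_∞) = ∫_Ω ∫_U ρ log (ρ / ρ_∞) dx dμ(ξ)`. -/
def entropy {d : ℕ} (L : ℝ) (μ : Measure Ω) (ρ : E d → Ω → ℝ) : ℝ :=
  ∫ ξ, ∫ x, ρ x ξ * Real.log (ρ x ξ / splay d L) ∂(vol d L) ∂μ

/-- `Ĥ(ρ | ρ_∞) < ∞`. The negative part of the integrand is bounded, so finiteness means
integrability on `U × Ω`. -/
def FiniteEntropy {d : ℕ} (L : ℝ) (μ : Measure Ω) (ρ : E d → Ω → ℝ) : Prop :=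
  Integrable (fun p : E d × Ω => ρ p.1 p.2 * Real.log (ρ p.1 p.2 / splay d L)) ((vol d L).prod μ)

/-! ### The graphop McKean–Vlasov equation -/

/-- Admissible initial data: `ρ₀(·, ξ) ∈ H^{3+d}(U) ∩ P_ac(U)` for almost every `ξ`, and
`ρ₀(x, ·) ∈ L^∞(Ω)` for each `x`. -/
structure IsAdmissible {d : ℕ} (L : ℝ) (μ : Measure Ω) (ρ₀ : E d → Ω → ℝ) : Prop where
  measurable : AEStronglyMeasurable (fun p : E d × Ω => ρ₀ p.1 p.2) ((vol d L).prod μ)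
  sobolev : ∀ᵐ ξ ∂μ, MemSobolev L (3 + d) 2 (fun x => ρ₀ x ξ)
  density : ∀ᵐ ξ ∂μ, IsProbDensity L (fun x => ρ₀ x ξ)
  bounded : ∀ x, MemLp (ρ₀ x) ⊤ μ

/-- The interaction term `∫_U ∇D(x - y) w(y) dy`. -/
def interaction {d : ℕ} (L : ℝ) (D w : E d → ℝ) (x : E d) : E d :=
  ∫ y, w y • weakGrad L D (x - y) ∂(vol d L)

/-- The divergence of a vector field. -/
def divergence {d : ℕ} (F : E d → E d) (x : E d) : ℝ :=
  ∑ i, fderiv ℝ (fun y => F y i) x (e i)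

/-- `ρ(t, x, ξ)` (for `t ≥ 0`) is a classical solution of
`∂_t ρ = κ div_x (ρ V[A](ρ)) + Δ_x ρ`, `ρ(0) = ρ₀`, where
`V[A](ρ)(t, x, ξ) = ∫_U ∇D(x - y) (A ρ)(t, y, ξ) dy`.

For almost every `ξ`, the nonnegative periodic function `ρ(·, ·, ξ)` is continuous up to `t = 0`, is
once continuously differentiable in `t` and twice in `x` for `t > 0`, and satisfies the equation
pointwise. In the field `equation`, `w` is the function `A ρ`; note that `V[A](ρ)(t, ·, ξ)` is then
continuously differentiable, as `∇D` is Lipschitz and `w(t, ·, ξ)` integrable. -/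
structure IsClassicalSolution {d : ℕ} (L κ : ℝ) (D : E d → ℝ) (A : POperator μ)
    (ρ₀ : E d → Ω → ℝ) (ρ : ℝ → E d → Ω → ℝ) : Prop where
  measurable : ∀ t ≥ 0, AEStronglyMeasurable (fun p : E d × Ω => ρ t p.1 p.2) ((vol d L).prod μ)
  periodic : ∀ᵐ ξ ∂μ, ∀ t ≥ 0, IsPeriodic L (fun x => ρ t x ξ)
  nonneg : ∀ᵐ ξ ∂μ, ∀ t ≥ 0, ∀ x, 0 ≤ ρ t x ξ
  initial : ∀ᵐ ξ ∂μ, ∀ᵐ x ∂(vol d L), ρ 0 x ξ = ρ₀ x ξ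
  continuous : ∀ᵐ ξ ∂μ, ContinuousOn (fun p : ℝ × E d => ρ p.1 p.2 ξ) (Ici 0 ×ˢ univ)
  contDiff : ∀ᵐ ξ ∂μ, ∀ t > 0, ContDiff ℝ 2 (fun x => ρ t x ξ)
  continuous_deriv : ∀ᵐ ξ ∂μ,
    ContinuousOn (fun p : ℝ × E d => deriv (fun s => ρ s p.2 ξ) p.1) (Ioi 0 ×ˢ univ)
  continuous_fderiv : ∀ᵐ ξ ∂μ,
    ContinuousOn (fun p : ℝ × E d => fderiv ℝ (fun x => ρ p.1 x ξ) p.2) (Ioi 0 ×ˢ univ)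
  continuous_iteratedFDeriv : ∀ᵐ ξ ∂μ,
    ContinuousOn (fun p : ℝ × E d => iteratedFDeriv ℝ 2 (fun x => ρ p.1 x ξ) p.2) (Ioi 0 ×ˢ univ)
  equation : ∃ w : ℝ → E d → Ω → ℝ,
    (∀ t > 0, AEStronglyMeasurable (fun p : E d × Ω => w t p.1 p.2) ((vol d L).prod μ)) ∧
    (∀ t > 0, ∀ᵐ x ∂(vol d L), IsImage A (ρ t x) (w t x)) ∧
    (∀ᵐ ξ ∂μ, ∀ t > 0, Integrable (fun x => w t x ξ) (vol d L)) ∧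
    ∀ᵐ ξ ∂μ, ∀ t > 0, ∀ x,
      HasDerivAt (fun s => ρ s x ξ)
        (κ * divergence (fun y => ρ t y ξ • interaction L D (fun z => w t z ξ) y) x
          + (Δ (fun y => ρ t y ξ)) x) t

end Image

end McKeanVlasov

end

/-! On one slice `ξ` the equation is a diffusion with a drift generated by `w = Aρ`. Differentiating
the relative entropy in time gives minus the Fisher information plus `κ ∫ ρ (ΔD ∗ w)`. The
logarithmic Sobolev inequality (`logSobolev_torus`) bounds the Fisher information below by `4π²/L²`
times the entropy. Since `ΔD` has mean zero on the torus, constants can be subtracted from both `ρ`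
and `w`. With the constants `ρ_∞` and `ρ_∞ A1(ξ)` the interaction term is at most `κ ‖ΔD‖_∞ G(ξ) ∫_U
|Aρ - ρ_∞ A1|`, where `G(ξ)` is the `L¹` distance of `ρ(t, ·, ξ)` from `ρ_∞`.

Positivity of `A` bounds the last integral by `AG(ξ)` (`IsGraphop.integral_abs_image_sub_le`). After
averaging over `ξ`, the numerical radius gives `∫ G · AG ≤ n(A) ∫ G²` (`integral_mul_image_le`), and
Pinsker's inequality gives `G² ≤ 2H` slicewise. Hence `Ĥ' ≤ -α Ĥ`, and Grönwall's inequality yields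
the decay.

Four points need care. The logarithm is singular where `ρ` vanishes, so the entropy of `ρ + ε ρ_∞`
is used, with errors that vanish as `ε → 0`. The kernel `∇D` is only Lipschitz, so the drift is
differentiated with Rademacher's theorem (`interactionRegular`). `Aρ` is a monotone limit, so it is
compared after integration over sets, where self-adjointness moves `A` onto indicator functions. The
entropy rate has an integrable bound only from above, so the average is controlled through its upper
right derivative (`IsFamilySolution.frequently_slope_lt`). -/

open scoped Pointwise

namespace McKeanVlasov

/-! ### Periodic functions on the cube -/

section Torus

variable {d : ℕ} {L : ℝ}

/-- The basis of the period lattice. -/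
noncomputable def periodBasis (d : ℕ) {L : ℝ} (hL : 0 < L) : Module.Basis (Fin d) ℝ (E d) :=
  (EuclideanSpace.basisFun (Fin d) ℝ).toBasis.isUnitSMul (w := fun _ => L)
    (fun _ => IsUnit.mk0 L hL.ne')

lemma periodBasis_apply (hL : 0 < L) (i : Fin d) : periodBasis d hL i = L • e i := by
  simp [periodBasis, Module.Basis.isUnitSMul_apply, e]

lemma periodBasis_repr (hL : 0 < L) (x : E d) (i : Fin d) :
    (periodBasis d hL).repr x i = x i / L := by
  have h := (periodBasis d hL).sum_repr x
  have h2 := congrArg (fun y : E d => y i) h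
  simp only [periodBasis_apply, e] at h2
  rw [eq_div_iff hL.ne', ← h2]
  simp [Finset.sum_apply, Pi.single_apply]

lemma e_apply (i j : Fin d) : (e i : E d) j = if j = i then 1 else 0 := by
  simp [e, PiLp.single_apply]

/-- The period lattice. -/
abbrev periodLattice (d : ℕ) {L : ℝ} (hL : 0 < L) : Submodule ℤ (E d) :=
  Submodule.span ℤ (Set.range (periodBasis d hL))

instance (hL : 0 < L) :
    VAddInvariantMeasure (periodLattice d hL) (E d) (volume : Measure (E d)) :=
  ⟨fun g s _ => measure_preimage_add volume (g : E d) s⟩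

lemma IsPeriodic.add_lattice {f : E d → ℝ} (hf : IsPeriodic L f) (hL : 0 < L) {g : E d}
    (hg : g ∈ periodLattice d hL) (x : E d) : f (x + g) = f x := by
  induction hg using Submodule.span_induction generalizing x with
  | mem y hy =>
    obtain ⟨i, rfl⟩ := hy
    rw [periodBasis_apply, hf]
  | zero => simp
  | add y z _ _ hy hz => rw [← add_assoc, hz, hy]
  | smul n y _ hy =>
    have hn : ∀ (k : ℕ) (x : E d), f (x + (k : ℤ) • y) = f x := by
      intro k
      induction k with
      | zero => simp
      | succ k ih => intro x; rw [Nat.cast_succ, add_smul, one_smul, ← add_assoc, hy, ih]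
    obtain ⟨k, rfl | rfl⟩ := n.eq_nat_or_neg
    · exact hn k x
    · rw [← hn k (x + -(k : ℤ) • y), neg_smul, neg_add_cancel_right]

lemma box_eq_preimage (d : ℕ) (L : ℝ) : box d L = (WithLp.ofLp : E d → Fin d → ℝ) ⁻¹'
    (Set.Icc (fun _ => -(L / 2)) (fun _ => L / 2)) := by
  ext x
  simp only [box, mem_ofPred_eq, mem_preimage, mem_Icc, Pi.le_def]
  exact ⟨fun h => ⟨fun i => (h i).1, fun i => (h i).2⟩, fun h i => ⟨h.1 i, h.2 i⟩⟩

lemma measurableSet_box (d : ℕ) (L : ℝ) : MeasurableSet (box d L) := by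
  rw [box_eq_preimage]
  exact measurableSet_Icc.preimage (PiLp.volume_preserving_ofLp (Fin d)).measurable

lemma isCompact_box (d : ℕ) (L : ℝ) : IsCompact (box d L) := by
  have : box d L = (EuclideanSpace.equiv (Fin d) ℝ).toHomeomorph ⁻¹'
    (Set.Icc (fun _ => -(L / 2)) (fun _ => L / 2)) := box_eq_preimage d L
  rw [this, Homeomorph.isCompact_preimage]
  exact isCompact_Icc

lemma volume_box (d : ℕ) (hL : 0 < L) : volume (box d L) = ENNReal.ofReal (L ^ d) := by
  rw [box_eq_preimage, (PiLp.volume_preserving_ofLp (Fin d)).measure_preimage measurableSet_Icc.nullMeasurableSet, Real.volume_Icc_pi]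
  simp [ENNReal.ofReal_pow hL.le]

lemma vol_univ (d : ℕ) (hL : 0 < L) : vol d L univ = ENNReal.ofReal (L ^ d) := by
  rw [vol, Measure.restrict_apply_univ, volume_box d hL]

lemma vol_real_univ (d : ℕ) (hL : 0 < L) : (vol d L).real univ = L ^ d := by
  rw [measureReal_def, vol_univ d hL, ENNReal.toReal_ofReal (by positivity)]

instance (d : ℕ) (L : ℝ) : IsFiniteMeasure (vol d L) :=
  ⟨by rw [vol, Measure.restrict_apply_univ]; exact (isCompact_box d L).measure_lt_top⟩

/-- The half-open cube is a translate of the fundamental parallelepiped of the lattice; closing it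
adds only faces, which are null. -/
lemma isAddFundamentalDomain_box (d : ℕ) (hL : 0 < L) :
    IsAddFundamentalDomain (periodLattice d hL) (box d L) (volume : Measure (E d)) := by
  have h0 := ZSpan.isAddFundamentalDomain (periodBasis d hL) (volume : Measure (E d))
  have h1 := h0.vadd_of_comm (WithLp.toLp 2 (fun _ => -(L / 2)) : E d)
  have hset : (WithLp.toLp 2 (fun _ => -(L / 2)) : E d) +ᵥ
      ZSpan.fundamentalDomain (periodBasis d hL) = (WithLp.ofLp : E d → Fin d → ℝ) ⁻¹'
        (Set.pi univ fun _ => Set.Ico (-(L / 2)) (L / 2)) := by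
    ext x
    rw [Set.mem_vadd_set_iff_neg_vadd_mem, ZSpan.mem_fundamentalDomain]
    simp only [periodBasis_repr, mem_preimage, Set.mem_pi, mem_univ, forall_const]
    refine forall_congr' fun i => ?_
    change ((-(WithLp.toLp 2 (fun _ => -(L / 2)) : E d) + x) i / L ∈ _) ↔ x i ∈ _
    simp only [PiLp.add_apply, PiLp.neg_apply, mem_Ico, neg_neg]
    rw [div_lt_one hL, div_nonneg_iff]
    constructor
    · rintro ⟨h | h, h2⟩
      · constructor <;> linarith
      · linarith
    · rintro ⟨h, h2⟩
      exact ⟨Or.inl ⟨by linarith, hL.le⟩, by linarith⟩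
  have hae : (WithLp.ofLp : E d → Fin d → ℝ) ⁻¹'
        (Set.pi univ fun _ => Set.Ico (-(L / 2)) (L / 2)) =ᵐ[volume] box d L := by
    rw [box_eq_preimage]
    exact (PiLp.volume_preserving_ofLp (Fin d)).quasiMeasurePreserving.preimage_ae_eq Measure.univ_pi_Ico_ae_eq_Icc
  rw [hset] at h1
  refine ⟨(measurableSet_box d L).nullMeasurableSet, ?_, ?_⟩
  · filter_upwards [h1.ae_covers] with x ⟨g, hg⟩
    refine ⟨g, ?_⟩
    rw [box_eq_preimage]
    have hg' : ∀ i ∈ (univ : Set (Fin d)), (g +ᵥ x).ofLp i ∈ Ico (-(L / 2)) (L / 2) := hg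
    exact ⟨fun i => (hg' i trivial).1, fun i => (hg' i trivial).2.le⟩
  · intro g g' hgg
    refine (h1.aedisjoint hgg).congr ?_ ?_
    · exact (vadd_set_ae_eq g).2 hae.symm
    · exact (vadd_set_ae_eq g').2 hae.symm

/-- The exceptional set is invariant under the lattice, and an invariant set that is null inside a
fundamental domain is null. -/
lemma ae_of_ae_vol (hL : 0 < L) {p : E d → Prop} (hp : ∀ x i, p (x + L • e i) ↔ p x)
    (h : ∀ᵐ x ∂(vol d L), p x) : ∀ᵐ x, p x := by
  classical
  have hper : IsPeriodic L (fun x => if p x then (1 : ℝ) else 0) := fun x i => by simp only [hp]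
  have hinv : ∀ g : periodLattice d hL, ∀ x, p (x + g) ↔ p x := by
    intro g x
    have := hper.add_lattice hL g.2 x
    by_cases h1 : p (x + g) <;> by_cases h2 : p x <;> simp_all
  refine (isAddFundamentalDomain_box d hL).measure_zero_of_invariant _ (fun g => ?_) ?_
  · ext x
    rw [Set.mem_vadd_set_iff_neg_vadd_mem, mem_compl_iff, mem_compl_iff, not_iff_not]
    have := hinv (-g) x
    rw [add_comm] at this
    exact this
  · rw [vol, ae_restrict_iff' (measurableSet_box d L)] at h
    refine measure_mono_null ?_ h
    intro x hx hx'
    exact hx.1 (hx' hx.2)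

lemma IsPeriodic.vadd_lattice {f : E d → ℝ} (hf : IsPeriodic L f) (hL : 0 < L)
    (g : periodLattice d hL) (x : E d) : f (g +ᵥ x) = f x := by
  have := hf.add_lattice hL g.2 x
  rw [add_comm] at this
  exact this

lemma IsPeriodic.aestronglyMeasurable {f : E d → ℝ} (hf : IsPeriodic L f) (hL : 0 < L)
    (h : AEStronglyMeasurable f (vol d L)) : AEStronglyMeasurable f volume := by
  have hbox := isAddFundamentalDomain_box d hL
  rw [← hbox.sum_restrict, aestronglyMeasurable_sum_measure_iff]
  exact fun g => (hbox.aestronglyMeasurable_on_iff (hbox.vadd g) (hf.vadd_lattice hL)).1 h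

lemma IsPeriodic.memLp_top {f : E d → ℝ} (hf : IsPeriodic L f) (hL : 0 < L)
    (h : MemLp f ⊤ (vol d L)) : MemLp f ⊤ (volume : Measure (E d)) := by
  refine memLp_top_of_bound (hf.aestronglyMeasurable hL h.1) (eLpNorm f ⊤ (vol d L)).toReal ?_
  refine ae_of_ae_vol hL (fun x i => by rw [hf x i]) ?_
  have := ae_le_eLpNormEssSup (f := f) (μ := vol d L)
  filter_upwards [this] with x hx
  rw [← eLpNorm_exponent_top] at hx
  have := ENNReal.toReal_mono h.2.ne hx
  simpa using this

lemma isAddFundamentalDomain_vadd_box (hL : 0 < L) (a : E d) :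
    IsAddFundamentalDomain (periodLattice d hL) (a +ᵥ box d L) (volume : Measure (E d)) :=
  (isAddFundamentalDomain_box d hL).vadd_of_comm a

lemma map_add_restrict_box (a : E d) :
    MeasurePreserving (fun x => x + a) (vol d L) (volume.restrict (a +ᵥ box d L)) := by
  have h := (measurePreserving_add_right (volume : Measure (E d)) a).restrict_image_emb
    (measurableEmbedding_addRight a) (box d L)
  have h2 : a +ᵥ box d L = (fun x => x + a) '' box d L := by
    rw [← Set.image_vadd]
    exact image_congr fun x _ => add_comm _ _
  rw [h2]
  exact h

lemma IsPeriodic.integral_comp_add {f : E d → ℝ} (hf : IsPeriodic L f) (hL : 0 < L) (a : E d) :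
    ∫ x, f (x + a) ∂(vol d L) = ∫ x, f x ∂(vol d L) := by
  have h1 := (map_add_restrict_box (L := L) a).integral_comp (measurableEmbedding_addRight a) f
  refine h1.trans ?_
  exact (isAddFundamentalDomain_vadd_box hL a).setIntegral_eq (isAddFundamentalDomain_box d hL)
    (hf.vadd_lattice hL)

lemma IsPeriodic.exists_mem_box (f : E d → ℝ) (hf : IsPeriodic L f) (hL : 0 < L) (x : E d) :
    ∃ y ∈ box d L, f y = f x := by
  let b := periodBasis d hL
  let c : E d := WithLp.toLp 2 (fun _ => L / 2)
  refine ⟨ZSpan.fract b (x + c) - c, ?_, ?_⟩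
  · intro i
    have h := (ZSpan.mem_fundamentalDomain b).1 (ZSpan.fract_mem_fundamentalDomain b (x + c)) i
    rw [periodBasis_repr, mem_Ico, div_lt_one hL, div_nonneg_iff] at h
    obtain ⟨h | h, h2⟩ := h
    · simp only [PiLp.sub_apply, c, mem_Icc]
      constructor <;> linarith
    · linarith
  · have h : ZSpan.fract b (x + c) - c = x + -(ZSpan.floor b (x + c) : E d) := by
      rw [ZSpan.fract]; abel
    rw [h]
    exact hf.add_lattice hL (neg_mem (ZSpan.floor b (x + c)).2) x

lemma IsPeriodic.exists_bound {f : E d → ℝ} (hf : IsPeriodic L f) (hL : 0 < L)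
    (hc : Continuous f) : ∃ C, ∀ x, |f x| ≤ C := by
  obtain ⟨C, hC⟩ := (isCompact_box d L).exists_bound_of_continuousOn hc.continuousOn
  refine ⟨C, fun x => ?_⟩
  obtain ⟨y, hy, hxy⟩ := hf.exists_mem_box f hL x
  rw [← hxy]
  exact hC y hy

lemma integrable_vol_of_continuous {f : E d → ℝ} (hc : Continuous f) :
    Integrable f (vol d L) :=
  hc.continuousOn.integrableOn_compact (isCompact_box d L)

/-- The integral of a bounded partial derivative of a periodic function vanishes. -/
lemma integral_partial_eq_zero (hL : 0 < L) {F F' : E d → ℝ} (hF : IsPeriodic L F)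
    (hc : Continuous F) (i : Fin d)
    (hd : ∀ x, HasDerivAt (fun s : ℝ => F (x + s • e i)) (F' x) 0) {C : ℝ}
    (hC : ∀ x, |F' x| ≤ C) : ∫ x, F' x ∂(vol d L) = 0 := by
  have hF' : F' = fun x => lineDeriv ℝ F x (e i) := by
    funext x
    exact (HasLineDerivAt.lineDeriv (hd x)).symm
  have hmeas : Measurable F' := by
    rw [hF']
    exact measurable_lineDeriv hc
  have hd' : ∀ x s, HasDerivAt (fun s : ℝ => F (x + s • e i)) (F' (x + s • e i)) s := by
    intro x s
    have h := hd (x + s • e i)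
    rw [← sub_self s] at h
    have h2 := h.comp_sub_const s s
    refine h2.congr_of_eventuallyEq (Eventually.of_forall fun r => ?_)
    simp only [add_assoc, ← add_smul]
    congr 3
    ring
  -- The integral of `F (x + s • e i)` over the cube does not depend on `s`, and its derivative at
  -- `s = 0` is the integral in question.
  have h := hasDerivAt_integral_of_dominated_loc_of_deriv_le (μ := vol d L) (s := univ)
    (x₀ := (0 : ℝ)) (F := fun s x => F (x + s • e i)) (F' := fun s x => F' (x + s • e i))
    (bound := fun _ => C) univ_mem
    (Eventually.of_forall fun s => (hc.comp (by fun_prop)).aestronglyMeasurable)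
    (integrable_vol_of_continuous (hc.comp (by fun_prop)))
    (hmeas.comp (by fun_prop)).aestronglyMeasurable
    (Eventually.of_forall fun x s _ => hC _) (integrable_const C)
    (Eventually.of_forall fun x s _ => hd' x s)
  have h2 := h.2
  simp only [hF.integral_comp_add hL, zero_smul, add_zero] at h2
  exact h2.unique (hasDerivAt_const _ _)

end Torus

/-! ### The logarithmic Sobolev inequality on the circle -/

section Circle

/-- **Wirtinger's inequality**. -/
lemma wirtinger {L : ℝ} (hL : 0 < L) {g g' : ℝ → ℝ} (hg : ∀ x, HasDerivAt g (g' x) x)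
    (hg' : Continuous g') (hper : g L = g 0) (hmean : ∫ x in (0 : ℝ)..L, g x = 0) :
    ∫ x in (0 : ℝ)..L, g x ^ 2 ≤ (L / (2 * Real.pi)) ^ 2 * ∫ x in (0 : ℝ)..L, g' x ^ 2 := by
  have hgc : Continuous g := continuous_iff_continuousAt.2 fun x => (hg x).continuousAt
  have hmem : ∀ φ : ℝ → ℝ, Continuous φ →
      MemLp (fun x => (φ x : ℂ)) 2 (volume.restrict (Ioc (0 : ℝ) L)) := by
    intro φ hφ
    obtain ⟨C, hC⟩ := (isCompact_Icc (a := (0 : ℝ)) (b := L)).exists_bound_of_continuousOn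
      hφ.continuousOn
    refine MemLp.of_bound (Complex.continuous_ofReal.comp hφ).aestronglyMeasurable C ?_
    rw [ae_restrict_iff' measurableSet_Ioc]
    refine Eventually.of_forall fun x hx => ?_
    rw [Complex.norm_real]
    exact hC x ⟨hx.1.le, hx.2⟩
  have h1 := hasSum_sq_fourierCoeffOn hL (hmem g hgc)
  have h2 := hasSum_sq_fourierCoeffOn hL (hmem g' hg')
  simp only [sub_zero, Complex.norm_real, Real.norm_eq_abs, sq_abs, smul_eq_mul] at h1 h2
  have hle : ∀ n : ℤ, ‖fourierCoeffOn hL (fun x => (g x : ℂ)) n‖ ^ 2 ≤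
      (L / (2 * Real.pi)) ^ 2 * ‖fourierCoeffOn hL (fun x => (g' x : ℂ)) n‖ ^ 2 := by
    intro n
    -- Mean zero kills the coefficient at `n = 0`. For `n ≠ 0` differentiation multiplies the
    -- coefficient by a number of modulus at least `2π / L`; Parseval's identity then sums the
    -- comparison.
    by_cases hn : n = 0
    · subst hn
      have : fourierCoeffOn hL (fun x => (g x : ℂ)) 0 = 0 := by
        rw [fourierCoeffOn_eq_integral]
        simp only [neg_zero, fourier_zero, one_smul]
        rw [intervalIntegral.integral_ofReal, hmean]
        simp
      rw [this]
      simp only [norm_zero, ne_eq, OfNat.ofNat_ne_zero, not_false_eq_true, zero_pow]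
      positivity
    · have h := fourierCoeffOn_of_hasDerivAt hL (f := fun x => (g x : ℂ))
        (f' := fun x => (g' x : ℂ)) hn (fun x _ => (hg x).ofReal_comp)
        ((Complex.continuous_ofReal.comp hg').intervalIntegrable _ _)
      rw [h, hper, sub_self, mul_zero, zero_sub, ← mul_pow]
      refine pow_le_pow_left₀ (norm_nonneg _) ?_ 2
      rw [norm_mul, norm_neg, norm_mul]
      have hn1 : (1 : ℝ) ≤ |(n : ℝ)| := by
        exact_mod_cast Int.one_le_abs hn
      have e1 : ‖1 / (-2 * (Real.pi : ℂ) * Complex.I * n)‖ = 1 / (2 * Real.pi * |(n : ℝ)|) := by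
        simp [abs_of_pos Real.pi_pos]
      have e2 : ‖((L : ℂ) - ((0 : ℝ) : ℂ))‖ = L := by simp [abs_of_pos hL]
      rw [e1, e2, ← mul_assoc]
      refine mul_le_mul_of_nonneg_right ?_ (norm_nonneg _)
      rw [div_mul_eq_mul_div, one_mul]
      refine div_le_div_of_nonneg_left hL.le (by positivity) ?_
      nlinarith [Real.pi_pos]
  have h3 := hasSum_le hle h1 (h2.mul_left _)
  have hLi : 0 < L⁻¹ := inv_pos.2 hL
  rw [← mul_assoc, mul_comm _ L⁻¹, mul_assoc] at h3
  exact le_of_mul_le_mul_left h3 hLi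

/-- A periodic function of mean zero is bounded by the `L²` norm of its derivative. -/
lemma sq_le_integral_deriv_sq {L : ℝ} (hL : 0 < L) {g g' : ℝ → ℝ}
    (hg : ∀ x, HasDerivAt g (g' x) x) (hg' : Continuous g') (hper : Function.Periodic g L)
    (hmean : ∫ x in (0 : ℝ)..L, g x = 0) (x : ℝ) :
    g x ^ 2 ≤ L / 12 * ∫ x in (0 : ℝ)..L, g' x ^ 2 := by
  have hgc : Continuous g := continuous_iff_continuousAt.2 fun x => (hg x).continuousAt
  have hper' : Function.Periodic g' L := by
    intro y
    refine ((hg (y + L)).comp_add_const y L |>.congr_of_eventuallyEq ?_).unique (hg y)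
    exact Eventually.of_forall fun z => (hper z).symm
  -- The sawtooth `y - x - L / 2` has slope one and end values `∓L / 2`, so integration by parts
  -- against it isolates `g x` when `g` has mean zero.
  have hparts : ∫ y in x..(x + L), (y - x - L / 2) * g' y = L * g x := by
    rw [intervalIntegral.integral_mul_deriv_eq_deriv_mul (u := fun y => y - x - L / 2)
      (u' := fun _ => (1 : ℝ)) (fun y _ => ((hasDerivAt_id y).sub_const x).sub_const (L / 2)) (fun y _ => hg y)
      (by simp) (hg'.intervalIntegrable _ _)]
    simp only [one_mul]
    rw [hper.intervalIntegral_add_eq x 0, zero_add, hmean, hper x]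
    ring
  have hsq : ∫ y in x..(x + L), g' y ^ 2 = ∫ y in (0 : ℝ)..L, g' y ^ 2 := by
    have := (hper'.comp (fun r => r ^ 2)).intervalIntegral_add_eq x 0
    simpa using this
  have hpoly : ∫ y in x..(x + L), (y - x - L / 2) ^ 2 = L ^ 3 / 12 := by
    have h := intervalIntegral.integral_comp_sub_right (a := x) (b := x + L)
      (fun y : ℝ => y ^ 2) (x + L / 2)
    simp only [← sub_sub] at h
    rw [h, integral_pow]
    push_cast
    ring
  -- The minimizer of the square below, namely `L g(x)` divided by `L³ / 12`; with it, nonnegativity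
  -- of the square is the Cauchy–Schwarz inequality.
  set l := 12 * g x / L ^ 2 with hl
  have hnn : 0 ≤ ∫ y in x..(x + L), (g' y - l * (y - x - L / 2)) ^ 2 :=
    intervalIntegral.integral_nonneg (by linarith) fun y _ => sq_nonneg _
  have hexp : ∫ y in x..(x + L), (g' y - l * (y - x - L / 2)) ^ 2 =
      (∫ y in x..(x + L), g' y ^ 2) - 2 * l * (∫ y in x..(x + L), (y - x - L / 2) * g' y)
        + l ^ 2 * ∫ y in x..(x + L), (y - x - L / 2) ^ 2 := by
    rw [← intervalIntegral.integral_const_mul, ← intervalIntegral.integral_const_mul,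
      ← intervalIntegral.integral_sub, ← intervalIntegral.integral_add]
    · refine intervalIntegral.integral_congr fun y _ => ?_
      ring
    all_goals exact Continuous.intervalIntegrable (by fun_prop) _ _
  rw [hexp, hparts, hsq, hpoly] at hnn
  have h3 : (∫ y in (0 : ℝ)..L, g' y ^ 2) - 12 * g x ^ 2 / L ≥ 0 := by
    convert hnn using 1
    rw [hl]
    field_simp
    ring
  have h4 : 12 * g x ^ 2 / L * (L / 12) = g x ^ 2 := by field_simp
  nlinarith

/-- Serves the two scalar logarithm inequalities of this file, whose gap functions attain their
minimum, zero, at `1`. -/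
lemma nonneg_of_deriv_sign {G G' : ℝ → ℝ} (hd : ∀ x, 0 < x → HasDerivAt G (G' x) x)
    (h1 : G 1 = 0) (hneg : ∀ x, 0 < x → x < 1 → G' x ≤ 0) (hpos : ∀ x, 1 < x → 0 ≤ G' x)
    {x : ℝ} (hx : 0 < x) : 0 ≤ G x := by
  rcases le_total x 1 with h | h
  · have hanti : AntitoneOn G (Icc x 1) := by
      refine antitoneOn_of_deriv_nonpos (convex_Icc x 1)
        (fun y hy => (hd y (hx.trans_le hy.1)).continuousAt.continuousWithinAt) ?_ ?_
      · rw [interior_Icc]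
        exact fun y hy => (hd y (hx.trans hy.1)).differentiableAt.differentiableWithinAt
      · rw [interior_Icc]
        intro y hy
        rw [(hd y (hx.trans hy.1)).deriv]
        exact hneg y (hx.trans hy.1) hy.2
    rw [← h1]
    exact hanti ⟨le_refl _, h⟩ ⟨h, le_refl _⟩ h
  · have hmono : MonotoneOn G (Icc 1 x) := by
      refine monotoneOn_of_deriv_nonneg (convex_Icc 1 x)
        (fun y hy => (hd y (one_pos.trans_le hy.1)).continuousAt.continuousWithinAt) ?_ ?_
      · rw [interior_Icc]
        exact fun y hy => (hd y (one_pos.trans hy.1)).differentiableAt.differentiableWithinAt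
      · rw [interior_Icc]
        intro y hy
        rw [(hd y (one_pos.trans hy.1)).deriv]
        exact hpos y hy.1
    rw [← h1]
    exact hmono ⟨le_refl _, h⟩ ⟨h, le_refl _⟩ h

/-- The right side is the cubic Taylor polynomial of the left side at `1`, and the fourth derivative
of the left side is negative. Dividing by `2h²` isolates the logarithm and leaves a gap with
derivative `(h - 1)³ / (3h³)`. -/
lemma sq_mul_log_sq_le {h : ℝ} (hh : 0 < h) :
    h ^ 2 * Real.log (h ^ 2) - h ^ 2 + 1 ≤ 2 * (h - 1) ^ 2 + 2 / 3 * (h - 1) ^ 3 := by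
  have key : 0 ≤ h / 3 + 1 / 2 - h⁻¹ + (h ^ 2)⁻¹ / 6 - Real.log h := by
    refine nonneg_of_deriv_sign (G := fun h => h / 3 + 1 / 2 - h⁻¹ + (h ^ 2)⁻¹ / 6 - Real.log h)
      (G' := fun h => (h - 1) ^ 3 / (3 * h ^ 3)) ?_ (by norm_num) ?_ ?_ hh
    · intro x hx
      have := ((((hasDerivAt_id x).div_const 3).add_const (1 / 2)).sub
        (hasDerivAt_inv hx.ne')).add (((hasDerivAt_pow 2 x).inv (by positivity)).div_const 6)
        |>.sub (Real.hasDerivAt_log hx.ne')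
      refine this.congr_deriv ?_
      field_simp
      ring
    · intro x hx hx1
      refine div_nonpos_of_nonpos_of_nonneg ?_ (by positivity)
      exact Odd.pow_nonpos (by decide) (by linarith)
    · intro x hx1
      have : 0 ≤ x - 1 := by linarith
      have : 0 < x := by linarith
      positivity
  have h2 : 0 ≤ 2 * h ^ 2 * (h / 3 + 1 / 2 - h⁻¹ + (h ^ 2)⁻¹ / 6 - Real.log h) := by positivity
  have h3 : 2 * h ^ 2 * (h / 3 + 1 / 2 - h⁻¹ + (h ^ 2)⁻¹ / 6 - Real.log h) =
      2 * (h - 1) ^ 2 + 2 / 3 * (h - 1) ^ 3 - (h ^ 2 * (2 * Real.log h) - h ^ 2 + 1) := by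
    field_simp
    ring
  rw [Real.log_pow]
  push_cast
  linarith

/-- The case `f = h²` with `h` of mean one. The constant is twice what linearization at constant
functions requires, and this slack permits an elementary argument: Wirtinger's inequality controls
`∫ (h - 1)²`, the sup bound controls `h - 1` pointwise, and small and large Dirichlet integrals are
treated separately. -/
lemma logSobolev_circle_of_mean_one {L : ℝ} (hL : 0 < L) {h h' : ℝ → ℝ}
    (hh : ∀ x, HasDerivAt h (h' x) x) (hh' : Continuous h') (hper : Function.Periodic h L)
    (hpos : ∀ x, 0 < h x) (hmean : ∫ x in (0 : ℝ)..L, h x = L) {N : ℝ}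
    (hN : ∫ x in (0 : ℝ)..L, h x ^ 2 = L * N) :
    ∫ x in (0 : ℝ)..L, h x ^ 2 * Real.log (h x ^ 2) ≤
      L * (N * Real.log N) + L ^ 2 / Real.pi ^ 2 * ∫ x in (0 : ℝ)..L, h' x ^ 2 := by
  have hc : Continuous h := continuous_iff_continuousAt.2 fun x => (hh x).continuousAt
  have hlogc : Continuous fun x => Real.log (h x ^ 2) :=
    (hc.pow 2).log fun x => (pow_pos (hpos x) 2).ne'
  have hNpos : 0 < N := by
    have : 0 < ∫ x in (0 : ℝ)..L, h x ^ 2 :=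
      intervalIntegral.intervalIntegral_pos_of_pos ((hc.pow 2).intervalIntegrable _ _)
        (fun x => pow_pos (hpos x) 2) hL
    rw [hN] at this
    exact pos_of_mul_pos_right this hL.le
  have hg : ∀ x, HasDerivAt (fun x => h x - 1) (h' x) x := fun x => (hh x).sub_const 1
  have hgper : Function.Periodic (fun x => h x - 1) L := fun x => by simp only [hper x]
  have hgmean : ∫ x in (0 : ℝ)..L, (h x - 1) = 0 := by
    rw [intervalIntegral.integral_sub (hc.intervalIntegrable _ _) (by simp), hmean]
    simp
  have hW := wirtinger hL hg hh' (by simpa using hgper 0) hgmean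
  have hS := sq_le_integral_deriv_sq hL hg hh' hgper hgmean
  set J := ∫ x in (0 : ℝ)..L, h' x ^ 2 with hJ
  have hJ0 : 0 ≤ J := intervalIntegral.integral_nonneg hL.le fun x _ => sq_nonneg _
  have hpi : 0 < Real.pi := Real.pi_pos
  have hpi2 : Real.pi ^ 2 < 9.9 := by
    have := Real.pi_lt_d4
    nlinarith
  -- In this unit Wirtinger's inequality reads `∫ (h - 1)² ≤ L b`, the sup bound reads `(h - 1)² ≤
  -- 3.3 b` because `π² / 3 < 3.3`, and the derivative term of the claim is `4 L b`.
  set b := L * J / (4 * Real.pi ^ 2) with hb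
  have hLJ : L * J = 4 * Real.pi ^ 2 * b := by rw [hb]; field_simp
  have hb0 : 0 ≤ b := by positivity
  have hfin : L ^ 2 / Real.pi ^ 2 * J = 4 * L * b := by rw [hb]; field_simp
  have hS' : ∀ x, (h x - 1) ^ 2 ≤ 3.3 * b := by
    intro x
    have h1 := hS x
    have : L / 12 * J = Real.pi ^ 2 * b / 3 := by
      rw [div_mul_eq_mul_div, hLJ]; ring
    rw [this] at h1
    nlinarith
  have hW' : ∫ x in (0 : ℝ)..L, (h x - 1) ^ 2 ≤ L * b := by
    refine hW.trans_eq ?_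
    rw [hb]; field_simp; ring
  rw [hfin]
  rcases le_total b 1 with hb1 | hb1
  -- Now `(h - 1)² ≤ 3.3 < 9`, so the cubic Taylor bound is at most `(2 + 2/3 · 3) (h - 1)²`, whose
  -- integral is at most `4 L b`.
  · have hg3 : ∀ x, h x - 1 ≤ 3 := fun x => by nlinarith [hS' x]
    have e1 : (∫ x in (0 : ℝ)..L, (h x ^ 2 * Real.log (h x ^ 2) - h x ^ 2 + 1)) ≤
        ∫ x in (0 : ℝ)..L, 4 * (h x - 1) ^ 2 := by
      refine intervalIntegral.integral_mono_on hL.le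
        (Continuous.intervalIntegrable (by fun_prop) _ _)
        (Continuous.intervalIntegrable (by fun_prop) _ _) fun x _ => ?_
      have := sq_mul_log_sq_le (hpos x)
      nlinarith [hg3 x, sq_nonneg (h x - 1)]
    rw [intervalIntegral.integral_add (Continuous.intervalIntegrable (by fun_prop) _ _)
      (by simp), intervalIntegral.integral_sub (Continuous.intervalIntegrable (by fun_prop) _ _)
      (Continuous.intervalIntegrable (by fun_prop) _ _), hN,
      intervalIntegral.integral_const_mul] at e1
    simp only [intervalIntegral.integral_const, sub_zero, smul_eq_mul, mul_one] at e1
    have hNlog : N - 1 ≤ N * Real.log N := by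
      have h1 := Real.one_sub_inv_le_log_of_pos hNpos
      have : N * (1 - N⁻¹) = N - 1 := by field_simp
      nlinarith
    nlinarith
  -- From `h² = 2(h - 1)² + 2 - (h - 2)²`, which is at most `6.6 b + 2`, and `1 ≤ b`.
  · have hK : ∀ x, h x ^ 2 ≤ 8.6 * b := fun x => by nlinarith [hS' x, sq_nonneg (h x - 2)]
    have e1 : (∫ x in (0 : ℝ)..L, h x ^ 2 * Real.log (h x ^ 2)) ≤
        ∫ x in (0 : ℝ)..L, h x ^ 2 * Real.log (8.6 * b) := by
      refine intervalIntegral.integral_mono_on hL.le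
        (Continuous.intervalIntegrable (by fun_prop) _ _)
        (Continuous.intervalIntegrable (by fun_prop) _ _) fun x _ => ?_
      exact mul_le_mul_of_nonneg_left (Real.log_le_log (pow_pos (hpos x) 2) (hK x)) (sq_nonneg _)
    rw [intervalIntegral.integral_mul_const, hN] at e1
    -- This is `log y ≤ y / e` with `e` lowered to `2.15`, the number for which `8.6 / 2.15 = 4`.
    have hlog : Real.log (8.6 * b / N) ≤ 8.6 * b / N / 2.15 := by
      have hy : 0 < 8.6 * b / N := by positivity
      have h1 := Real.log_le_sub_one_of_pos (show 0 < 8.6 * b / N / Real.exp 1 by positivity)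
      rw [Real.log_div hy.ne' (Real.exp_pos 1).ne', Real.log_exp] at h1
      have h2 : 8.6 * b / N / Real.exp 1 ≤ 8.6 * b / N / 2.15 :=
        div_le_div_of_nonneg_left hy.le (by norm_num) (by linarith [Real.exp_one_gt_d9])
      linarith
    rw [Real.log_div (by positivity) hNpos.ne'] at hlog
    have h4 : N * (8.6 * b / N / 2.15) = 4 * b := by field_simp; norm_num
    have h5 : N * (Real.log (8.6 * b) - Real.log N) ≤ 4 * b := by
      rw [← h4]; exact mul_le_mul_of_nonneg_left hlog hNpos.le
    nlinarith

/-- The **logarithmic Sobolev inequality** on the circle of length `L`. -/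
theorem logSobolev_circle {L : ℝ} (hL : 0 < L) {f f' : ℝ → ℝ} (hf : ∀ x, HasDerivAt f (f' x) x)
    (hf' : Continuous f') (hper : Function.Periodic f L) (hpos : ∀ x, 0 < f x) {M : ℝ}
    (hM : ∫ x in (0 : ℝ)..L, f x = L * M) :
    ∫ x in (0 : ℝ)..L, f x * Real.log (f x) ≤
      L * (M * Real.log M) + L ^ 2 / (4 * Real.pi ^ 2) * ∫ x in (0 : ℝ)..L, f' x ^ 2 / f x := by
  have hc : Continuous f := continuous_iff_continuousAt.2 fun x => (hf x).continuousAt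
  have hsqrt : ∀ x, 0 < √(f x) := fun x => Real.sqrt_pos.2 (hpos x)
  -- Dividing `√f` by its mean reaches the normalized case. The resulting `log (A²)` terms cancel,
  -- as both sides carry the same mass.
  set A := (∫ x in (0 : ℝ)..L, √(f x)) / L with hA
  have hApos : 0 < A := div_pos (intervalIntegral.intervalIntegral_pos_of_pos
    (hc.sqrt.intervalIntegrable _ _) hsqrt hL) hL
  have hMpos : 0 < M := by
    have : 0 < ∫ x in (0 : ℝ)..L, f x :=
      intervalIntegral.intervalIntegral_pos_of_pos (hc.intervalIntegrable _ _) hpos hL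
    rw [hM] at this
    exact pos_of_mul_pos_right this hL.le
  have hsq : ∀ x, (√(f x) / A) ^ 2 = f x / A ^ 2 := fun x => by
    rw [div_pow, Real.sq_sqrt (hpos x).le]
  have key := logSobolev_circle_of_mean_one hL (h := fun x => √(f x) / A)
    (h' := fun x => f' x / (2 * √(f x)) / A)
    (fun x => ((hf x).sqrt (hpos x).ne').div_const A)
    ((hf'.div (continuous_const.mul hc.sqrt) fun x => (mul_pos two_pos (hsqrt x)).ne').div_const A)
    (fun x => by simp only [hper x]) (fun x => div_pos (hsqrt x) hApos)
    (by rw [intervalIntegral.integral_div, hA]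
        have : (∫ x in (0 : ℝ)..L, √(f x)) ≠ 0 := by
          rw [hA] at hApos
          intro h0
          rw [h0] at hApos
          simp at hApos
        field_simp)
    (N := M / A ^ 2) (by simp only [hsq]; rw [intervalIntegral.integral_div, hM]; ring)
  simp only [hsq] at key
  have e1 : ∀ x, f x / A ^ 2 * Real.log (f x / A ^ 2) =
      (f x * Real.log (f x) - Real.log (A ^ 2) * f x) / A ^ 2 := fun x => by
    rw [Real.log_div (hpos x).ne' (by positivity)]; ring
  have e2 : ∀ x, (f' x / (2 * √(f x)) / A) ^ 2 = (f' x ^ 2 / f x) / (4 * A ^ 2) := fun x => by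
    rw [div_pow, div_pow, mul_pow, Real.sq_sqrt (hpos x).le]
    have := (hpos x).ne'
    field_simp
    norm_num
  have hlogc : Continuous fun x => Real.log (f x) := hc.log fun x => (hpos x).ne'
  simp only [e1, e2] at key
  rw [intervalIntegral.integral_div, intervalIntegral.integral_div, intervalIntegral.integral_sub
    (Continuous.intervalIntegrable (by fun_prop) _ _)
    (Continuous.intervalIntegrable (by fun_prop) _ _), intervalIntegral.integral_const_mul, hM,
    Real.log_div hMpos.ne' (by positivity)] at key
  have hA2 : 0 < A ^ 2 := by positivity
  rw [div_le_iff₀ hA2] at key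
  have e3 : (L * (M / A ^ 2 * (Real.log M - Real.log (A ^ 2))) + L ^ 2 / Real.pi ^ 2 *
      ((∫ x in (0 : ℝ)..L, f' x ^ 2 / f x) / (4 * A ^ 2))) * A ^ 2 =
      L * (M * Real.log M) - Real.log (A ^ 2) * (L * M) + L ^ 2 / (4 * Real.pi ^ 2) *
        ∫ x in (0 : ℝ)..L, f' x ^ 2 / f x := by
    field_simp
  linarith

end Circle

/-! ### The logarithmic Sobolev inequality on the torus -/

section TorusLSI

variable {d : ℕ} {L : ℝ}

/-- `F` is a positive periodic function with continuous partial derivatives `F' j`. -/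
structure IsPosC1 (L : ℝ) (F : E d → ℝ) (F' : Fin d → E d → ℝ) : Prop where
  cont : Continuous F
  per : IsPeriodic L F
  pos : ∀ x, 0 < F x
  cont' : ∀ j, Continuous (F' j)
  per' : ∀ j, IsPeriodic L (F' j)
  deriv : ∀ j x, HasDerivAt (fun s : ℝ => F (x + s • e j)) (F' j x) 0

/-- The average of `F` along a period in the `i`-th coordinate direction. -/
noncomputable def lineAvg (L : ℝ) (i : Fin d) (F : E d → ℝ) (x : E d) : ℝ :=
  (∫ s in (0 : ℝ)..L, F (x + s • e i)) / L

lemma hasDerivAt_line {F F' : E d → ℝ} {j : Fin d}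
    (h : ∀ x, HasDerivAt (fun s : ℝ => F (x + s • e j)) (F' x) 0) (x : E d) (s : ℝ) :
    HasDerivAt (fun s : ℝ => F (x + s • e j)) (F' (x + s • e j)) s := by
  have h := h (x + s • e j)
  rw [← sub_self s] at h
  refine (h.comp_sub_const s s).congr_of_eventuallyEq (Eventually.of_forall fun r => ?_)
  simp only [add_assoc, ← add_smul]
  congr 3
  ring

lemma continuous_lineAvg {F : E d → ℝ} (hF : Continuous F) (i : Fin d) :
    Continuous (lineAvg L i F) := by
  have : Continuous (Function.uncurry fun (x : E d) (s : ℝ) => F (x + s • e i)) :=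
    hF.comp (by fun_prop)
  exact (intervalIntegral.continuous_parametric_intervalIntegral_of_continuous' this 0 L).div_const L

lemma IsPeriodic.lineAvg {F : E d → ℝ} (hF : IsPeriodic L F) (i : Fin d) :
    IsPeriodic L (lineAvg L i F) := by
  intro x j
  unfold McKeanVlasov.lineAvg
  congr 1
  refine intervalIntegral.integral_congr fun s _ => ?_
  rw [add_right_comm, hF]

lemma IsPeriodic.line {F : E d → ℝ} (hF : IsPeriodic L F) (i : Fin d) (x : E d) :
    Function.Periodic (fun s : ℝ => F (x + s • e i)) L := by
  intro s
  simp only [add_smul, ← add_assoc]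
  exact hF _ _

lemma lineAvg_add_smul {F : E d → ℝ} (hF : IsPeriodic L F) (i : Fin d) (x : E d) (t : ℝ) :
    lineAvg L i F (x + t • e i) = lineAvg L i F x := by
  unfold lineAvg
  congr 1
  have h1 := intervalIntegral.integral_comp_add_left (a := 0) (b := L)
    (fun s : ℝ => F (x + s • e i)) t
  have h2 := (hF.line i x).intervalIntegral_add_eq t 0
  simp only [add_zero, zero_add] at h1 h2
  rw [h2] at h1
  rw [← h1]
  refine intervalIntegral.integral_congr fun s _ => ?_
  simp only [add_smul, add_assoc]

lemma lineAvg_invariant {F : E d → ℝ} {i j : Fin d} (hF : ∀ x (t : ℝ), F (x + t • e j) = F x)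
    (x : E d) (t : ℝ) : lineAvg L i F (x + t • e j) = lineAvg L i F x := by
  unfold lineAvg
  congr 1
  refine intervalIntegral.integral_congr fun s _ => ?_
  rw [add_right_comm, hF]

lemma integral_lineAvg (hL : 0 < L) {F : E d → ℝ} (hF : Continuous F) (hper : IsPeriodic L F)
    (i : Fin d) : ∫ x, lineAvg L i F x ∂(vol d L) = ∫ x, F x ∂(vol d L) := by
  obtain ⟨C, hC⟩ := hper.exists_bound hL hF
  unfold lineAvg
  rw [integral_div]
  simp only [intervalIntegral.integral_of_le hL.le]
  rw [integral_integral_swap]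
  · simp only [hper.integral_comp_add hL]
    rw [integral_const]
    simp [measureReal_def, hL.le]
    field_simp
  · refine Integrable.of_bound (C := C) ?_ (Eventually.of_forall fun p => hC _)
    exact Continuous.aestronglyMeasurable (hF.comp (by fun_prop))

lemma IsPosC1.lineAvg (hL : 0 < L) {F : E d → ℝ} {F' : Fin d → E d → ℝ} (h : IsPosC1 L F F')
    (i : Fin d) : IsPosC1 L (lineAvg L i F) (fun j => lineAvg L i (F' j)) where
  cont := continuous_lineAvg h.cont i
  per := h.per.lineAvg i
  pos x := div_pos (intervalIntegral.intervalIntegral_pos_of_pos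
    ((h.cont.comp (by fun_prop)).intervalIntegrable _ _) (fun s => h.pos _) hL) hL
  cont' j := continuous_lineAvg (h.cont' j) i
  per' j := (h.per' j).lineAvg i
  deriv j x := by
    obtain ⟨C, hC⟩ := (h.per' j).exists_bound hL (h.cont' j)
    unfold McKeanVlasov.lineAvg
    have := intervalIntegral.hasDerivAt_integral_of_dominated_loc_of_deriv_le (μ := volume)
      (a := 0) (b := L) (s := univ) (x₀ := (0 : ℝ)) (F := fun t s => F (x + t • e j + s • e i))
      (F' := fun t s => F' j (x + t • e j + s • e i)) (bound := fun _ => C) univ_mem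
      (Eventually.of_forall fun s => (h.cont.comp (by fun_prop)).aestronglyMeasurable)
      ((h.cont.comp (by fun_prop)).intervalIntegrable _ _)
      ((h.cont' j).comp (by fun_prop)).aestronglyMeasurable
      (Eventually.of_forall fun s _ t _ => hC _) (by simp)
      (Eventually.of_forall fun s _ t _ => by
        have := hasDerivAt_line (h.deriv j) (x + s • e i) t
        simpa only [add_right_comm] using this)
    have h2 := this.2.div_const L
    simpa using h2

/-- Joint convexity of `(p, q) ↦ p² / q`: average the tangent bound `p² / q ≥ 2lp - l²q` with `l`
the quotient of the two averages. -/
lemma sq_lineAvg_div_le (hL : 0 < L) {p q : E d → ℝ} (hp : Continuous p) (hq : Continuous q)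
    (hpos : ∀ x, 0 < q x) (i : Fin d) (x : E d) :
    lineAvg L i p x ^ 2 / lineAvg L i q x ≤ lineAvg L i (fun y => p y ^ 2 / q y) x := by
  have hq0 : 0 < lineAvg L i q x := div_pos (intervalIntegral.intervalIntegral_pos_of_pos
    ((hq.comp (by fun_prop)).intervalIntegrable _ _) (fun s => hpos _) hL) hL
  set l := lineAvg L i p x / lineAvg L i q x with hl
  have h1 : (∫ s in (0 : ℝ)..L, (2 * l * p (x + s • e i) - l ^ 2 * q (x + s • e i))) ≤
      ∫ s in (0 : ℝ)..L, p (x + s • e i) ^ 2 / q (x + s • e i) := by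
    refine intervalIntegral.integral_mono_on hL.le ?_ ?_ fun s _ => ?_
    · exact Continuous.intervalIntegrable (by fun_prop) _ _
    · refine Continuous.intervalIntegrable ?_ _ _
      exact (by fun_prop : Continuous fun s : ℝ => p (x + s • e i) ^ 2).div (by fun_prop)
        fun s => (hpos _).ne'
    · rw [le_div_iff₀ (hpos _)]
      nlinarith [sq_nonneg (p (x + s • e i) - l * q (x + s • e i))]
  rw [intervalIntegral.integral_sub (Continuous.intervalIntegrable (by fun_prop) _ _)
    (Continuous.intervalIntegrable (by fun_prop) _ _), intervalIntegral.integral_const_mul,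
    intervalIntegral.integral_const_mul] at h1
  have h2 := div_le_div_of_nonneg_right h1 hL.le
  refine le_trans (le_of_eq ?_) h2
  change _ = (2 * l * _ - l ^ 2 * _) / L
  rw [sub_div, mul_div_assoc, mul_div_assoc]
  change _ = 2 * l * lineAvg L i p x - l ^ 2 * lineAvg L i q x
  rw [hl]
  field_simp
  ring

/-- Averaging along one direction does not increase any directional Fisher information, so later
averaging steps can be charged to the original function. -/
lemma integral_sq_div_lineAvg_le (hL : 0 < L) {F : E d → ℝ} {F' : Fin d → E d → ℝ}
    (h : IsPosC1 L F F') (i j : Fin d) :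
    ∫ x, lineAvg L i (F' j) x ^ 2 / lineAvg L i F x ∂(vol d L) ≤
      ∫ x, F' j x ^ 2 / F x ∂(vol d L) := by
  have hc : Continuous fun x => F' j x ^ 2 / F x :=
    ((h.cont' j).pow 2).div h.cont fun x => (h.pos x).ne'
  rw [← integral_lineAvg hL hc (fun x k => by simp only [h.per x k, h.per' j x k]) i]
  refine integral_mono (integrable_vol_of_continuous ?_)
    (integrable_vol_of_continuous (continuous_lineAvg hc i)) fun x =>
      sq_lineAvg_div_le hL (h.cont' j) h.cont h.pos i x
  exact ((h.lineAvg hL i).cont' j |>.pow 2).div (h.lineAvg hL i).cont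
    fun x => ((h.lineAvg hL i).pos x).ne'

/-- The circle inequality holds on each line in direction `i`, with the line average as mean;
integrating over the torus gives the cost of averaging out one variable. -/
lemma integral_mul_log_le_lineAvg (hL : 0 < L) {F : E d → ℝ} {F' : Fin d → E d → ℝ}
    (h : IsPosC1 L F F') (i : Fin d) :
    ∫ x, F x * Real.log (F x) ∂(vol d L) ≤
      ∫ x, lineAvg L i F x * Real.log (lineAvg L i F x) ∂(vol d L) +
        L ^ 2 / (4 * Real.pi ^ 2) * ∫ x, F' i x ^ 2 / F x ∂(vol d L) := by
  have hc1 : Continuous fun x => F x * Real.log (F x) :=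
    h.cont.mul (h.cont.log fun x => (h.pos x).ne')
  have hA := h.lineAvg hL i
  have hc2 : Continuous fun x => lineAvg L i F x * Real.log (lineAvg L i F x) :=
    hA.cont.mul (hA.cont.log fun x => (hA.pos x).ne')
  have hc3 : Continuous fun x => F' i x ^ 2 / F x :=
    ((h.cont' i).pow 2).div h.cont fun x => (h.pos x).ne'
  rw [← integral_lineAvg hL hc1 (fun x k => by simp only [h.per x k]) i,
    ← integral_lineAvg hL hc3 (fun x k => by simp only [h.per x k, h.per' i x k]) i,
    ← integral_const_mul, ← integral_add (integrable_vol_of_continuous hc2)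
      ((integrable_vol_of_continuous (continuous_lineAvg hc3 i)).const_mul _)]
  refine integral_mono (integrable_vol_of_continuous (continuous_lineAvg hc1 i))
    (integrable_vol_of_continuous (hc2.add ((continuous_lineAvg hc3 i).const_mul _))) fun x => ?_
  have key := logSobolev_circle hL (f := fun s => F (x + s • e i))
    (f' := fun s => F' i (x + s • e i)) (fun s => hasDerivAt_line (h.deriv i) x s)
    ((h.cont' i).comp (by fun_prop)) (h.per.line i x) (fun s => h.pos _)
    (M := lineAvg L i F x) (by rw [lineAvg]; field_simp)
  have h2 := div_le_div_of_nonneg_right key hL.le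
  refine h2.trans (le_of_eq ?_)
  simp only [lineAvg]
  field_simp

/-- The **logarithmic Sobolev inequality** on the torus. -/
theorem logSobolev_torus (hL : 0 < L) {F : E d → ℝ} {F' : Fin d → E d → ℝ} (h : IsPosC1 L F F')
    {M : ℝ} (hM : ∫ x, F x ∂(vol d L) = L ^ d * M) :
    ∫ x, F x * Real.log (F x) ∂(vol d L) ≤ L ^ d * (M * Real.log M) +
      L ^ 2 / (4 * Real.pi ^ 2) * ∑ j, ∫ x, F' j x ^ 2 / F x ∂(vol d L) := by
  -- Averaging over the directions in `s` one at a time keeps the mass and costs one Fisher term per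
  -- direction. Once every direction is averaged, the function is the constant `M`.
  have hind : ∀ s : Finset (Fin d), ∃ (G : E d → ℝ) (G' : Fin d → E d → ℝ), IsPosC1 L G G' ∧
      (∀ j ∈ s, ∀ x (t : ℝ), G (x + t • e j) = G x) ∧
      (∀ j, ∫ x, G' j x ^ 2 / G x ∂(vol d L) ≤ ∫ x, F' j x ^ 2 / F x ∂(vol d L)) ∧
      ∫ x, G x ∂(vol d L) = L ^ d * M ∧
      ∫ x, F x * Real.log (F x) ∂(vol d L) ≤ ∫ x, G x * Real.log (G x) ∂(vol d L) +
        L ^ 2 / (4 * Real.pi ^ 2) * ∑ j ∈ s, ∫ x, F' j x ^ 2 / F x ∂(vol d L) := by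
    intro s
    induction s using Finset.induction with
    | empty => exact ⟨F, F', h, by simp, fun j => le_rfl, hM, by simp⟩
    | insert a s has ih =>
      obtain ⟨G, G', hG, hinv, hfish, hmass, hent⟩ := ih
      refine ⟨_, _, hG.lineAvg hL a, ?_, fun j =>
        (integral_sq_div_lineAvg_le hL hG a j).trans (hfish j), ?_, ?_⟩
      · intro j hj x t
        rcases Finset.mem_insert.1 hj with rfl | hj
        · exact lineAvg_add_smul hG.per j x t
        · exact lineAvg_invariant (hinv j hj) x t
      · rw [integral_lineAvg hL hG.cont hG.per, hmass]
      · rw [Finset.sum_insert has]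
        have h1 := integral_mul_log_le_lineAvg hL hG a
        have h2 := mul_le_mul_of_nonneg_left (hfish a)
          (show 0 ≤ L ^ 2 / (4 * Real.pi ^ 2) by positivity)
        linarith
  obtain ⟨G, G', hG, hinv, -, hmass, hent⟩ := hind Finset.univ
  have hconst : ∀ x, G x = G 0 := by
    intro x
    have : ∀ s : Finset (Fin d), G (∑ i ∈ s, x i • e i) = G 0 := by
      intro s
      induction s using Finset.induction with
      | empty => simp
      | insert a s has ih =>
        rw [Finset.sum_insert has, add_comm, hinv a (Finset.mem_univ a), ih]
    rw [← this Finset.univ]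
    congr 1
    ext j
    simp [Finset.sum_apply, e_apply]
  simp only [hconst, integral_const, vol_real_univ d hL, smul_eq_mul] at hmass hent
  have hGM : G 0 = M := mul_left_cancel₀ (pow_pos hL d).ne' hmass
  rwa [hGM] at hent

end TorusLSI

/-! ### Entropy inequalities -/

section EntropyInequalities

/-- The pointwise form of Pinsker's inequality. Division by `2r² + 4r` isolates the logarithm, and
the gap has derivative `(r - 1)³ / (r² (r + 2)²)`. -/
lemma three_mul_sq_le {r : ℝ} (hr : 0 ≤ r) :
    3 * (r - 1) ^ 2 ≤ (2 * r + 4) * (r * Real.log r - r + 1) := by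
  rcases hr.eq_or_lt with rfl | hr
  · norm_num
  have key : 0 ≤ Real.log r - (5 * r ^ 2 - 4 * r - 1) / (2 * r ^ 2 + 4 * r) := by
    refine nonneg_of_deriv_sign
      (G := fun r => Real.log r - (5 * r ^ 2 - 4 * r - 1) / (2 * r ^ 2 + 4 * r))
      (G' := fun r => (r - 1) ^ 3 / (r ^ 2 * (r + 2) ^ 2)) ?_ (by norm_num) ?_ ?_ hr
    · intro x hx
      have hne : 2 * x ^ 2 + 4 * x ≠ 0 := by positivity
      have h1 : HasDerivAt (fun x : ℝ => 5 * x ^ 2 - 4 * x - 1) (10 * x - 4) x := by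
        have := (((hasDerivAt_pow 2 x).const_mul 5).sub ((hasDerivAt_id x).const_mul 4)).sub_const 1
        refine this.congr_deriv ?_
        norm_num
        ring
      have h2 : HasDerivAt (fun x : ℝ => 2 * x ^ 2 + 4 * x) (4 * x + 4) x := by
        have := ((hasDerivAt_pow 2 x).const_mul 2).add ((hasDerivAt_id x).const_mul 4)
        refine this.congr_deriv ?_
        norm_num
        ring
      refine ((Real.hasDerivAt_log hx.ne').sub (h1.div h2 hne)).congr_deriv ?_
      have e : 2 * x ^ 2 + 4 * x = 2 * x * (x + 2) := by ring
      rw [e]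
      field_simp
      ring
    · intro x hx hx1
      refine div_nonpos_of_nonpos_of_nonneg ?_ (by positivity)
      exact Odd.pow_nonpos (by decide) (by linarith)
    · intro x hx1
      have : 0 ≤ x - 1 := by linarith
      have : 0 < x := by linarith
      positivity
  have h2 : 0 ≤ (2 * r ^ 2 + 4 * r) *
      (Real.log r - (5 * r ^ 2 - 4 * r - 1) / (2 * r ^ 2 + 4 * r)) := by positivity
  rw [mul_sub, mul_div_cancel₀ _ (by positivity)] at h2
  nlinarith

/-- This bound and the next one compare the regularized entropy density with the original. The upper
bound is affine in `a`, hence controlled by the mass; the lower one does not involve `a`. -/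
lemma add_mul_log_sub_le {a ε : ℝ} (ha : 0 ≤ a) (hε : 0 < ε) :
    (a + ε) * Real.log (a + ε) - a * Real.log a ≤ ε * (a + ε) := by
  have h1 : ε * Real.log (a + ε) ≤ ε * (a + ε - 1) :=
    mul_le_mul_of_nonneg_left (Real.log_le_sub_one_of_pos (by positivity)) hε.le
  have h2 : a * Real.log (a + ε) - a * Real.log a ≤ ε := by
    rcases ha.eq_or_lt with rfl | ha
    · simpa using hε.le
    have h := Real.log_le_sub_one_of_pos (show 0 < (a + ε) / a by positivity)
    rw [Real.log_div (by positivity) ha.ne'] at h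
    have h3 := mul_le_mul_of_nonneg_left h ha.le
    have h4 : a * ((a + ε) / a - 1) = ε := by field_simp; ring
    linarith
  linarith

lemma mul_log_le_add_mul_log_sub {a ε : ℝ} (ha : 0 ≤ a) (hε : 0 < ε) :
    ε * Real.log ε ≤ (a + ε) * Real.log (a + ε) - a * Real.log a := by
  have h1 : ε * Real.log ε ≤ ε * Real.log (a + ε) :=
    mul_le_mul_of_nonneg_left (Real.log_le_log hε (by linarith)) hε.le
  have h2 : a * Real.log a ≤ a * Real.log (a + ε) := by
    rcases ha.eq_or_lt with rfl | ha
    · simp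
    exact mul_le_mul_of_nonneg_left (Real.log_le_log ha (by linarith)) ha.le
  linarith

lemma log_one_add_le_two_mul_sqrt {x : ℝ} (hx : 0 ≤ x) : Real.log (1 + x) ≤ 2 * √x := by
  have h1 : 1 + x ≤ (1 + √x) ^ 2 := by nlinarith [Real.sq_sqrt hx, Real.sqrt_nonneg x]
  have h2 := Real.log_le_log (by linarith) h1
  rw [Real.log_pow] at h2
  have h3 := Real.log_le_sub_one_of_pos (show 0 < 1 + √x by positivity)
  push_cast at h2
  linarith

variable {d : ℕ} {L : ℝ}

lemma splay_pos (d : ℕ) (hL : 0 < L) : 0 < splay d L := by unfold splay; positivity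

lemma pow_mul_splay (d : ℕ) (hL : 0 < L) : L ^ d * splay d L = 1 := by
  unfold splay; field_simp

/-- The relative entropy `∫_U f log (f / ρ_∞)` of a function on the torus. -/
noncomputable def relEntropy (L : ℝ) (f : E d → ℝ) : ℝ :=
  ∫ x, f x * Real.log (f x / splay d L) ∂(vol d L)

/-- The relative entropy of `f + ε ρ_∞`. -/
noncomputable def regEntropy (L ε : ℝ) (f : E d → ℝ) : ℝ :=
  ∫ x, (f x + ε * splay d L) * Real.log ((f x + ε * splay d L) / splay d L) ∂(vol d L)

lemma continuous_mul_log_div {f : E d → ℝ} (hf : Continuous f) (hL : 0 < L) :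
    Continuous fun x => f x * Real.log (f x / splay d L) := by
  have h : (fun x => f x * Real.log (f x / splay d L)) =
      fun x => splay d L * (f x / splay d L * Real.log (f x / splay d L)) := by
    funext x
    have := (splay_pos d hL).ne'
    field_simp
  rw [h]
  exact continuous_const.mul (Real.continuous_mul_log.comp (hf.div_const _))

lemma integral_const_splay (d : ℕ) (hL : 0 < L) (c : ℝ) :
    ∫ _, c * splay d L ∂(vol d L) = c := by
  rw [integral_const, vol_real_univ d hL, smul_eq_mul, mul_left_comm, pow_mul_splay d hL, mul_one]

/-- **Pinsker's inequality**. -/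
theorem pinsker (hL : 0 < L) {f : E d → ℝ} (hf : Continuous f) (h0 : ∀ x, 0 ≤ f x)
    (h1 : ∫ x, f x ∂(vol d L) = 1) :
    (∫ x, |f x - splay d L| ∂(vol d L)) ^ 2 ≤ 2 * relEntropy L f := by
  set m := splay d L with hm
  have hmpos : 0 < m := splay_pos d hL
  have hm1 : ∫ _, m ∂(vol d L) = 1 := by simpa using integral_const_splay d hL 1
  set G := ∫ x, |f x - m| ∂(vol d L) with hG
  have hG0 : 0 ≤ G := integral_nonneg fun x => abs_nonneg _
  have hcl := continuous_mul_log_div hf hL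
  -- Cauchy–Schwarz in the form of a weighted AM–GM inequality with free parameter `s`. The weight
  -- `2f + 4ρ_∞` has integral `6`, and the linear terms in `f log (f / ρ_∞) - f + ρ_∞` integrate to
  -- zero.
  have key : ∀ s : ℝ, 0 < s → 2 * G ≤ 6 * s + relEntropy L f / (3 * s) := by
    intro s hs
    have hle : ∀ x, 2 * |f x - m| ≤ s * (2 * f x + 4 * m) +
        (f x * Real.log (f x / m) - f x + m) / (3 * s) := by
      intro x
      have hr := three_mul_sq_le (div_nonneg (h0 x) hmpos.le)
      set r := f x / m with hrdef
      have hfr : f x = m * r := by rw [hrdef]; field_simp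
      have hr0 : 0 ≤ r := div_nonneg (h0 x) hmpos.le
      set Q := r * Real.log r - r + 1 with hQ
      have e1 : f x * Real.log r - f x + m = m * Q := by rw [hfr, hQ]; ring
      have e2 : |f x - m| = m * |r - 1| := by
        rw [hfr, show m * r - m = m * (r - 1) by ring, abs_mul, abs_of_pos hmpos]
      rw [e1, e2, hfr]
      have hd : 0 < 2 * r + 4 := by linarith
      have h2 : 2 * |r - 1| ≤ s * (2 * r + 4) + Q / (3 * s) := by
        have h3 : (r - 1) ^ 2 / (s * (2 * r + 4)) ≤ Q / (3 * s) := by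
          rw [div_le_div_iff₀ (by positivity) (by positivity)]
          nlinarith
        have h4 : 2 * |r - 1| ≤ s * (2 * r + 4) + (r - 1) ^ 2 / (s * (2 * r + 4)) := by
          set y := s * (2 * r + 4) with hy
          have hy0 : 0 < y := by positivity
          rw [← sq_abs]
          have : 0 ≤ (y - |r - 1|) ^ 2 / y := by positivity
          have e3 : (y - |r - 1|) ^ 2 / y = y + |r - 1| ^ 2 / y - 2 * |r - 1| := by
            field_simp; ring
          linarith
        linarith
      have h5 := mul_le_mul_of_nonneg_left h2 hmpos.le
      have e4 : m * (s * (2 * r + 4) + Q / (3 * s)) =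
        s * (2 * (m * r) + 4 * m) + m * Q / (3 * s) := by ring
      linarith
    have hint := integral_mono (μ := vol d L)
      (integrable_vol_of_continuous (by fun_prop))
      (integrable_vol_of_continuous (by fun_prop)) hle
    rw [integral_const_mul, integral_add (integrable_vol_of_continuous (by fun_prop))
      (integrable_vol_of_continuous (by fun_prop)), integral_const_mul, integral_div,
      integral_add (integrable_vol_of_continuous (by fun_prop)) (integrable_const _),
      integral_add (integrable_vol_of_continuous (by fun_prop)) (integrable_const _),
      integral_sub (integrable_vol_of_continuous hcl) (integrable_vol_of_continuous hf),
      integral_const_mul, integral_const_mul, h1, hm1] at hint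
    have e5 : relEntropy L f = ∫ x, f x * Real.log (f x / m) ∂(vol d L) := rfl
    rw [e5]
    rw [sub_add_cancel] at hint
    linarith
  -- The choice `s = G / 6` requires `G > 0`. For `G = 0` the claim is nonnegativity of the entropy,
  -- obtained as `s → 0`.
  rcases hG0.eq_or_lt with h | h
  · rw [← h]
    have h2 : ∀ s : ℝ, 0 < s → -(18 * s ^ 2) ≤ relEntropy L f := by
      intro s hs
      have := key s hs
      rw [← h] at this
      have h3 : relEntropy L f / (3 * s) * (3 * s) = relEntropy L f := by field_simp
      nlinarith
    have h3 : Tendsto (fun s : ℝ => -(18 * s ^ 2)) (𝓝[>] 0) (𝓝 (-(18 * 0 ^ 2))) :=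
      ((continuous_const.mul (continuous_pow 2)).neg.tendsto (0 : ℝ)).mono_left nhdsWithin_le_nhds
    have h4 := le_of_tendsto h3 (eventually_nhdsWithin_of_forall fun s hs => h2 s hs)
    norm_num at h4 ⊢
    exact h4
  · have := key (G / 6) (by positivity)
    have h3 : relEntropy L f / (3 * (G / 6)) * G = 2 * relEntropy L f := by field_simp; ring
    nlinarith

lemma regEntropy_integrand_continuous (hL : 0 < L) (ε : ℝ) {f : E d → ℝ} (hf : Continuous f) :
    Continuous fun x =>
      (f x + ε * splay d L) * Real.log ((f x + ε * splay d L) / splay d L) :=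
  continuous_mul_log_div (hf.add continuous_const) hL

lemma regEntropy_sub_relEntropy_le (hL : 0 < L) {ε : ℝ} (hε : 0 < ε) {f : E d → ℝ}
    (hf : Continuous f) (h0 : ∀ x, 0 ≤ f x) (h1 : ∫ x, f x ∂(vol d L) = 1) :
    regEntropy L ε f - relEntropy L f ≤ ε + ε ^ 2 := by
  have hmpos : 0 < splay d L := splay_pos d hL
  unfold regEntropy relEntropy
  rw [← integral_sub (integrable_vol_of_continuous (regEntropy_integrand_continuous hL ε hf))
    (integrable_vol_of_continuous (continuous_mul_log_div hf hL))]
  have h : ∫ x, (ε * f x + ε ^ 2 * splay d L) ∂(vol d L) = ε + ε ^ 2 := by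
    rw [integral_add (integrable_vol_of_continuous (by fun_prop)) (integrable_const _),
      integral_const_mul, h1, integral_const_splay d hL, mul_one]
  rw [← h]
  refine integral_mono ((integrable_vol_of_continuous (regEntropy_integrand_continuous hL ε hf)).sub
    (integrable_vol_of_continuous (continuous_mul_log_div hf hL)))
    (integrable_vol_of_continuous (by fun_prop)) fun x => ?_
  have := mul_le_mul_of_nonneg_left
    (add_mul_log_sub_le (div_nonneg (h0 x) hmpos.le) hε) hmpos.le
  have e : (f x + ε * splay d L) / splay d L = f x / splay d L + ε := by field_simp
  simp only [e]
  convert this using 1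
  · field_simp
  · field_simp

lemma le_regEntropy_sub_relEntropy (hL : 0 < L) {ε : ℝ} (hε : 0 < ε) {f : E d → ℝ}
    (hf : Continuous f) (h0 : ∀ x, 0 ≤ f x) :
    ε * Real.log ε ≤ regEntropy L ε f - relEntropy L f := by
  have hmpos : 0 < splay d L := splay_pos d hL
  unfold regEntropy relEntropy
  rw [← integral_sub (integrable_vol_of_continuous (regEntropy_integrand_continuous hL ε hf))
    (integrable_vol_of_continuous (continuous_mul_log_div hf hL)),
    ← integral_const_splay d hL (ε * Real.log ε)]
  refine integral_mono (integrable_const _)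
    ((integrable_vol_of_continuous (regEntropy_integrand_continuous hL ε hf)).sub
    (integrable_vol_of_continuous (continuous_mul_log_div hf hL))) fun x => ?_
  have := mul_le_mul_of_nonneg_left
    (mul_log_le_add_mul_log_sub (div_nonneg (h0 x) hmpos.le) hε) hmpos.le
  have e : (f x + ε * splay d L) / splay d L = f x / splay d L + ε := by field_simp
  simp only [e]
  convert this using 1
  · ring
  · field_simp

lemma integral_abs_sub_splay_le (hL : 0 < L) {f : E d → ℝ} (hf : Integrable f (vol d L))
    (h0 : 0 ≤ᵐ[vol d L] f) (h1 : ∫ x, f x ∂(vol d L) = 1) :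
    ∫ x, |f x - splay d L| ∂(vol d L) ≤ 2 := by
  have hm := integral_const_splay d hL 1
  rw [one_mul] at hm
  have h : ∫ x, (f x + splay d L) ∂(vol d L) = 2 := by
    rw [integral_add hf (integrable_const _), h1, hm]; norm_num
  rw [← h]
  refine integral_mono_ae (hf.sub (integrable_const _)).abs (hf.add (integrable_const _)) ?_
  filter_upwards [h0] with x hx
  have := splay_pos d hL
  exact abs_le.2 ⟨by simp at hx; linarith, by linarith⟩

/-- The function `r - ε ρ_∞ log ((r + ε ρ_∞) / ρ_∞)` approximates `r` up to an additive constant. -/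
lemma integral_abs_reg_le (hL : 0 < L) {ε : ℝ} (hε : 0 < ε) {f : E d → ℝ} (hf : Continuous f)
    (h0 : ∀ x, 0 ≤ f x) (h1 : ∫ x, f x ∂(vol d L) = 1) :
    ∫ x, |f x - ε * splay d L * Real.log ((f x + ε * splay d L) / splay d L)
        - (splay d L - ε * splay d L * Real.log ε)| ∂(vol d L) ≤
      ∫ x, |f x - splay d L| ∂(vol d L) + 2 * √ε := by
  have hmpos : 0 < splay d L := splay_pos d hL
  have hm := integral_const_splay d hL 1
  rw [one_mul] at hm
  have hpos : ∀ x, 0 < (f x + ε * splay d L) / splay d L := fun x =>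
    div_pos (by have := h0 x; positivity) hmpos
  have hlog : Continuous fun x => Real.log ((f x + ε * splay d L) / splay d L) :=
    ((hf.add continuous_const).div_const _).log fun x => (hpos x).ne'
  have h : ∫ x, (|f x - splay d L| + √ε * (f x + splay d L)) ∂(vol d L) =
      ∫ x, |f x - splay d L| ∂(vol d L) + 2 * √ε := by
    rw [integral_add (integrable_vol_of_continuous (by fun_prop))
      (integrable_vol_of_continuous (by fun_prop)), integral_const_mul,
      integral_add (integrable_vol_of_continuous hf) (integrable_const _), h1, hm]
    ring
  rw [← h]
  refine integral_mono (integrable_vol_of_continuous (by fun_prop))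
    (integrable_vol_of_continuous (by fun_prop)) fun x => ?_
  set m := splay d L with hmdef
  set y := f x / (ε * m) with hy
  have hy0 : 0 ≤ y := div_nonneg (h0 x) (by positivity)
  have e1 : (f x + ε * m) / m = ε * (1 + y) := by rw [hy]; field_simp; ring
  have e2 : Real.log ((f x + ε * m) / m) = Real.log ε + Real.log (1 + y) := by
    rw [e1, Real.log_mul hε.ne' (by positivity)]
  have e3 : f x - ε * m * Real.log ((f x + ε * m) / m) - (m - ε * m * Real.log ε) =
      (f x - m) - ε * m * Real.log (1 + y) := by rw [e2]; ring
  -- Combines `log (1 + y) ≤ 2√y` with `2√(εy) ≤ 1 + εy`, the latter written as an exact square.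
  have h3 : ε * m * Real.log (1 + y) ≤ √ε * (f x + m) := by
    refine (mul_le_mul_of_nonneg_left (log_one_add_le_two_mul_sqrt hy0) (by positivity)).trans ?_
    have hs := Real.sqrt_nonneg y
    have hsy := Real.sq_sqrt hy0
    have hse := Real.sq_sqrt hε.le
    have hse0 := Real.sqrt_pos.2 hε
    have hfx : f x = ε * m * y := by rw [hy]; field_simp
    rw [hfx]
    have : √ε * (ε * m * y + m) - ε * m * (2 * √y) = √ε * m * (√ε * √y - 1) ^ 2 := by
      have e4 : √ε * m * (√ε * √y - 1) ^ 2 = √ε * m * (√ε ^ 2 * √y ^ 2) - √ε ^ 2 * m * (2 * √y) +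
        √ε * m := by ring
      rw [e4, hsy, hse]; ring
    have h5 : 0 ≤ √ε * m * (√ε * √y - 1) ^ 2 := by positivity
    linarith
  have h4 : 0 ≤ ε * m * Real.log (1 + y) :=
    mul_nonneg (by positivity) (Real.log_nonneg (by linarith))
  simp only
  rw [e3]
  refine (abs_sub _ _).trans ?_
  rw [abs_of_nonneg h4]
  linarith

end EntropyInequalities

/-! ### The interaction term -/

section Interaction

variable {d : ℕ} {L : ℝ}

lemma ae_abs_le_eLpNorm_top {α : Type*} [MeasurableSpace α] {ν : Measure α} {f : α → ℝ}
    (h : MemLp f ⊤ ν) : ∀ᵐ x ∂ν, |f x| ≤ (eLpNorm f ⊤ ν).toReal := by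
  filter_upwards [ae_le_eLpNormEssSup (f := f) (μ := ν)] with x hx
  rw [← eLpNorm_exponent_top] at hx
  have := ENNReal.toReal_mono h.2.ne hx
  rwa [toReal_enorm, Real.norm_eq_abs] at this

-- Puts the derivative on the mollifier, in the integral form to which the weak derivative of `g`
-- applies.
open scoped Convolution in
lemma fderiv_convolution_apply {φ g : E d → ℝ} (hφ : ContDiff ℝ ∞ φ) (hφc : HasCompactSupport φ)
    (hg : LocallyIntegrable g) (x v : E d) :
    HasFDerivAt (φ ⋆[ContinuousLinearMap.lsmul ℝ ℝ, volume] g)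
      ((fderiv ℝ φ ⋆[(ContinuousLinearMap.lsmul ℝ ℝ).precompL (E d), volume] g) x) x ∧
    ((fderiv ℝ φ ⋆[(ContinuousLinearMap.lsmul ℝ ℝ).precompL (E d), volume] g) x) v =
      ∫ t, fderiv ℝ φ (x - t) v * g t := by
  have hφ1 : ContDiff ℝ 1 φ := hφ.of_le (by exact_mod_cast le_top)
  refine ⟨hφc.hasFDerivAt_convolution_left _ hφ1 hg x, ?_⟩
  have hint : ConvolutionExistsAt (fderiv ℝ φ) g x
      ((ContinuousLinearMap.lsmul ℝ ℝ).precompL (E d)) volume :=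
    (hφc.fderiv ℝ).convolutionExists_left _ (hφ1.continuous_fderiv one_ne_zero) hg x
  rw [convolution_def, ContinuousLinearMap.integral_apply hint]
  rw [← integral_sub_left_eq_self (fun t => fderiv ℝ φ (x - t) v * g t) volume x]
  refine integral_congr_ae (Eventually.of_forall fun t => ?_)
  simp [ContinuousLinearMap.precompL_apply]

/-- A bounded function with bounded weak partial derivatives has a Lipschitz representative. -/
lemma exists_lipschitz_representative {g : E d → ℝ} {g' : Fin d → E d → ℝ}
    (hg : MemLp g ⊤ volume) (hg' : ∀ j, MemLp (g' j) ⊤ volume)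
    (hw : ∀ j, ∀ φ : E d → ℝ, ContDiff ℝ ∞ φ → HasCompactSupport φ →
      ∫ x, g x * fderiv ℝ φ x (e j) = -∫ x, g' j x * φ x) :
    ∃ (G : E d → ℝ) (K : NNReal), LipschitzWith K G ∧ G =ᵐ[volume] g := by
  have hgl : LocallyIntegrable g := hg.locallyIntegrable le_top
  let C : Fin d → ℝ := fun j => (eLpNorm (g' j) ⊤ volume).toReal
  have hC : ∀ j, ∀ᵐ x, |g' j x| ≤ C j := by
    exact fun j => ae_abs_le_eLpNorm_top (hg' j)
  let φ : ℕ → ContDiffBump (0 : E d) := fun n =>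
    ⟨1 / (n + 1), 2 / (n + 1), by positivity, by gcongr; norm_num⟩
  have hφ0 : Tendsto (fun n => (φ n).rOut) atTop (𝓝 0) := by
    have := (tendsto_one_div_add_atTop_nhds_zero_nat (𝕜 := ℝ)).const_mul 2
    simpa only [φ, mul_one_div, mul_zero] using this
  have hae := ContDiffBump.ae_convolution_tendsto_right_of_locallyIntegrable (K := 2)
    (μ := (volume : Measure (E d))) hφ0
    (Eventually.of_forall fun n => le_of_eq (by simp [φ]; ring)) hgl
  let u : ℕ → E d → ℝ := fun n =>
    convolution ((φ n).normed volume) g (ContinuousLinearMap.lsmul ℝ ℝ) volume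
  let K : ℝ := ∑ j, C j
  have hC0 : ∀ j, 0 ≤ C j := fun j => ENNReal.toReal_nonneg
  have hK0 : 0 ≤ K := Finset.sum_nonneg fun j _ => hC0 j
  -- The Lipschitz constant is independent of `n`: a partial derivative of the mollification is an
  -- average of `g' j`, hence bounded by `C j`.
  have hlip : ∀ n, LipschitzWith K.toNNReal (u n) := by
    intro n
    set ψ := (φ n).normed volume with hψ
    have hψs : ContDiff ℝ ∞ ψ := (φ n).contDiff_normed
    have hψc : HasCompactSupport ψ := (φ n).hasCompactSupport_normed
    have hd := fun x v => fderiv_convolution_apply hψs hψc hgl x v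
    refine lipschitzWith_of_nnnorm_fderiv_le (𝕜 := ℝ) (fun x => (hd x 0).1.differentiableAt) ?_
    intro x
    rw [(hd x 0).1.fderiv, ← NNReal.coe_le_coe, coe_nnnorm, Real.coe_toNNReal K hK0]
    have hcoord : ∀ j, |((convolution (fderiv ℝ ψ) g
        ((ContinuousLinearMap.lsmul ℝ ℝ).precompL (E d)) volume) x) (e j)| ≤ C j := by
      intro j
      rw [(hd x (e j)).2]
      have hψx : ContDiff ℝ ∞ (fun t => ψ (x - t)) := hψs.comp (contDiff_const.sub contDiff_id)
      have hψxc : HasCompactSupport (fun t => ψ (x - t)) :=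
        hψc.comp_homeomorph (Homeomorph.subLeft x)
      have h1 := hw j _ hψx hψxc
      have h2 : ∀ t, fderiv ℝ (fun t => ψ (x - t)) t (e j) = -fderiv ℝ ψ (x - t) (e j) := by
        intro t
        have hdψ : HasFDerivAt ψ (fderiv ℝ ψ (x - t)) (x - t) :=
          (hψs.differentiable (by simp)).differentiableAt.hasFDerivAt
        have := hdψ.comp t ((hasFDerivAt_id t).const_sub x)
        have h3 : fderiv ℝ (fun t => ψ (x - t)) t = _ := this.fderiv
        rw [h3]
        simp
      simp only [h2, mul_neg, integral_neg, neg_inj] at h1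
      simp only [mul_comm (fderiv ℝ ψ _ _)]
      rw [h1]
      have hψint : Integrable (fun t => ψ (x - t)) :=
        hψx.continuous.integrable_of_hasCompactSupport hψxc
      have hψ1 : ∫ t, ψ (x - t) = 1 := by
        rw [integral_sub_left_eq_self ψ volume x]
        exact (φ n).integral_normed
      have hnn : ∀ t, 0 ≤ ψ (x - t) := fun t => (φ n).nonneg_normed _
      calc |∫ t, g' j t * ψ (x - t)| ≤ ∫ t, C j * ψ (x - t) := by
            rw [← Real.norm_eq_abs]
            refine norm_integral_le_of_norm_le (hψint.const_mul _) ?_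
            filter_upwards [hC j] with t ht
            rw [Real.norm_eq_abs, abs_mul, abs_of_nonneg (hnn t)]
            exact mul_le_mul_of_nonneg_right ht (hnn t)
        _ = C j := by rw [integral_const_mul, hψ1, mul_one]
    refine ContinuousLinearMap.opNorm_le_bound _ hK0 fun v => ?_
    have hv : v = ∑ j, v j • e j := by
      ext k
      simp [Finset.sum_apply, e_apply]
    conv_lhs => rw [hv]
    rw [map_sum, Finset.sum_mul]
    refine (norm_sum_le _ _).trans (Finset.sum_le_sum fun j _ => ?_)
    rw [map_smul, norm_smul, mul_comm]
    exact mul_le_mul (hcoord j) (PiLp.norm_apply_le v j) (norm_nonneg _) (hC0 j)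
  -- The Lipschitz bound survives the limit wherever the mollifications converge to `g`, which is
  -- almost everywhere; a real Lipschitz function extends from any subset.
  have hlipOn : LipschitzOnWith K.toNNReal g {x | Tendsto (fun n => u n x) atTop (𝓝 (g x))} := by
    refine LipschitzOnWith.of_dist_le_mul fun x hx y hy => ?_
    exact le_of_tendsto (hx.dist hy) (Eventually.of_forall fun n => (hlip n).dist_le_mul x y)
  obtain ⟨G, hG, hGe⟩ := hlipOn.extend_real
  refine ⟨G, _, hG, ?_⟩
  filter_upwards [hae] with x hx
  exact (hGe hx).symm

lemma weakPartial_spec {D : E d → ℝ} (hD : MemSobolev L 2 ⊤ D) {m : ℕ} (hm : m ≤ 2)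
    (s : Fin m → Fin d) : IsWeakPartial L ⊤ s D (weakPartial L ⊤ s D) :=
  Classical.epsilon_spec (hD.2.2 m hm s)

/-- The second weak derivative is defined directly from `D`. Testing the first one against `∂_j φ`
shows that the second is also a weak derivative of the first. -/
lemma weakPartial_by_parts {D : E d → ℝ} (hD : MemSobolev L 2 ⊤ D) (i j : Fin d) {φ : E d → ℝ}
    (hφ : ContDiff ℝ ∞ φ) (hφc : HasCompactSupport φ) :
    ∫ x, weakPartial L ⊤ ![i] D x * fderiv ℝ φ x (e j) =
      -∫ x, weakPartial L ⊤ ![i, j] D x * φ x := by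
  have hψ : ContDiff ℝ ∞ (fun x => fderiv ℝ φ x (e j)) :=
    (hφ.fderiv_right (m := ∞) (by simp)).clm_apply contDiff_const
  have hψc : HasCompactSupport (fun x => fderiv ℝ φ x (e j)) := hφc.fderiv_apply (𝕜 := ℝ) (e j)
  have h1 := (weakPartial_spec hD one_le_two ![i]).2.2 _ hψ hψc
  have h2 := (weakPartial_spec hD le_rfl ![i, j]).2.2 φ hφ hφc
  have h3 : ∀ x, iteratedFDeriv ℝ 1 (fun x => fderiv ℝ φ x (e j)) x (fun k => e (![i] k)) =
      iteratedFDeriv ℝ 2 φ x (fun k => e (![i, j] k)) := by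
    intro x
    rw [iteratedFDeriv_one_apply, iteratedFDeriv_two_apply]
    have hd : DifferentiableAt ℝ (fderiv ℝ φ) x :=
      ((hφ.fderiv_right (m := ∞) (by simp)).differentiable (by simp)).differentiableAt
    rw [fderiv_clm_apply hd (differentiableAt_const _)]
    simp
  simp only [h3] at h1
  rw [h1] at h2
  simp only [pow_one, neg_mul, one_mul, even_two, Even.neg_pow, one_pow] at h2
  linarith

/-- Lipschitz representative of the gradient of `D ∈ W^{2,∞}`. -/
lemma exists_lipschitz_grad (hL : 0 < L) {D : E d → ℝ} (hD : MemSobolev L 2 ⊤ D) (i : Fin d) :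
    ∃ (G : E d → ℝ) (K : NNReal), LipschitzWith K G ∧ IsPeriodic L G ∧
      G =ᵐ[volume] weakPartial L ⊤ ![i] D ∧
      ∀ᵐ x, lineDeriv ℝ G x (e i) = weakPartial L ⊤ ![i, i] D x := by
  have hmem1 : MemLp (weakPartial L ⊤ ![i] D) ⊤ volume :=
    (weakPartial_spec hD one_le_two ![i]).1.memLp_top hL (weakPartial_spec hD one_le_two ![i]).2.1
  have hmem2 : ∀ j, MemLp (weakPartial L ⊤ ![i, j] D) ⊤ volume := fun j =>
    (weakPartial_spec hD le_rfl ![i, j]).1.memLp_top hL (weakPartial_spec hD le_rfl ![i, j]).2.1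
  obtain ⟨G, K, hG, hGe⟩ := exists_lipschitz_representative hmem1 hmem2
    (fun j φ hφ hφc => weakPartial_by_parts hD i j hφ hφc)
  refine ⟨G, K, hG, ?_, hGe, ?_⟩
  · intro x k
    -- Almost everywhere periodicity suffices, because `G` is continuous and Lebesgue measure
    -- charges every open set.
    have hae : (fun x => G (x + L • e k)) =ᵐ[volume] G := by
      have h1 := (measurePreserving_add_right (volume : Measure (E d))
        (L • e k)).quasiMeasurePreserving.ae_eq_comp hGe
      filter_upwards [h1, hGe] with x hx hx2
      simp only [Function.comp_apply] at hx
      rw [hx, (weakPartial_spec hD one_le_two ![i]).1 x k, hx2]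
    exact congrFun ((hG.continuous.comp (continuous_id.add continuous_const)).ae_eq_iff_eq volume
      hG.continuous |>.1 hae) x
  -- Both functions have the same integral against every test function: a Lipschitz function can be
  -- integrated by parts with its pointwise line derivative.
  · refine ae_eq_of_integral_contDiff_smul_eq (hG.locallyIntegrable_lineDeriv _)
      ((hmem2 i).locallyIntegrable le_top) fun φ hφ hφc => ?_
    have hφ1 : ContDiff ℝ 1 φ := hφ.of_le (by exact_mod_cast le_top)
    obtain ⟨Kφ, hKφ⟩ := hφ1.lipschitzWith_of_hasCompactSupport hφc one_ne_zero
    have h1 := hG.integral_lineDeriv_mul_eq (μ := volume) hKφ hφc (e i)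
    have h2 := weakPartial_by_parts hD i i hφ hφc
    have h3 : ∫ x, lineDeriv ℝ φ x (-e i) * G x =
        -∫ x, weakPartial L ⊤ ![i] D x * fderiv ℝ φ x (e i) := by
      rw [← integral_neg]
      refine integral_congr_ae ?_
      filter_upwards [hGe] with x hx
      rw [hx, ((hφ1.differentiable one_ne_zero).differentiableAt).lineDeriv_eq_fderiv, map_neg]
      ring
    simp only [smul_eq_mul, mul_comm (φ _)]
    rw [h1, h3, h2, neg_neg]

lemma measurable_weakLaplacian (hL : 0 < L) {D : E d → ℝ} (hD : MemSobolev L 2 ⊤ D) :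
    MemLp (weakLaplacian L D) ⊤ (volume : Measure (E d)) := by
  unfold weakLaplacian
  exact memLp_finsetSum _ fun i _ => (weakPartial_spec hD le_rfl ![i, i]).1.memLp_top hL
    (weakPartial_spec hD le_rfl ![i, i]).2.1

lemma isPeriodic_weakLaplacian {D : E d → ℝ} (hD : MemSobolev L 2 ⊤ D) :
    IsPeriodic L (weakLaplacian L D) := by
  intro x k
  unfold weakLaplacian
  exact Finset.sum_congr rfl fun i _ => (weakPartial_spec hD le_rfl ![i, i]).1 x k

lemma ae_abs_weakLaplacian_le (hL : 0 < L) {D : E d → ℝ} (hD : MemSobolev L 2 ⊤ D) :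
    ∀ᵐ x, |weakLaplacian L D x| ≤ normLaplacian L D := by
  refine ae_of_ae_vol hL (fun x i => by rw [isPeriodic_weakLaplacian hD x i]) ?_
  have hmem : MemLp (weakLaplacian L D) ⊤ (vol d L) :=
    (measurable_weakLaplacian hL hD).restrict _
  exact ae_abs_le_eLpNorm_top hmem

lemma ae_vol_sub_left {p : E d → Prop} (h : ∀ᵐ x, p x) (x : E d) : ∀ᵐ y ∂(vol d L), p (x - y) :=
  ae_restrict_of_ae ((Measure.measurePreserving_sub_left (volume : Measure (E d))
    x).quasiMeasurePreserving.ae h)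

lemma aestronglyMeasurable_sub_left {f : E d → ℝ} (h : AEStronglyMeasurable f volume) (x : E d) :
    AEStronglyMeasurable (fun y => f (x - y)) (vol d L) :=
  (h.comp_quasiMeasurePreserving (Measure.measurePreserving_sub_left (volume : Measure (E d))
    x).quasiMeasurePreserving).restrict

/-- The divergence `∫_U ΔD(x - y) w(y) dy` of the interaction term. -/
noncomputable def interactionDiv (L : ℝ) (D w : E d → ℝ) (x : E d) : ℝ :=
  ∫ y, w y * weakLaplacian L D (x - y) ∂(vol d L)

/-- Allows the arbitrary representative of `∇D` in `weakGrad` to be exchanged for the Lipschitz one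
under the integral. -/
lemma interaction_apply_ae {D w G : E d → ℝ} {i : Fin d} (hL : 0 < L) (hD : MemSobolev L 2 ⊤ D)
    (hw : Integrable w (vol d L)) (hGe : G =ᵐ[volume] weakPartial L ⊤ ![i] D) (x : E d) :
    interaction L D w x i = ∫ y, w y * G (x - y) ∂(vol d L) := by
  have hmem : ∀ k, MemLp (weakPartial L ⊤ ![k] D) ⊤ volume := fun k =>
    (weakPartial_spec hD one_le_two ![k]).1.memLp_top hL (weakPartial_spec hD one_le_two ![k]).2.1
  have hint : Integrable (fun y => w y • weakGrad L D (x - y)) (vol d L) := by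
    refine Integrable.of_eval_piLp fun k => ?_
    have hk : Integrable (fun y => weakPartial L ⊤ ![k] D (x - y) * w y) (vol d L) := by
      refine Integrable.bdd_mul hw (aestronglyMeasurable_sub_left (hmem k).1 x)
        (c := (eLpNorm (weakPartial L ⊤ ![k] D) ⊤ volume).toReal) ?_
      exact ae_vol_sub_left (ae_abs_le_eLpNorm_top (hmem k)) x
    refine hk.congr (Eventually.of_forall fun y => ?_)
    simp [weakGrad, mul_comm]
  have h1 := (EuclideanSpace.proj (𝕜 := ℝ) i).integral_comp_comm hint
  have h2 : interaction L D w x i = EuclideanSpace.proj (𝕜 := ℝ) i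
    (∫ y, w y • weakGrad L D (x - y) ∂(vol d L)) := rfl
  rw [h2, ← h1]
  refine integral_congr_ae ?_
  filter_upwards [ae_vol_sub_left hGe x] with y hy
  simp [weakGrad, hy]

/-- The properties of the interaction term that the entropy estimate uses. -/
structure InteractionRegular (L : ℝ) (D w : E d → ℝ) : Prop where
  differentiable : ∀ i, Differentiable ℝ fun x => interaction L D w x i
  periodic : ∀ i, IsPeriodic L fun x => interaction L D w x i
  bound : ∃ C, ∀ i x, |interaction L D w x i| ≤ C
  bound_deriv : ∃ C, ∀ i x, |fderiv ℝ (fun x => interaction L D w x i) x (e i)| ≤ C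
  div : ∀ x, ∑ i, fderiv ℝ (fun x => interaction L D w x i) x (e i) = interactionDiv L D w x

lemma interactionRegular (hL : 0 < L) {D w : E d → ℝ} (hD : MemSobolev L 2 ⊤ D)
    (hw : Integrable w (vol d L)) : InteractionRegular L D w := by
  choose G K hG hGper hGe hGd using exists_lipschitz_grad hL hD
  have hI : ∀ i x, interaction L D w x i = ∫ y, w y * G i (x - y) ∂(vol d L) := fun i x =>
    interaction_apply_ae hL hD hw (hGe i) x
  have hbG : ∀ i, ∃ C, ∀ x, |G i x| ≤ C := fun i => (hGper i).exists_bound hL (hG i).continuous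
  choose B hB using hbG
  have hmeas : ∀ i x, AEStronglyMeasurable (fun y => w y * G i (x - y)) (vol d L) := fun i x =>
    hw.1.mul ((hG i).continuous.comp (by fun_prop)).aestronglyMeasurable
  have hint : ∀ i x, Integrable (fun y => w y * G i (x - y)) (vol d L) := fun i x => by
    refine (hw.bdd_mul (c := B i) ((hG i).continuous.comp (by fun_prop :
      Continuous fun y => x - y)).aestronglyMeasurable
      (Eventually.of_forall fun y => hB i _)).congr ?_
    exact Eventually.of_forall fun y => by simp [mul_comm]
  have hder : ∀ i x, Integrable (fun y => w y • fderiv ℝ (G i) (x - y)) (vol d L) ∧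
      HasFDerivAt (fun x => ∫ y, w y * G i (x - y) ∂(vol d L))
        (∫ y, w y • fderiv ℝ (G i) (x - y) ∂(vol d L)) x := by
    intro i x
    -- The Lipschitz constant of the kernel gives domination, and Rademacher's theorem gives
    -- differentiability at `x - y` for almost every `y`.
    refine hasFDerivAt_integral_of_dominated_loc_of_lip (s := univ)
      (bound := fun y => K i * |w y|) univ_mem
      (Eventually.of_forall fun x => hmeas i x) (hint i x) ?_ ?_ (hw.abs.const_mul _) ?_
    · exact hw.1.smul ((measurable_fderiv ℝ (G i)).comp (by fun_prop)).aestronglyMeasurable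
    · refine Eventually.of_forall fun y => LipschitzOnWith.of_dist_le_mul fun a _ b _ => ?_
      rw [Real.dist_eq, ← mul_sub, abs_mul]
      have h1 := (hG i).dist_le_mul (a - y) (b - y)
      rw [Real.dist_eq, dist_sub_right] at h1
      have h2 : ((Real.nnabs (K i * |w y|) : NNReal) : ℝ) = K i * |w y| := by
        simp
      rw [h2]
      nlinarith [abs_nonneg (w y), mul_le_mul_of_nonneg_left h1 (abs_nonneg (w y))]
    · filter_upwards [ae_vol_sub_left (L := L) (hG i).ae_differentiableAt x] with y hy
      have h1 : HasFDerivAt (fun a => G i (a - y)) (fderiv ℝ (G i) (x - y)) x := by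
        have := hy.hasFDerivAt.comp x ((hasFDerivAt_id x).sub_const y)
        simpa [Function.comp_def] using this
      exact h1.const_mul (w y)
  have hIf : ∀ i, (fun x => interaction L D w x i) =
      fun x => ∫ y, w y * G i (x - y) ∂(vol d L) := fun i => funext (hI i)
  have hfd : ∀ i x, fderiv ℝ (fun x => interaction L D w x i) x (e i) =
      ∫ y, w y * weakPartial L ⊤ ![i, i] D (x - y) ∂(vol d L) := by
    intro i x
    rw [hIf, (hder i x).2.fderiv, ContinuousLinearMap.integral_apply (hder i x).1]
    refine integral_congr_ae ?_
    filter_upwards [ae_vol_sub_left (L := L) (hG i).ae_differentiableAt x,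
      ae_vol_sub_left (L := L) (hGd i) x] with y hy1 hy2
    rw [_root_.smul_apply, smul_eq_mul, ← hy1.lineDeriv_eq_fderiv, hy2]
  have hmem2 : ∀ i, MemLp (weakPartial L ⊤ ![i, i] D) ⊤ volume := fun i =>
    (weakPartial_spec hD le_rfl ![i, i]).1.memLp_top hL (weakPartial_spec hD le_rfl ![i, i]).2.1
  have hae2 : ∀ i, ∀ᵐ z, ‖weakPartial L ⊤ ![i, i] D z‖ ≤
      (eLpNorm (weakPartial L ⊤ ![i, i] D) ⊤ volume).toReal :=
    fun i => ae_abs_le_eLpNorm_top (hmem2 i)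
  refine ⟨fun i => ?_, fun i x k => ?_, ?_, ?_, fun x => ?_⟩
  · rw [hIf]
    exact fun x => (hder i x).2.differentiableAt
  · simp only [hI]
    refine integral_congr_ae (Eventually.of_forall fun y => ?_)
    simp only
    rw [add_sub_right_comm, hGper i]
  · refine ⟨∑ j, |B j| * ∫ y, |w y| ∂(vol d L), fun i x => ?_⟩
    have h1 : |interaction L D w x i| ≤ |B i| * ∫ y, |w y| ∂(vol d L) := by
      rw [hI, ← integral_const_mul, ← Real.norm_eq_abs]
      refine norm_integral_le_of_norm_le (hw.abs.const_mul _) (Eventually.of_forall fun y => ?_)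
      rw [Real.norm_eq_abs, abs_mul, mul_comm]
      exact mul_le_mul_of_nonneg_right ((hB i _).trans (le_abs_self _)) (abs_nonneg _)
    exact h1.trans (Finset.single_le_sum (f := fun j => |B j| * ∫ y, |w y| ∂(vol d L))
      (fun j _ => mul_nonneg (abs_nonneg _) (integral_nonneg fun y => abs_nonneg _))
      (Finset.mem_univ i))
  · set Q : Fin d → ℝ := fun j => (eLpNorm (weakPartial L ⊤ ![j, j] D) ⊤ volume).toReal with hQ
    refine ⟨∑ j, Q j * ∫ y, |w y| ∂(vol d L), fun i x => ?_⟩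
    have h1 : |fderiv ℝ (fun x => interaction L D w x i) x (e i)| ≤
        Q i * ∫ y, |w y| ∂(vol d L) := by
      rw [hfd, ← integral_const_mul, ← Real.norm_eq_abs]
      refine norm_integral_le_of_norm_le (hw.abs.const_mul _) ?_
      filter_upwards [ae_vol_sub_left (L := L) (hae2 i) x] with y hy
      rw [Real.norm_eq_abs, abs_mul, mul_comm]
      exact mul_le_mul_of_nonneg_right hy (abs_nonneg _)
    exact h1.trans (Finset.single_le_sum (f := fun j => Q j * ∫ y, |w y| ∂(vol d L))
      (fun j _ => mul_nonneg ENNReal.toReal_nonneg (integral_nonneg fun y => abs_nonneg _))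
      (Finset.mem_univ i))
  · simp only [hfd]
    rw [← integral_finsetSum]
    · refine integral_congr_ae (Eventually.of_forall fun y => ?_)
      simp only [weakLaplacian, Finset.mul_sum]
    · intro i _
      refine (hw.bdd_mul (aestronglyMeasurable_sub_left (hmem2 i).1 x)
        (ae_vol_sub_left (hae2 i) x)).congr ?_
      exact Eventually.of_forall fun y => by simp [mul_comm]

/-- A divergence has mean zero on the torus. This is what allows a constant to be subtracted from
the factor containing `ρ`. -/
lemma integral_interactionDiv (hL : 0 < L) {D w : E d → ℝ} (hD : MemSobolev L 2 ⊤ D)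
    (hw : Integrable w (vol d L)) : ∫ x, interactionDiv L D w x ∂(vol d L) = 0 := by
  have hR := interactionRegular hL hD hw
  obtain ⟨C, hC⟩ := hR.bound_deriv
  simp only [← hR.div]
  rw [integral_finsetSum]
  · refine Finset.sum_eq_zero fun i _ => ?_
    exact integral_partial_eq_zero hL (hR.periodic i) (hR.differentiable i).continuous i
      (fun x => ((hR.differentiable i) x).hasFDerivAt.hasLineDerivAt (e i)) (hC i)
  · intro i _
    refine Integrable.of_bound (measurable_fderiv_apply_const ℝ _ _).aestronglyMeasurable C
      (Eventually.of_forall fun x => hC i x)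

/-- With weight one the interaction term is constant in `x` by translation invariance, so its
divergence vanishes. This is what allows a constant to be subtracted from `w`. -/
lemma integral_weakLaplacian_sub (hL : 0 < L) {D : E d → ℝ} (hD : MemSobolev L 2 ⊤ D) (x : E d) :
    ∫ y, weakLaplacian L D (x - y) ∂(vol d L) = 0 := by
  have hR := interactionRegular hL hD (w := fun _ => 1) (integrable_const _)
  choose G K hG hGper hGe hGd using exists_lipschitz_grad hL hD
  have h1 : ∫ y, weakLaplacian L D (x - y) ∂(vol d L) = interactionDiv L D (fun _ => 1) x := by
    simp [interactionDiv]
  rw [h1, ← hR.div]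
  refine Finset.sum_eq_zero fun i _ => ?_
  have hconst : (fun x => interaction L D (fun _ => 1) x i) =
      fun _ => interaction L D (fun _ => 1) 0 i := by
    funext x
    rw [interaction_apply_ae hL hD (integrable_const _) (hGe i),
      interaction_apply_ae hL hD (integrable_const _) (hGe i)]
    have hper : IsPeriodic L fun y => G i (x - y) := by
      intro y k
      have := hGper i (x - (y + L • e k)) k
      simp only
      rw [← this]
      congr 1
      abel
    have := hper.integral_comp_add hL x
    simp only [one_mul]
    rw [← this]
    refine integral_congr_ae (Eventually.of_forall fun y => ?_)
    simp
  rw [hconst]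
  simp

lemma abs_interactionDiv_le (hL : 0 < L) {D w : E d → ℝ} (hD : MemSobolev L 2 ⊤ D)
    (hw : Integrable w (vol d L)) (s : ℝ) (x : E d) :
    |interactionDiv L D w x| ≤ normLaplacian L D * ∫ y, |w y - s| ∂(vol d L) := by
  have hbd := ae_vol_sub_left (L := L) (ae_abs_weakLaplacian_le hL hD) x
  have hm := aestronglyMeasurable_sub_left (L := L) (measurable_weakLaplacian hL hD).1 x
  have hi : ∀ v : E d → ℝ, Integrable v (vol d L) →
      Integrable (fun y => v y * weakLaplacian L D (x - y)) (vol d L) := fun v hv =>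
    (hv.bdd_mul hm hbd).congr (Eventually.of_forall fun y => by simp [mul_comm])
  have h1 : interactionDiv L D w x = ∫ y, (w y - s) * weakLaplacian L D (x - y) ∂(vol d L) := by
    simp only [sub_mul]
    rw [integral_sub (hi w hw) (hi _ (integrable_const s)), integral_const_mul,
      integral_weakLaplacian_sub hL hD, mul_zero, sub_zero]
    rfl
  rw [h1, ← integral_const_mul, ← Real.norm_eq_abs]
  refine norm_integral_le_of_norm_le ((hw.sub (integrable_const s)).abs.const_mul _) ?_
  filter_upwards [hbd] with y hy
  rw [Real.norm_eq_abs, abs_mul, mul_comm]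
  exact mul_le_mul_of_nonneg_right hy (abs_nonneg _)

end Interaction

/-! ### Entropy dissipation at a fixed `ξ` -/

section Dissipation

variable {d : ℕ} {L : ℝ}

lemma continuousOn_integral_vol {S : Set ℝ} (hS : IsLocallyClosed S) {f : ℝ × E d → ℝ}
    (hf : ContinuousOn f (S ×ˢ univ)) :
    ContinuousOn (fun t => ∫ x, f (t, x) ∂(vol d L)) S := by
  have := hS.locallyCompactSpace
  rw [continuousOn_iff_continuous_domRestrict]
  have hc : Continuous (Function.uncurry fun (t : S) (x : E d) => f (t, x)) :=
    hf.comp_continuous (by fun_prop) fun p => ⟨p.1.2, trivial⟩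
  exact continuous_parametric_integral_of_continuous (μ := volume) hc (isCompact_box d L)

lemma continuous_slice {S : Set ℝ} {f : ℝ × E d → ℝ} (hf : ContinuousOn f (S ×ˢ univ)) {t : ℝ}
    (ht : t ∈ S) : Continuous fun x => f (t, x) :=
  hf.comp_continuous (by fun_prop) fun _ => ⟨ht, trivial⟩

/-- Differentiation under the integral over the torus. -/
lemma hasDerivAt_integral_vol {f f' : ℝ × E d → ℝ} (hf : ContinuousOn f (Ioi 0 ×ˢ univ))
    (hf' : ContinuousOn f' (Ioi 0 ×ˢ univ))
    (hd : ∀ t > 0, ∀ x, HasDerivAt (fun s => f (s, x)) (f' (t, x)) t) {t : ℝ} (ht : 0 < t) :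
    HasDerivAt (fun s => ∫ x, f (s, x) ∂(vol d L)) (∫ x, f' (t, x) ∂(vol d L)) t := by
  have hcomp : IsCompact (Icc (t / 2) (2 * t) ×ˢ box d L) := isCompact_Icc.prod (isCompact_box d L)
  have hsub : Icc (t / 2) (2 * t) ×ˢ box d L ⊆ Ioi 0 ×ˢ univ := fun p hp =>
    ⟨lt_of_lt_of_le (by positivity : 0 < t / 2) hp.1.1, trivial⟩
  obtain ⟨C, hC⟩ := hcomp.exists_bound_of_continuousOn (hf'.mono hsub)
  refine (hasDerivAt_integral_of_dominated_loc_of_deriv_le (μ := vol d L) (s := Ioo (t / 2) (2 * t))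
    (F := fun s x => f (s, x)) (F' := fun s x => f' (s, x)) (bound := fun _ => C)
    (Ioo_mem_nhds (by linarith) (by linarith)) ?_ ?_ ?_ ?_ (integrable_const C) ?_).2
  · filter_upwards [Ioi_mem_nhds ht] with s hs
    exact (continuous_slice hf hs).aestronglyMeasurable
  · exact integrable_vol_of_continuous (continuous_slice hf ht)
  · exact (continuous_slice hf' ht).aestronglyMeasurable
  · rw [vol, ae_restrict_iff' (measurableSet_box d L)]
    exact Eventually.of_forall fun x hx s hs => hC (s, x) ⟨⟨hs.1.le, hs.2.le⟩, hx⟩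
  · exact Eventually.of_forall fun x s hs => hd s ((by positivity : 0 < t / 2).trans hs.1) x

/-- The properties for almost every `ξ` of a classical solution. -/
structure IsSliceSolution (L κ : ℝ) (D : E d → ℝ) (ρ w : ℝ → E d → ℝ) : Prop where
  periodic : ∀ t ≥ 0, IsPeriodic L (ρ t)
  nonneg : ∀ t ≥ 0, ∀ x, 0 ≤ ρ t x
  initial_mass : ∫ x, ρ 0 x ∂(vol d L) = 1
  continuous : ContinuousOn (fun p : ℝ × E d => ρ p.1 p.2) (Ici 0 ×ˢ univ)
  contDiff : ∀ t > 0, ContDiff ℝ 2 (ρ t)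
  continuous_deriv :
    ContinuousOn (fun p : ℝ × E d => deriv (fun s => ρ s p.2) p.1) (Ioi 0 ×ˢ univ)
  integrable : ∀ t > 0, Integrable (w t) (vol d L)
  equation : ∀ t > 0, ∀ x, HasDerivAt (fun s => ρ s x)
    (κ * divergence (fun y => ρ t y • interaction L D (w t) y) x + (Δ (ρ t)) x) t

lemma IsPeriodic.fderiv_apply {P : E d → ℝ} (hP : IsPeriodic L P) (v : E d) :
    IsPeriodic L (fun x => fderiv ℝ P x v) := by
  intro x i
  have h : (fun y => P (y + L • e i)) = P := funext fun y => hP y i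
  have := fderiv_comp_add_right (𝕜 := ℝ) (f := P) (x := x) (L • e i)
  rw [h] at this
  simp only [this]

lemma fderiv_fderiv_apply {P : E d → ℝ} (hP : ContDiff ℝ 2 P) (v x : E d) :
    HasFDerivAt (fun y => fderiv ℝ P y v)
      ((ContinuousLinearMap.apply ℝ ℝ v).comp (fderiv ℝ (fderiv ℝ P) x)) x := by
  have h1 : DifferentiableAt ℝ (fderiv ℝ P) x :=
    ((hP.fderiv_right (m := 1) (by norm_num)).differentiable one_ne_zero).differentiableAt
  exact (ContinuousLinearMap.apply ℝ ℝ v).hasFDerivAt.comp x h1.hasFDerivAt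

lemma laplacian_apply (P : E d → ℝ) (x : E d) :
    (Δ P) x = ∑ i, fderiv ℝ (fderiv ℝ P) x (e i) (e i) := by
  rw [InnerProductSpace.laplacian_eq_iteratedFDeriv_orthonormalBasis P
    (EuclideanSpace.basisFun (Fin d) ℝ)]
  refine Finset.sum_congr rfl fun i _ => ?_
  rw [iteratedFDeriv_two_apply]
  simp [e]

/-- `∫ ψ'(P) ΔP = -∫ ψ''(P) |∇P|²`. -/
lemma integral_mul_laplacian (hL : 0 < L) {P : E d → ℝ} (hP : ContDiff ℝ 2 P)
    (hper : IsPeriodic L P) (h0 : ∀ x, 0 ≤ P x) {ψ₁ ψ₂ : ℝ → ℝ}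
    (h1 : ∀ r ≥ 0, HasDerivAt ψ₁ (ψ₂ r) r) (h2 : ContinuousOn ψ₂ (Ici 0)) :
    ∫ x, ψ₁ (P x) * (Δ P) x ∂(vol d L) =
      -∑ i, ∫ x, ψ₂ (P x) * fderiv ℝ P x (e i) ^ 2 ∂(vol d L) := by
  have hP1 : Continuous (fderiv ℝ P) := hP.continuous_fderiv (by norm_num)
  have hP2 : Continuous (fderiv ℝ (fderiv ℝ P)) :=
    (hP.fderiv_right (m := 1) (by norm_num)).continuous_fderiv one_ne_zero
  have hψ₁ : Continuous fun x => ψ₁ (P x) :=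
    continuous_iff_continuousAt.2 fun x =>
      (h1 _ (h0 x)).continuousAt.comp (f := P) hP.continuous.continuousAt
  have hψ₂ : Continuous fun x => ψ₂ (P x) := h2.comp_continuous hP.continuous h0
  have hper2 : ∀ i, IsPeriodic L fun x => fderiv ℝ (fderiv ℝ P) x (e i) (e i) := by
    intro i
    have := (hper.fderiv_apply (e i)).fderiv_apply (e i)
    simp only [(fderiv_fderiv_apply hP (e i) _).fderiv] at this
    exact this
  have hp : ∀ i, Continuous fun x => fderiv ℝ P x (e i) := fun i => hP1.clm_apply continuous_const
  have hpp : ∀ i, Continuous fun x => fderiv ℝ (fderiv ℝ P) x (e i) (e i) := fun i =>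
    (hP2.clm_apply continuous_const).clm_apply continuous_const
  have hc1 : ∀ i, Continuous fun x => ψ₂ (P x) * fderiv ℝ P x (e i) ^ 2 := fun i =>
    hψ₂.mul ((hp i).pow 2)
  have hc2 : ∀ i, Continuous fun x => ψ₁ (P x) * fderiv ℝ (fderiv ℝ P) x (e i) (e i) := fun i =>
    hψ₁.mul (hpp i)
  -- The integrand is `∂_i (ψ₁(P) ∂_i P)`.
  have key : ∀ i, ∫ x, (ψ₂ (P x) * fderiv ℝ P x (e i) ^ 2 +
      ψ₁ (P x) * fderiv ℝ (fderiv ℝ P) x (e i) (e i)) ∂(vol d L) = 0 := by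
    intro i
    have hF'c : Continuous fun x => ψ₂ (P x) * fderiv ℝ P x (e i) ^ 2 +
      ψ₁ (P x) * fderiv ℝ (fderiv ℝ P) x (e i) (e i) := (hc1 i).add (hc2 i)
    obtain ⟨C, hC⟩ := IsPeriodic.exists_bound (L := L) (fun x k => by
      have e1 := hper x k
      have e2 := hper.fderiv_apply (e i) x k
      have e3 := hper2 i x k
      simp only at e2 e3
      simp only [e1, e2, e3]) hL hF'c
    refine integral_partial_eq_zero hL (F := fun x => ψ₁ (P x) * fderiv ℝ P x (e i)) ?_
      (hψ₁.mul (hp i)) i (fun x => ?_) hC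
    · intro x k
      have e2 := hper.fderiv_apply (e i) x k
      simp only at e2
      simp only [hper x k, e2]
    · have hPd : HasFDerivAt P (fderiv ℝ P x) x :=
        (hP.differentiable (by norm_num)).differentiableAt.hasFDerivAt
      have hF := ((h1 _ (h0 x)).comp_hasFDerivAt x hPd).mul (fderiv_fderiv_apply hP (e i) x)
      have := hF.hasLineDerivAt (e i)
      refine this.congr_deriv ?_
      simp
      ring
  simp only [laplacian_apply, Finset.mul_sum]
  rw [integral_finsetSum _ fun i _ => integrable_vol_of_continuous (hc2 i),
    ← Finset.sum_neg_distrib]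
  refine Finset.sum_congr rfl fun i _ => ?_
  have := key i
  rw [integral_add (integrable_vol_of_continuous (hc1 i))
    (integrable_vol_of_continuous (hc2 i))] at this
  linarith

/-- `∫ ψ'(P) div(P V) = ∫ (P ψ'(P) - ψ(P)) div V`. -/
lemma integral_mul_divergence (hL : 0 < L) {P D w : E d → ℝ} (hP : ContDiff ℝ 2 P)
    (hper : IsPeriodic L P) (h0 : ∀ x, 0 ≤ P x) {ψ ψ₁ : ℝ → ℝ}
    (h1 : ∀ r ≥ 0, HasDerivAt ψ (ψ₁ r) r) (h2 : ContinuousOn ψ₁ (Ici 0))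
    (hV : InteractionRegular L D w) :
    ∫ x, ψ₁ (P x) * divergence (fun y => P y • interaction L D w y) x ∂(vol d L) =
      ∫ x, (P x * ψ₁ (P x) - ψ (P x)) * interactionDiv L D w x ∂(vol d L) := by
  have hP1 : Continuous (fderiv ℝ P) := hP.continuous_fderiv (by norm_num)
  have hPd : ∀ x, HasFDerivAt P (fderiv ℝ P x) x := fun x =>
    (hP.differentiable (by norm_num)).differentiableAt.hasFDerivAt
  have hψ : Continuous fun x => ψ (P x) :=
    continuous_iff_continuousAt.2 fun x =>
      (h1 _ (h0 x)).continuousAt.comp (f := P) hP.continuous.continuousAt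
  have hψ₁ : Continuous fun x => ψ₁ (P x) := h2.comp_continuous hP.continuous h0
  have hp : ∀ i, Continuous fun x => fderiv ℝ P x (e i) := fun i => hP1.clm_apply continuous_const
  have hVd : ∀ i x, HasFDerivAt (fun x => interaction L D w x i)
      (fderiv ℝ (fun x => interaction L D w x i) x) x := fun i x =>
    (hV.differentiable i x).hasFDerivAt
  have hdiv : ∀ x, divergence (fun y => P y • interaction L D w y) x =
      ∑ i, (P x * fderiv ℝ (fun x => interaction L D w x i) x (e i) +
        interaction L D w x i * fderiv ℝ P x (e i)) := by
    intro x
    unfold divergence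
    refine Finset.sum_congr rfl fun i _ => ?_
    have h : fderiv ℝ (fun y => P y * interaction L D w y i) x = _ := ((hPd x).mul (hVd i x)).fderiv
    have h2 : (fun y => (P y • interaction L D w y) i) =
        fun y => P y * interaction L D w y i := by
      funext y; simp
    rw [h2, h]
    simp
  have hline : ∀ i x, HasDerivAt (fun s : ℝ => ψ (P (x + s • e i)) * interaction L D w (x + s • e i) i)
      (ψ (P x) * fderiv ℝ (fun x => interaction L D w x i) x (e i) +
        interaction L D w x i * (ψ₁ (P x) * fderiv ℝ P x (e i))) 0 := by
    intro i x
    have hF := ((h1 _ (h0 x)).comp_hasFDerivAt x (hPd x)).mul (hVd i x)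
    refine (hF.hasLineDerivAt (e i)).congr_deriv ?_
    simp
  have hdVm : ∀ i, Measurable fun x => fderiv ℝ (fun x => interaction L D w x i) x (e i) :=
    fun i => measurable_fderiv_apply_const ℝ _ _
  obtain ⟨C, hC⟩ := hV.bound_deriv
  obtain ⟨B, hB⟩ := hV.bound
  have hVper := hV.periodic
  have hVc : ∀ i, Continuous fun x => interaction L D w x i := fun i =>
    (hV.differentiable i).continuous
  have hpper : ∀ i, IsPeriodic L fun x => fderiv ℝ P x (e i) := fun i => hper.fderiv_apply (e i)
  simp only [hdiv, ← hV.div]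
  clear hdiv hVd
  obtain ⟨dV, hdV⟩ : ∃ dV : Fin d → E d → ℝ, ∀ i x,
    fderiv ℝ (fun x => interaction L D w x i) x (e i) = dV i x := ⟨_, fun _ _ => rfl⟩
  obtain ⟨V, hV'⟩ : ∃ V : Fin d → E d → ℝ, ∀ i x, interaction L D w x i = V i x :=
    ⟨_, fun _ _ => rfl⟩
  obtain ⟨p, hp'⟩ : ∃ p : Fin d → E d → ℝ, ∀ i x, fderiv ℝ P x (e i) = p i x :=
    ⟨_, fun _ _ => rfl⟩
  simp only [hdV] at hline hdVm hC ⊢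
  simp only [hV'] at hline hB hVper hVc ⊢
  simp only [hp'] at hline hp hpper ⊢
  clear hdV hV' hp'
  have hψp : ∀ i, Continuous fun x => ψ₁ (P x) * p i x := fun i => hψ₁.mul (hp i)
  have hdVint : ∀ i (f : E d → ℝ), Continuous f → Integrable (fun x => f x * dV i x) (vol d L) :=
    fun i f hf => (integrable_vol_of_continuous hf).mul_bdd (c := C)
      (hdVm i).aestronglyMeasurable (Eventually.of_forall fun x => hC i x)
  have key : ∀ i, ∫ x, (ψ (P x) * dV i x + V i x * (ψ₁ (P x) * p i x)) ∂(vol d L) = 0 := by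
    intro i
    obtain ⟨C₁, hC₁⟩ := IsPeriodic.exists_bound (L := L) (f := fun x => ψ (P x))
      (fun x k => by simp only [hper x k]) hL hψ
    obtain ⟨C₂, hC₂⟩ := IsPeriodic.exists_bound (L := L) (f := fun x => ψ₁ (P x) * p i x)
      (fun x k => by simp only [hper x k, hpper i x k]) hL (hψp i)
    refine integral_partial_eq_zero hL (F := fun x => ψ (P x) * V i x)
      (C := C₁ * C + B * C₂) ?_ (hψ.mul (hVc i)) i (hline i) (fun x => ?_)
    · intro x k
      simp only [hper x k, hVper i x k]
    · refine (abs_add_le _ _).trans (add_le_add ?_ ?_)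
      · rw [abs_mul]
        exact mul_le_mul (hC₁ x) (hC i x) (abs_nonneg _) ((abs_nonneg _).trans (hC₁ x))
      · rw [abs_mul]
        exact mul_le_mul (hB i x) (hC₂ x) (abs_nonneg _) ((abs_nonneg _).trans (hB i x))
  -- The product rule `ψ₁(P) div (P V) = (P ψ₁(P) - ψ(P)) div V + div (ψ(P) V)`; the last divergence
  -- integrates to zero by `key`.
  have hsplit : ∀ x, ψ₁ (P x) * ∑ i, (P x * dV i x + V i x * p i x) =
      (P x * ψ₁ (P x) - ψ (P x)) * ∑ i, dV i x +
        ∑ i, (ψ (P x) * dV i x + V i x * (ψ₁ (P x) * p i x)) := by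
    intro x
    rw [Finset.mul_sum, Finset.mul_sum, ← Finset.sum_add_distrib]
    refine Finset.sum_congr rfl fun i _ => ?_
    ring
  simp only [hsplit]
  have hi1 : Integrable (fun x => (P x * ψ₁ (P x) - ψ (P x)) * ∑ i, dV i x) (vol d L) := by
    simp only [Finset.mul_sum]
    exact integrable_finsetSum _ fun i _ => hdVint i _ ((hP.continuous.mul hψ₁).sub hψ)
  have hi2 : ∀ i, Integrable (fun x => ψ (P x) * dV i x + V i x * (ψ₁ (P x) * p i x))
      (vol d L) := fun i =>
    (hdVint i _ hψ).add (integrable_vol_of_continuous ((hVc i).mul (hψp i)))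
  rw [integral_add hi1 (integrable_finsetSum _ fun i _ => hi2 i),
    integral_finsetSum _ fun i _ => hi2 i, Finset.sum_eq_zero fun i _ => key i, add_zero]

/-! ### Dissipation identities along one slice. -/

namespace IsSliceSolution

variable {κ : ℝ} {D : E d → ℝ} {ρ w : ℝ → E d → ℝ}

lemma continuous_at (h : IsSliceSolution L κ D ρ w) {t : ℝ} (ht : 0 ≤ t) : Continuous (ρ t) :=
  continuous_slice h.continuous ht

lemma continuousOn_comp (h : IsSliceSolution L κ D ρ w) {ψ : ℝ → ℝ}
    (hψ : ContinuousOn ψ (Ici 0)) :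
    ContinuousOn (fun p : ℝ × E d => ψ (ρ p.1 p.2)) (Ici 0 ×ˢ univ) :=
  hψ.comp h.continuous fun _ hp => h.nonneg _ hp.1 _

lemma continuousOn_integral_comp (h : IsSliceSolution L κ D ρ w) {ψ : ℝ → ℝ}
    (hψ : ContinuousOn ψ (Ici 0)) :
    ContinuousOn (fun t => ∫ x, ψ (ρ t x) ∂(vol d L)) (Ici 0) :=
  continuousOn_integral_vol isClosed_Ici.isLocallyClosed (h.continuousOn_comp hψ)

lemma continuousOn_deriv_comp (h : IsSliceSolution L κ D ρ w) {ψ₁ : ℝ → ℝ}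
    (h2 : ContinuousOn ψ₁ (Ici 0)) :
    ContinuousOn (fun p : ℝ × E d => ψ₁ (ρ p.1 p.2) * deriv (fun s => ρ s p.2) p.1)
      (Ioi 0 ×ˢ univ) :=
  ((h.continuousOn_comp h2).mono (prod_mono Ioi_subset_Ici_self subset_rfl)).mul
    h.continuous_deriv

lemma hasDerivAt_integral_comp (h : IsSliceSolution L κ D ρ w) {ψ ψ₁ : ℝ → ℝ}
    (h1 : ∀ r ≥ 0, HasDerivAt ψ (ψ₁ r) r) (h2 : ContinuousOn ψ₁ (Ici 0)) {t : ℝ} (ht : 0 < t) :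
    HasDerivAt (fun s => ∫ x, ψ (ρ s x) ∂(vol d L))
      (∫ x, ψ₁ (ρ t x) * deriv (fun s => ρ s x) t ∂(vol d L)) t := by
  refine hasDerivAt_integral_vol (f := fun p => ψ (ρ p.1 p.2))
    (f' := fun p => ψ₁ (ρ p.1 p.2) * deriv (fun s => ρ s p.2) p.1) ?_
    (h.continuousOn_deriv_comp h2) ?_ ht
  · exact (h.continuousOn_comp fun r hr => (h1 r hr).continuousAt.continuousWithinAt).mono
      (prod_mono Ioi_subset_Ici_self subset_rfl)
  · intro s hs x
    have := h.equation s hs x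
    exact (h1 _ (h.nonneg s (le_of_lt hs) x)).comp s this.differentiableAt.hasDerivAt

/-- A dissipation identity for a general density `ψ`: the identity function gives conservation of
mass, and the regularized entropy density gives the entropy production. -/
lemma integral_deriv_comp (h : IsSliceSolution L κ D ρ w) (hL : 0 < L) (hD : MemSobolev L 2 ⊤ D)
    {ψ ψ₁ ψ₂ : ℝ → ℝ} (h1 : ∀ r ≥ 0, HasDerivAt ψ (ψ₁ r) r)
    (h2 : ∀ r ≥ 0, HasDerivAt ψ₁ (ψ₂ r) r) (h3 : ContinuousOn ψ₂ (Ici 0)) {t : ℝ} (ht : 0 < t) :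
    ∫ x, ψ₁ (ρ t x) * deriv (fun s => ρ s x) t ∂(vol d L) =
      κ * ∫ x, (ρ t x * ψ₁ (ρ t x) - ψ (ρ t x)) * interactionDiv L D (w t) x ∂(vol d L) -
        ∑ i, ∫ x, ψ₂ (ρ t x) * fderiv ℝ (ρ t) x (e i) ^ 2 ∂(vol d L) := by
  have hψ₁ : ContinuousOn ψ₁ (Ici 0) := fun r hr => (h2 r hr).continuousAt.continuousWithinAt
  have hP := h.contDiff t ht
  have hper := h.periodic t ht.le
  have h0 := h.nonneg t ht.le
  have hV := interactionRegular hL hD (h.integrable t ht)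
  have hlapc : Continuous fun x => ψ₁ (ρ t x) * (Δ (ρ t)) x := by
    simp only [laplacian_apply]
    have hP2 : Continuous (fderiv ℝ (fderiv ℝ (ρ t))) :=
      (hP.fderiv_right (m := 1) (by norm_num)).continuous_fderiv one_ne_zero
    exact (hψ₁.comp_continuous hP.continuous h0).mul (continuous_finsetSum _ fun i _ =>
      (hP2.clm_apply continuous_const).clm_apply continuous_const)
  have hdc : Continuous fun x => ψ₁ (ρ t x) * deriv (fun s => ρ s x) t :=
    continuous_slice (h.continuousOn_deriv_comp hψ₁) ht
  -- Solved for the drift term, the equation presents it as a difference of continuous functions, so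
  -- its integrability needs no separate proof.
  have heq : ∀ x, ψ₁ (ρ t x) * deriv (fun s => ρ s x) t - ψ₁ (ρ t x) * (Δ (ρ t)) x =
      κ * (ψ₁ (ρ t x) * divergence (fun y => ρ t y • interaction L D (w t) y) x) := by
    intro x
    rw [(h.equation t ht x).deriv]
    ring
  have hint := integral_sub (μ := vol d L) (integrable_vol_of_continuous hdc)
    (integrable_vol_of_continuous hlapc)
  simp only [heq] at hint
  rw [integral_const_mul, integral_mul_divergence hL hP hper h0 h1 hψ₁ hV,
    integral_mul_laplacian hL hP hper h0 h2 h3] at hint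
  linarith

/-- Conservation of mass. -/
lemma mass (h : IsSliceSolution L κ D ρ w) (hL : 0 < L) (hD : MemSobolev L 2 ⊤ D) {t : ℝ}
    (ht : 0 ≤ t) : ∫ x, ρ t x ∂(vol d L) = 1 := by
  have hcont : ContinuousOn (fun t => ∫ x, ρ t x ∂(vol d L)) (Ici 0) :=
    h.continuousOn_integral_comp (ψ := fun r => r) continuousOn_id
  have hder : ∀ s > 0, HasDerivAt (fun t => ∫ x, ρ t x ∂(vol d L)) 0 s := by
    intro s hs
    have h1 := h.hasDerivAt_integral_comp (ψ := fun r => r) (ψ₁ := fun _ => 1)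
      (fun r _ => hasDerivAt_id r) continuousOn_const hs
    have h2 := h.integral_deriv_comp hL hD (ψ := fun r => r) (ψ₁ := fun _ => 1) (ψ₂ := fun _ => 0)
      (fun r _ => hasDerivAt_id r) (fun r _ => hasDerivAt_const r 1) continuousOn_const hs
    rw [h2] at h1
    simpa using h1
  rw [← h.initial_mass]
  rcases ht.eq_or_lt with rfl | ht
  · rfl
  have hmono : MonotoneOn (fun t => ∫ x, ρ t x ∂(vol d L)) (Ici 0) := by
    refine monotoneOn_of_deriv_nonneg (convex_Ici 0) hcont ?_ ?_
    · rw [interior_Ici]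
      exact fun s hs => (hder s hs).differentiableAt.differentiableWithinAt
    · rw [interior_Ici]
      exact fun s hs => (hder s hs).deriv.ge
  have hanti : AntitoneOn (fun t => ∫ x, ρ t x ∂(vol d L)) (Ici 0) := by
    refine antitoneOn_of_deriv_nonpos (convex_Ici 0) hcont ?_ ?_
    · rw [interior_Ici]
      exact fun s hs => (hder s hs).differentiableAt.differentiableWithinAt
    · rw [interior_Ici]
      exact fun s hs => (hder s hs).deriv.le
  exact le_antisymm (hanti (mem_Ici.2 le_rfl) ht.le ht.le) (hmono (mem_Ici.2 le_rfl) ht.le ht.le)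

end IsSliceSolution

end Dissipation

/-! ### Production of the regularized entropy on one slice. -/

section EntropyDissipation

variable {d : ℕ} {L : ℝ}

/-- The time derivative of the entropy of `ρ + ε ρ_∞`. -/
noncomputable def entropyRate (L ε : ℝ) (ρ : ℝ → E d → ℝ) (t : ℝ) : ℝ :=
  ∫ x, (Real.log ((ρ t x + ε * splay d L) / splay d L) + 1) * deriv (fun s => ρ s x) t ∂(vol d L)

lemma hasDerivAt_log_add_div {a m r : ℝ} (hm : 0 < m) (hr : 0 < r + a) :
    HasDerivAt (fun r => Real.log ((r + a) / m)) (1 / (r + a)) r := by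
  have h := ((((hasDerivAt_id r).add_const a).div_const m).log (div_pos hr hm).ne')
  refine h.congr_deriv ?_
  simp only [id]
  field_simp

lemma hasDerivAt_add_mul_log {a m r : ℝ} (hm : 0 < m) (hr : 0 < r + a) :
    HasDerivAt (fun r => (r + a) * Real.log ((r + a) / m)) (Real.log ((r + a) / m) + 1) r := by
  have h := ((hasDerivAt_id r).add_const a).mul (hasDerivAt_log_add_div hm hr)
  refine h.congr_deriv ?_
  simp only [id]
  field_simp

namespace IsSliceSolution

variable {κ : ℝ} {D : E d → ℝ} {ρ w : ℝ → E d → ℝ} {ε : ℝ}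

lemma continuousOn_log (hL : 0 < L) (hε : 0 < ε) :
    ContinuousOn (fun r => Real.log ((r + ε * splay d L) / splay d L) + 1) (Ici 0) := by
  have hm := splay_pos d hL
  exact fun r (hr : 0 ≤ r) => ((hasDerivAt_log_add_div hm (by positivity :
    0 < r + ε * splay d L)).add_const 1).continuousAt.continuousWithinAt

lemma hasDerivAt_regEntropy (h : IsSliceSolution L κ D ρ w) (hL : 0 < L) (hε : 0 < ε) {t : ℝ}
    (ht : 0 < t) :
    HasDerivAt (fun s => regEntropy L ε (ρ s)) (entropyRate L ε ρ t) t := by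
  have hm := splay_pos d hL
  exact h.hasDerivAt_integral_comp (fun r hr => hasDerivAt_add_mul_log hm (by positivity))
    (continuousOn_log hL hε) ht

lemma continuousOn_regEntropy (h : IsSliceSolution L κ D ρ w) (hL : 0 < L) (hε : 0 < ε) :
    ContinuousOn (fun s => regEntropy L ε (ρ s)) (Ici 0) := by
  have hm := splay_pos d hL
  exact h.continuousOn_integral_comp fun r (hr : 0 ≤ r) => (hasDerivAt_add_mul_log hm
    (by positivity : 0 < r + ε * splay d L)).continuousAt.continuousWithinAt

lemma continuousOn_entropyRate (h : IsSliceSolution L κ D ρ w) (hL : 0 < L) (hε : 0 < ε) :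
    ContinuousOn (entropyRate L ε ρ) (Ioi 0) :=
  continuousOn_integral_vol isOpen_Ioi.isLocallyClosed
    (h.continuousOn_deriv_comp (continuousOn_log hL hε))

/-- The logarithmic Sobolev inequality for `P + ε ρ_∞`. -/
lemma _root_.McKeanVlasov.regEntropy_le_fisher (hL : 0 < L) (hε : 0 < ε) {P : E d → ℝ}
    (hP : ContDiff ℝ 2 P) (hper : IsPeriodic L P) (h0 : ∀ x, 0 ≤ P x)
    (h1 : ∫ x, P x ∂(vol d L) = 1) :
    regEntropy L ε P ≤ (1 + ε) * Real.log (1 + ε) + L ^ 2 / (4 * Real.pi ^ 2) *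
      ∑ i, ∫ x, 1 / (P x + ε * splay d L) * fderiv ℝ P x (e i) ^ 2 ∂(vol d L) := by
  have hm := splay_pos d hL
  have hLd : 0 < L ^ d := pow_pos hL d
  have hpos : ∀ x, 0 < P x + ε * splay d L := fun x => by have := h0 x; positivity
  have hreg : IsPosC1 L (fun x => P x + ε * splay d L) (fun i x => fderiv ℝ P x (e i)) :=
    { cont := hP.continuous.add continuous_const
      per := fun x i => by simp only [hper x i]
      pos := hpos
      cont' := fun i => (hP.continuous_fderiv (by norm_num)).clm_apply continuous_const
      per' := fun i => hper.fderiv_apply (e i)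
      deriv := fun i x => (((hP.differentiable (by norm_num)).differentiableAt.hasFDerivAt
        ).hasLineDerivAt (e i)).add_const _ }
  have hmass : ∫ x, (P x + ε * splay d L) ∂(vol d L) = 1 + ε := by
    rw [integral_add (integrable_vol_of_continuous hP.continuous) (integrable_const _), h1,
      integral_const_splay d hL]
  -- The mean of `P + ε ρ_∞` is `(1 + ε) ρ_∞`; relative to `ρ_∞` this constant state has entropy `(1
  -- + ε) log (1 + ε)`.
  have key := logSobolev_torus hL hreg (M := (1 + ε) * splay d L)
    (by rw [hmass, mul_left_comm, pow_mul_splay d hL, mul_one])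
  have hlogc : Continuous fun x => (P x + ε * splay d L) * Real.log (P x + ε * splay d L) :=
    hreg.cont.mul (hreg.cont.log fun x => (hpos x).ne')
  have e1 : regEntropy L ε P = ∫ x, (P x + ε * splay d L) * Real.log (P x + ε * splay d L)
      ∂(vol d L) - (1 + ε) * Real.log (splay d L) := by
    have : ∀ x, (P x + ε * splay d L) * Real.log ((P x + ε * splay d L) / splay d L) =
        (P x + ε * splay d L) * Real.log (P x + ε * splay d L) -
          (P x + ε * splay d L) * Real.log (splay d L) := fun x => by
      rw [Real.log_div (hpos x).ne' hm.ne']; ring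
    unfold regEntropy
    simp only [this]
    rw [integral_sub (integrable_vol_of_continuous hlogc)
      ((integrable_vol_of_continuous hreg.cont).mul_const _), integral_mul_const, hmass]
  have e2 : L ^ d * ((1 + ε) * splay d L * Real.log ((1 + ε) * splay d L)) =
      (1 + ε) * Real.log (1 + ε) + (1 + ε) * Real.log (splay d L) := by
    rw [Real.log_mul (by positivity) hm.ne']
    have := pow_mul_splay d hL
    linear_combination (1 + ε) * (Real.log (1 + ε) + Real.log (splay d L)) * this
  rw [e2] at key
  rw [e1]
  simp only [one_div_mul_eq_div]
  linarith

/-- The Fisher information is absorbed by the logarithmic Sobolev inequality, and both factors of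
the interaction term are centred. The constant `s` stays free so that it can later be `ρ_∞ A1(ξ)`.
-/
lemma entropyRate_le (h : IsSliceSolution L κ D ρ w) (hL : 0 < L) (hκ : 0 ≤ κ) (hε : 0 < ε)
    (hD : MemSobolev L 2 ⊤ D) (s : ℝ) {t : ℝ} (ht : 0 < t) :
    entropyRate L ε ρ t ≤
      -(4 * Real.pi ^ 2 / L ^ 2) * (regEntropy L ε (ρ t) - (1 + ε) * Real.log (1 + ε)) +
      κ * normLaplacian L D * ((∫ x, |ρ t x - splay d L| ∂(vol d L) + 2 * √ε) *
        ∫ y, |w t y - s| ∂(vol d L)) := by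
  have hm := splay_pos d hL
  have hP := h.contDiff t ht
  have hper := h.periodic t ht.le
  have h0 := h.nonneg t ht.le
  have h1 := h.mass hL hD ht.le
  have hw := h.integrable t ht
  have hpos : ∀ r ≥ (0 : ℝ), 0 < r + ε * splay d L := fun r hr => by positivity
  have hrate := h.integral_deriv_comp hL hD
    (fun r hr => hasDerivAt_add_mul_log hm (hpos r hr))
    (fun r hr => (hasDerivAt_log_add_div hm (hpos r hr)).add_const 1)
    (ContinuousOn.div₀ continuousOn_const (by fun_prop) fun r hr => (hpos r hr).ne') ht
  change entropyRate L ε ρ t = _ at hrate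
  rw [hrate]
  have hfisher := regEntropy_le_fisher hL hε hP hper h0 h1
  set I := ∑ i, ∫ x, 1 / (ρ t x + ε * splay d L) * fderiv ℝ (ρ t) x (e i) ^ 2 ∂(vol d L) with hI
  have hI' : 4 * Real.pi ^ 2 / L ^ 2 *
      (regEntropy L ε (ρ t) - (1 + ε) * Real.log (1 + ε)) ≤ I := by
    have hc : 0 < 4 * Real.pi ^ 2 / L ^ 2 := by positivity
    have := mul_le_mul_of_nonneg_left (sub_le_iff_le_add'.2 hfisher) hc.le
    refine this.trans_eq ?_
    field_simp
  -- This is `P ψ₁(P) - ψ(P)` for the regularized entropy density, equal to `ρ - ε ρ_∞ log ((ρ + ε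
  -- ρ_∞) / ρ_∞)`. The constant `c` can be subtracted freely, and it makes the `L¹` norm at most
  -- that of `ρ - ρ_∞` plus `2√ε`.
  set χ : E d → ℝ := fun x => ρ t x * (Real.log ((ρ t x + ε * splay d L) / splay d L) + 1) -
    (ρ t x + ε * splay d L) * Real.log ((ρ t x + ε * splay d L) / splay d L) with hχ
  set c := splay d L - ε * splay d L * Real.log ε with hc
  have hχe : ∀ x, χ x - c = ρ t x -
      ε * splay d L * Real.log ((ρ t x + ε * splay d L) / splay d L) - c := fun x => by
    rw [hχ]; ring
  have hχc : Continuous χ := by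
    have : Continuous fun x => Real.log ((ρ t x + ε * splay d L) / splay d L) :=
      ((hP.continuous.add continuous_const).div_const _).log fun x =>
        (div_pos (hpos _ (h0 x)) hm).ne'
    have := hP.continuous
    fun_prop
  have hV := interactionRegular hL hD hw
  have hbd := abs_interactionDiv_le hL hD hw s
  have hmeas : Measurable fun x => interactionDiv L D (w t) x := by
    simp only [← hV.div]
    exact Finset.measurable_fun_sum _ fun i _ => measurable_fderiv_apply_const ℝ _ _
  set W := ∫ y, |w t y - s| ∂(vol d L) with hW
  have hdivint : Integrable (interactionDiv L D (w t)) (vol d L) :=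
    Integrable.of_bound hmeas.aestronglyMeasurable _ (Eventually.of_forall hbd)
  have hprod : ∫ x, χ x * interactionDiv L D (w t) x ∂(vol d L) ≤
      normLaplacian L D * ((∫ x, |ρ t x - splay d L| ∂(vol d L) + 2 * √ε) * W) := by
    have e1 : ∫ x, χ x * interactionDiv L D (w t) x ∂(vol d L) =
        ∫ x, (χ x - c) * interactionDiv L D (w t) x ∂(vol d L) := by
      simp only [sub_mul]
      rw [integral_sub ((integrable_vol_of_continuous hχc).mul_bdd hmeas.aestronglyMeasurable
        (Eventually.of_forall hbd)) (hdivint.const_mul c), integral_const_mul,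
        integral_interactionDiv hL hD hw, mul_zero, sub_zero]
    rw [e1]
    have e2 : ∫ x, |χ x - c| * (normLaplacian L D * W) ∂(vol d L) ≤
        normLaplacian L D * ((∫ x, |ρ t x - splay d L| ∂(vol d L) + 2 * √ε) * W) := by
      rw [integral_mul_const]
      have h2 := integral_abs_reg_le hL hε hP.continuous h0 h1
      simp only [← hc, ← hχe] at h2
      have h3 : 0 ≤ normLaplacian L D * W := mul_nonneg ENNReal.toReal_nonneg
        (integral_nonneg fun y => abs_nonneg _)
      calc _ ≤ _ := mul_le_mul_of_nonneg_right h2 h3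
        _ = _ := by ring
    refine le_trans ?_ e2
    refine (le_abs_self _).trans ?_
    rw [← Real.norm_eq_abs]
    refine norm_integral_le_of_norm_le (integrable_vol_of_continuous (by fun_prop))
      (Eventually.of_forall fun x => ?_)
    rw [Real.norm_eq_abs, abs_mul]
    exact mul_le_mul_of_nonneg_left (hbd x) (abs_nonneg _)
  have := mul_le_mul_of_nonneg_left hprod hκ
  rw [neg_mul]
  linarith

end IsSliceSolution

end EntropyDissipation

/-! ### Graphops -/

section GraphopBounds

variable {Ω : Type*} [MeasurableSpace Ω] {μ : Measure Ω} {A : POperator μ}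

lemma IsGraphop.mono (hA : IsGraphop A) {f g : Lp ℝ ⊤ μ} (h : f ≤ᵐ[μ] g) : A f ≤ᵐ[μ] A g := by
  have h1 : 0 ≤ᵐ[μ] (g - f : Lp ℝ ⊤ μ) := by
    filter_upwards [h, Lp.coeFn_sub g f] with ξ h1 h2
    rw [h2]
    simpa using h1
  have h2 := hA.positivity _ h1
  rw [map_sub] at h2
  filter_upwards [h2, Lp.coeFn_sub (A g) (A f)] with ξ h3 h4
  rw [h4] at h3
  simpa using h3

lemma IsGraphop.abs_le (hA : IsGraphop A) (f : Lp ℝ ⊤ μ) : ∀ᵐ ξ ∂μ, |A f ξ| ≤ A |f| ξ := by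
  have h1 : f ≤ᵐ[μ] (|f| : Lp ℝ ⊤ μ) := by
    filter_upwards [Lp.coeFn_abs f] with ξ h
    rw [h]
    exact le_abs_self _
  have h2 : (-f : Lp ℝ ⊤ μ) ≤ᵐ[μ] (|f| : Lp ℝ ⊤ μ) := by
    filter_upwards [Lp.coeFn_abs f, Lp.coeFn_neg f] with ξ h h'
    rw [h, h']
    exact neg_le_abs _
  have h3 := hA.mono h2
  rw [map_neg] at h3
  filter_upwards [hA.mono h1, h3, Lp.coeFn_neg (A f)] with ξ h4 h5 h6
  rw [h6] at h5
  exact abs_le'.2 ⟨h4, h5⟩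

lemma integrable_mul_image (f g : Lp ℝ ⊤ μ) : Integrable (fun ξ => f ξ * A g ξ) μ :=
  (L1.integrable_coeFn (A g)).bdd_mul (Lp.aestronglyMeasurable f)
    (ae_abs_le_eLpNorm_top (Lp.memLp f))

variable [IsProbabilityMeasure μ]

/-- The indicator function of a measurable set in `L^∞`. -/
noncomputable def indLp (μ : Measure Ω) [IsProbabilityMeasure μ] {s : Set Ω}
    (hs : MeasurableSet s) : Lp ℝ ⊤ μ :=
  indicatorConstLp ⊤ hs (measure_ne_top μ s) 1

lemma indLp_coe {s : Set Ω} (hs : MeasurableSet s) :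
    indLp μ hs =ᵐ[μ] s.indicator fun _ => 1 := indicatorConstLp_coeFn

/-- The degree function `A 1`. -/
noncomputable def degree (A : POperator μ) : Ω → ℝ := A (indLp μ MeasurableSet.univ)

lemma integrable_degree (A : POperator μ) : Integrable (degree A) μ := L1.integrable_coeFn _

lemma IsGraphop.degree_nonneg (hA : IsGraphop A) : 0 ≤ᵐ[μ] degree A :=
  hA.positivity _ (by
    filter_upwards [indLp_coe (μ := μ) MeasurableSet.univ] with ξ h
    rw [h]
    simp)

lemma IsGraphop.indLp_nonneg (hA : IsGraphop A) {s : Set Ω} (hs : MeasurableSet s) :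
    0 ≤ᵐ[μ] A (indLp μ hs) :=
  hA.positivity _ (by
    filter_upwards [indLp_coe (μ := μ) hs] with ξ h
    rw [h]
    exact Set.indicator_nonneg (fun _ _ => zero_le_one) ξ)

/-- Self-adjointness moves `A` onto the indicator function. Integrals of `A f` over sets thus become
integrals of `f` against a nonnegative weight, where pointwise comparison and Fubini apply to `f`
itself. -/
lemma IsGraphop.setIntegral_image (hA : IsGraphop A) {s : Set Ω} (hs : MeasurableSet s)
    (f : Lp ℝ ⊤ μ) : ∫ ξ in s, A f ξ ∂μ = ∫ ξ, f ξ * A (indLp μ hs) ξ ∂μ := by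
  rw [← hA.self_adjoint, ← integral_indicator hs]
  refine integral_congr_ae ?_
  filter_upwards [indLp_coe (μ := μ) hs] with ξ h
  rw [h]
  by_cases hξ : ξ ∈ s <;> simp [hξ]

lemma IsGraphop.setLIntegral_image (hA : IsGraphop A) {s : Set Ω} (hs : MeasurableSet s)
    {f : Lp ℝ ⊤ μ} (hf : 0 ≤ᵐ[μ] f) : ∫⁻ ξ in s, ENNReal.ofReal (A f ξ) ∂μ =
      ∫⁻ ξ, ENNReal.ofReal (f ξ) * ENNReal.ofReal (A (indLp μ hs) ξ) ∂μ := by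
  have hnn := hA.positivity f hf
  rw [← ofReal_integral_eq_lintegral_ofReal (L1.integrable_coeFn (A f)).restrict
    (ae_restrict_of_ae hnn), hA.setIntegral_image hs, ofReal_integral_eq_lintegral_ofReal
    (integrable_mul_image f _)]
  · refine lintegral_congr_ae ?_
    filter_upwards [hf] with ξ h
    rw [ENNReal.ofReal_mul h]
  · filter_upwards [hf, hA.indLp_nonneg hs] with ξ h1 h2
    exact mul_nonneg h1 h2

/-- If `w = A r` in the sense of monotone limits, then `|w - m A 1| ≤ A |r - m|`, tested against
the indicator function of a set. -/
lemma IsGraphop.setLIntegral_image_sub_le (hA : IsGraphop A) {r w : Ω → ℝ} (h : IsImage A r w)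
    (m : ℝ) {s : Set Ω} (hs : MeasurableSet s) :
    ∫⁻ ξ in s, ENNReal.ofReal |w ξ - m * degree A ξ| ∂μ ≤
      ∫⁻ ξ, ENNReal.ofReal |r ξ - m| * ENNReal.ofReal (A (indLp μ hs) ξ) ∂μ := by
  obtain ⟨hr, v, hv, hlim⟩ := h
  set one := indLp μ MeasurableSet.univ with hone
  have hone1 : one =ᵐ[μ] fun _ => 1 := by
    filter_upwards [indLp_coe (μ := μ) MeasurableSet.univ] with ξ h
    rw [h]; simp
  have hAv : ∀ n, A (v n - m • one) =ᵐ[μ] fun ξ => A (v n) ξ - m * degree A ξ := by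
    intro n
    rw [map_sub, map_smul]
    filter_upwards [Lp.coeFn_sub (A (v n)) (m • A one), Lp.coeFn_smul m (A one)] with ξ h1 h2
    rw [h1, Pi.sub_apply, h2]
    rfl
  have hvabs : ∀ n, (|v n - m • one| : Lp ℝ ⊤ μ) =ᵐ[μ] fun ξ => |min (r ξ) n - m| := by
    intro n
    filter_upwards [Lp.coeFn_abs (v n - m • one), Lp.coeFn_sub (v n) (m • one),
      Lp.coeFn_smul m one, hone1, hv n] with ξ h1 h2 h3 h4 h5
    rw [h1, h2, Pi.sub_apply, h3, Pi.smul_apply, h4, h5]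
    simp
  -- For `n ≥ m` truncation at `n` moves `r` only towards `m`, so `|min (r, n) - m| ≤ |r - m|`.
  have hbound : ∀ n : ℕ, m ≤ n → ∫⁻ ξ in s, ENNReal.ofReal |A (v n) ξ - m * degree A ξ| ∂μ ≤
      ∫⁻ ξ, ENNReal.ofReal |r ξ - m| * ENNReal.ofReal (A (indLp μ hs) ξ) ∂μ := by
    intro n hn
    have hnn : 0 ≤ᵐ[μ] (|v n - m • one| : Lp ℝ ⊤ μ) := by
      filter_upwards [hvabs n] with ξ h1
      rw [h1]
      exact abs_nonneg _
    calc ∫⁻ ξ in s, ENNReal.ofReal |A (v n) ξ - m * degree A ξ| ∂μ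
        ≤ ∫⁻ ξ in s, ENNReal.ofReal (A |v n - m • one| ξ) ∂μ := by
          refine lintegral_mono_ae (ae_restrict_of_ae ?_)
          filter_upwards [hA.abs_le (v n - m • one), hAv n] with ξ h1 h2
          rw [h2] at h1
          exact ENNReal.ofReal_le_ofReal h1
      _ = ∫⁻ ξ, ENNReal.ofReal ((|v n - m • one| : Lp ℝ ⊤ μ) ξ) *
            ENNReal.ofReal (A (indLp μ hs) ξ) ∂μ := hA.setLIntegral_image hs hnn
      _ ≤ _ := by
          refine lintegral_mono_ae ?_
          filter_upwards [hvabs n, hr] with ξ h1 h2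
          rw [h1]
          refine mul_le_mul_left (ENNReal.ofReal_le_ofReal ?_) _
          rcases le_total (r ξ) n with h3 | h3
          · rw [min_eq_left h3]
          · rw [min_eq_right h3, abs_of_nonneg (by linarith), abs_of_nonneg (by linarith)]
            linarith
  -- Fatou's lemma suffices, since `w` is an almost everywhere limit and only an upper bound is
  -- wanted.
  have hfatou : ∫⁻ ξ in s, ENNReal.ofReal |w ξ - m * degree A ξ| ∂μ ≤
      liminf (fun n => ∫⁻ ξ in s, ENNReal.ofReal |A (v n) ξ - m * degree A ξ| ∂μ) atTop := by
    refine le_trans (le_of_eq ?_) (lintegral_liminf_le' fun n => ?_)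
    · refine lintegral_congr_ae (ae_restrict_of_ae ?_)
      filter_upwards [hlim] with ξ h
      exact ((ENNReal.continuous_ofReal.tendsto _).comp
        (h.sub_const _).abs).liminf_eq.symm
    · exact (((Lp.aestronglyMeasurable (A (v n))).aemeasurable.sub
        ((integrable_degree A).1.aemeasurable.const_mul m)).norm.ennreal_ofReal).restrict
  refine hfatou.trans ?_
  refine liminf_le_of_frequently_le' (Eventually.frequently ?_)
  filter_upwards [eventually_ge_atTop ⌈m⌉₊] with n hn
  exact hbound n ((Nat.le_ceil m).trans (by exact_mod_cast hn))

variable {d : ℕ} {L : ℝ}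

/-- `∫_U |A r - m A 1| dx ≤ A (∫_U |r - m| dx)`. -/
lemma IsGraphop.integral_abs_image_sub_le (hA : IsGraphop A) {r w : E d → Ω → ℝ}
    (hr : AEStronglyMeasurable (fun p : E d × Ω => r p.1 p.2) ((vol d L).prod μ))
    (hw : AEStronglyMeasurable (fun p : E d × Ω => w p.1 p.2) ((vol d L).prod μ))
    (him : ∀ᵐ x ∂(vol d L), IsImage A (r x) (w x))
    (hrint : ∀ᵐ ξ ∂μ, Integrable (fun x => r x ξ) (vol d L))
    (hwint : ∀ᵐ ξ ∂μ, Integrable (fun x => w x ξ) (vol d L)) {m : ℝ}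
    {G : Lp ℝ ⊤ μ} (hG : G =ᵐ[μ] fun ξ => ∫ x, |r x ξ - m| ∂(vol d L)) :
    ∀ᵐ ξ ∂μ, ∫ x, |w x ξ - m * degree A ξ| ∂(vol d L) ≤ A G ξ := by
  have hG0 : 0 ≤ᵐ[μ] G := by
    filter_upwards [hG] with ξ h
    rw [h]
    exact integral_nonneg fun x => abs_nonneg _
  have hdeg : AEMeasurable (fun p : E d × Ω => degree A p.2) ((vol d L).prod μ) :=
    (integrable_degree A).1.aemeasurable.comp_snd
  have hK : AEMeasurable (fun p : E d × Ω => ENNReal.ofReal |w p.1 p.2 - m * degree A p.2|)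
      ((vol d L).prod μ) :=
    (hw.aemeasurable.sub (hdeg.const_mul m)).norm.ennreal_ofReal
  have hR : AEMeasurable (fun p : E d × Ω => ENNReal.ofReal |r p.1 p.2 - m|)
      ((vol d L).prod μ) :=
    (hr.aemeasurable.sub aemeasurable_const).norm.ennreal_ofReal
  -- The bound is tested on all measurable sets of `ξ`. Tonelli makes `x` the outer variable, where
  -- the image relation is known for almost every `x`, and then restores the order to form `G`.
  have hmain : (fun ξ => ∫⁻ x, ENNReal.ofReal |w x ξ - m * degree A ξ| ∂(vol d L)) ≤ᵐ[μ]
      fun ξ => ENNReal.ofReal (A G ξ) := by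
    refine ae_le_of_forall_setLIntegral_le_of_sigmaFinite₀ ?_ fun s hs _ => ?_
    · exact hK.prod_swap.lintegral_prod_right'
    · have hprod : (vol d L).prod (μ.restrict s) ≪ (vol d L).prod μ :=
        Measure.AbsolutelyContinuous.rfl.prod Measure.restrict_le_self.absolutelyContinuous
      rw [← lintegral_lintegral_swap (hK.mono_ac hprod), hA.setLIntegral_image hs hG0]
      have hRA : AEMeasurable (fun p : E d × Ω => ENNReal.ofReal |r p.1 p.2 - m| *
          ENNReal.ofReal (A (indLp μ hs) p.2)) ((vol d L).prod μ) :=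
        hR.mul (L1.integrable_coeFn (A (indLp μ hs))).1.aemeasurable.ennreal_ofReal.comp_snd
      calc ∫⁻ x, ∫⁻ ξ in s, ENNReal.ofReal |w x ξ - m * degree A ξ| ∂μ ∂(vol d L)
          ≤ ∫⁻ x, ∫⁻ ξ, ENNReal.ofReal |r x ξ - m| *
              ENNReal.ofReal (A (indLp μ hs) ξ) ∂μ ∂(vol d L) := by
            refine lintegral_mono_ae ?_
            filter_upwards [him] with x hx
            exact hA.setLIntegral_image_sub_le hx m hs
        _ = ∫⁻ ξ, ∫⁻ x, ENNReal.ofReal |r x ξ - m| *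
              ENNReal.ofReal (A (indLp μ hs) ξ) ∂(vol d L) ∂μ := lintegral_lintegral_swap hRA
        _ ≤ ∫⁻ ξ, ENNReal.ofReal (G ξ) * ENNReal.ofReal (A (indLp μ hs) ξ) ∂μ := by
            refine lintegral_mono_ae ?_
            filter_upwards [hG, hrint] with ξ h1 h2
            have h3 := ofReal_integral_eq_lintegral_ofReal (h2.sub (integrable_const m)).abs
              (Eventually.of_forall fun x => abs_nonneg _)
            rw [lintegral_mul_const' _ _ ENNReal.ofReal_ne_top, h1]
            exact mul_le_mul_left h3.ge _
  filter_upwards [hmain, hwint, hA.positivity G hG0] with ξ h1 h2 h3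
  have h4 := (h2.sub (integrable_const (m * degree A ξ))).abs
  have h5 := ofReal_integral_eq_lintegral_ofReal h4 (Eventually.of_forall fun x => abs_nonneg _)
  have h6 : ENNReal.ofReal (∫ x, |w x ξ - m * degree A ξ| ∂(vol d L)) ≤
      ENNReal.ofReal (A G ξ) := by
    refine le_trans (le_of_eq h5) h1
  exact (ENNReal.ofReal_le_ofReal_iff h3).1 h6

lemma IsGraphop.image_le_degree (hA : IsGraphop A) {G : Lp ℝ ⊤ μ} {C : ℝ}
    (hG : ∀ᵐ ξ ∂μ, G ξ ≤ C) : ∀ᵐ ξ ∂μ, A G ξ ≤ C * degree A ξ := by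
  have h1 : G ≤ᵐ[μ] (C • indLp μ MeasurableSet.univ : Lp ℝ ⊤ μ) := by
    filter_upwards [hG, Lp.coeFn_smul C (indLp μ MeasurableSet.univ),
      indLp_coe (μ := μ) MeasurableSet.univ] with ξ h1 h2 h3
    rw [h2, Pi.smul_apply, h3]
    simpa using h1
  have h2 := hA.mono h1
  rw [map_smul] at h2
  filter_upwards [h2, Lp.coeFn_smul C (A (indLp μ MeasurableSet.univ))] with ξ h3 h4
  rw [h4] at h3
  exact h3

lemma inner_extL2_incl (hA2 : MemB A 2 2) (f : Lp ℝ ⊤ μ) :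
    ⟪extL2 A hA2 (incl μ f), incl μ f⟫_ℝ = ∫ ξ, f ξ * A f ξ ∂μ := by
  rw [extL2_incl, L2.inner_def]
  refine integral_congr_ae ?_
  filter_upwards [(memLp_of_memB hA2 f).coeFn_toLp,
    ((Lp.memLp f).mono_exponent (p := 2) le_top).coeFn_toLp] with ξ h1 h2
  change inner ℝ ((memLp_of_memB hA2 f).toLp (A f) ξ)
    (((Lp.memLp f).mono_exponent (p := 2) le_top).toLp f ξ) = _
  rw [h1, h2]
  simp

lemma norm_incl_sq (f : Lp ℝ ⊤ μ) : ‖incl μ f‖ ^ 2 = ∫ ξ, f ξ ^ 2 ∂μ := by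
  rw [← real_inner_self_eq_norm_sq, L2.inner_def]
  refine integral_congr_ae ?_
  filter_upwards [((Lp.memLp f).mono_exponent (p := 2) le_top).coeFn_toLp] with ξ h2
  change inner ℝ (((Lp.memLp f).mono_exponent (p := 2) le_top).toLp f ξ)
    (((Lp.memLp f).mono_exponent (p := 2) le_top).toLp f ξ) = _
  rw [h2]
  simp [sq]

/-- Both sides are homogeneous of degree two, so the supremum over unit vectors controls every
bounded function. -/
lemma integral_mul_image_le (hA2 : MemB A 2 2) (f : Lp ℝ ⊤ μ) :
    ∫ ξ, f ξ * A f ξ ∂μ ≤ numericalRadius A hA2 * ∫ ξ, f ξ ^ 2 ∂μ := by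
  rw [← inner_extL2_incl hA2, ← norm_incl_sq]
  set g := incl μ f with hg
  by_cases h0 : g = 0
  · simp [h0]
  have hn : 0 < ‖g‖ := norm_pos_iff.2 h0
  have h1 := le_csSup (numericalRadius_bddAbove A hA2)
    ⟨‖g‖⁻¹ • g, by rw [norm_smul, norm_inv, norm_norm, inv_mul_cancel₀ hn.ne'], rfl⟩
  rw [map_smul, real_inner_smul_left, real_inner_smul_right] at h1
  change _ ≤ numericalRadius A hA2 at h1
  have h2 := mul_le_mul_of_nonneg_right h1 (sq_nonneg ‖g‖)
  refine le_trans (le_of_eq ?_) h2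
  field_simp

/-- The constant function `1` is a unit vector, and `A1 ≥ 0`. -/
lemma IsGraphop.numericalRadius_nonneg (hA : IsGraphop A) (hA2 : MemB A 2 2) :
    0 ≤ numericalRadius A hA2 := by
  have h := integral_mul_image_le hA2 (indLp μ MeasurableSet.univ)
  have h1 : ∫ ξ, indLp μ MeasurableSet.univ ξ ^ 2 ∂μ = 1 := by
    rw [integral_congr_ae (g := fun _ => 1)]
    · simp
    · filter_upwards [indLp_coe (μ := μ) MeasurableSet.univ] with ξ h
      rw [h]; simp
  rw [h1, mul_one] at h
  refine le_trans (integral_nonneg_of_ae ?_) h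
  filter_upwards [indLp_coe (μ := μ) MeasurableSet.univ, hA.degree_nonneg] with ξ h1 h2
  rw [h1]
  simp only [mem_univ, indicator_of_mem, one_mul]
  exact h2

end GraphopBounds

/-! ### Entropy decay -/

section Decay

variable {d : ℕ} {L : ℝ} {Ω : Type*} [MeasurableSpace Ω] {μ : Measure Ω} [IsProbabilityMeasure μ]

lemma relEntropy_nonneg (hL : 0 < L) {f : E d → ℝ} (hf : Continuous f) (h0 : ∀ x, 0 ≤ f x)
    (h1 : ∫ x, f x ∂(vol d L) = 1) : 0 ≤ relEntropy L f := by
  have h := pinsker hL hf h0 h1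
  nlinarith [sq_nonneg (∫ x, |f x - splay d L| ∂(vol d L))]

lemma aestronglyMeasurable_integral_comp {ρ : E d → Ω → ℝ}
    (hρ : AEStronglyMeasurable (fun p : E d × Ω => ρ p.1 p.2) ((vol d L).prod μ)) {ψ : ℝ → ℝ}
    (hψ : Measurable ψ) : AEStronglyMeasurable (fun ξ => ∫ x, ψ (ρ x ξ) ∂(vol d L)) μ := by
  have h : AEStronglyMeasurable (fun p : E d × Ω => ψ (ρ p.1 p.2)) ((vol d L).prod μ) :=
    (hψ.comp_aemeasurable hρ.aemeasurable).aestronglyMeasurable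
  exact h.prod_swap.integral_prod_right'

lemma finiteEntropy_of_integrable (hL : 0 < L) {ρ : E d → Ω → ℝ}
    (hρ : AEStronglyMeasurable (fun p : E d × Ω => ρ p.1 p.2) ((vol d L).prod μ))
    (hc : ∀ᵐ ξ ∂μ, Continuous (fun x => ρ x ξ) ∧ ∀ x, 0 ≤ ρ x ξ)
    (hint : Integrable (fun ξ => relEntropy L (fun x => ρ x ξ)) μ) : FiniteEntropy L μ ρ := by
  have hm := splay_pos d hL
  have hψ : Measurable fun r : ℝ => r * Real.log (r / splay d L) :=
    measurable_id.mul (Real.measurable_log.comp (measurable_id.div_const _))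
  have hmeas : AEStronglyMeasurable
      (fun p : E d × Ω => ρ p.1 p.2 * Real.log (ρ p.1 p.2 / splay d L)) ((vol d L).prod μ) :=
    (hψ.comp_aemeasurable hρ.aemeasurable).aestronglyMeasurable
  refine (integrable_prod_iff' hmeas).2 ⟨?_, ?_⟩
  · filter_upwards [hc] with ξ h
    exact integrable_vol_of_continuous (continuous_mul_log_div h.1 hL)
  · refine Integrable.mono' (hint.add (integrable_const 2))
      (aestronglyMeasurable_integral_comp (ψ := fun r => ‖r * Real.log (r / splay d L)‖) hρ
        hψ.norm) ?_
    filter_upwards [hc] with ξ h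
    have hcont := continuous_mul_log_div h.1 hL
    rw [Real.norm_of_nonneg (integral_nonneg fun x => norm_nonneg _), Pi.add_apply, relEntropy,
      ← integral_const_splay d hL 2, ← integral_add (integrable_vol_of_continuous hcont)
        (integrable_const _)]
    refine integral_mono (integrable_vol_of_continuous hcont.norm)
      (integrable_vol_of_continuous (hcont.add continuous_const)) fun x => ?_
    -- From `a log (a / m) ≥ a - m`. An integrand bounded below by `-ρ_∞` has absolute value at most
    -- itself plus `2ρ_∞`.
    have hr : -splay d L ≤ ρ x ξ * Real.log (ρ x ξ / splay d L) := by
      have h0 := h.2 x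
      rcases h0.eq_or_lt with h0 | h0
      · simp [← h0, hm.le]
      · have ha : 0 < ρ x ξ / splay d L := div_pos h0 hm
        have h1 := mul_le_mul_of_nonneg_left (Real.one_sub_inv_le_log_of_pos ha) h0.le
        rw [inv_div, mul_sub, mul_div_cancel₀ _ h0.ne'] at h1
        linarith
    rw [Real.norm_eq_abs]
    exact abs_le.2 ⟨by linarith, by linarith⟩

/-- A solution together with the function `w = A ρ` of the equation. -/
structure IsFamilySolution (L κ : ℝ) (D : E d → ℝ) (A : POperator μ)
    (ρ w : ℝ → E d → Ω → ℝ) : Prop where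
  measurable : ∀ t ≥ 0, AEStronglyMeasurable (fun p : E d × Ω => ρ t p.1 p.2) ((vol d L).prod μ)
  measurable_image :
    ∀ t > 0, AEStronglyMeasurable (fun p : E d × Ω => w t p.1 p.2) ((vol d L).prod μ)
  image : ∀ t > 0, ∀ᵐ x ∂(vol d L), IsImage A (ρ t x) (w t x)
  slice : ∀ᵐ ξ ∂μ, IsSliceSolution L κ D (fun t x => ρ t x ξ) (fun t x => w t x ξ)
  initial : Integrable (fun ξ => relEntropy L (fun x => ρ 0 x ξ)) μ

/-- The entropy of `ρ(t, ·, ξ) + ε ρ_∞`. -/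
noncomputable abbrev sliceEntropy (L ε : ℝ) (ρ : ℝ → E d → Ω → ℝ) (t : ℝ) (ξ : Ω) : ℝ :=
  regEntropy L ε (fun x => ρ t x ξ)

/-- The averaged entropy of `ρ(t) + ε ρ_∞`. -/
noncomputable def avgEntropy (L ε : ℝ) (μ : Measure Ω) (ρ : ℝ → E d → Ω → ℝ) (t : ℝ) : ℝ :=
  ∫ ξ, sliceEntropy L ε ρ t ξ ∂μ

/-- Estimates hold off a null set of `ξ` that depends on time; with countably many times the null
sets can be united, and continuity covers the rest. -/
lemma le_of_forall_rat {f : ℝ → ℝ} {B : ℝ} (hf : ContinuousOn f (Ioi 0))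
    (h : ∀ q : ℚ, 0 < (q : ℝ) → f q ≤ B) {t : ℝ} (ht : 0 < t) : f t ≤ B := by
  have hcl : t ∈ closure (Ioi (0 : ℝ) ∩ range ((↑) : ℚ → ℝ)) :=
    Rat.denseRange_cast.open_subset_closure_inter isOpen_Ioi ht
  obtain ⟨u, hu, hlim⟩ := mem_closure_iff_seq_limit.1 hcl
  have h1 := ((hf t ht).continuousAt (Ioi_mem_nhds ht)).tendsto.comp hlim
  refine le_of_tendsto h1 (Eventually.of_forall fun n => ?_)
  obtain ⟨h2, q, hq⟩ := hu n
  simp only [Function.comp_apply]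
  rw [← hq]
  exact h q (by rw [hq]; exact h2)

/-! ### Estimates uniform in time and integrable over `ξ`. -/

namespace IsFamilySolution

variable {κ ε : ℝ} {D : E d → ℝ} {A : POperator μ} {ρ w : ℝ → E d → Ω → ℝ}

lemma aestronglyMeasurable_relEntropy (h : IsFamilySolution L κ D A ρ w) {t : ℝ} (ht : 0 ≤ t) :
    AEStronglyMeasurable (fun ξ => relEntropy L (fun x => ρ t x ξ)) μ :=
  aestronglyMeasurable_integral_comp (h.measurable t ht)
    (ψ := fun r => r * Real.log (r / splay d L))
    (measurable_id.mul (Real.measurable_log.comp (measurable_id.div_const _)))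

lemma aestronglyMeasurable_sliceEntropy (h : IsFamilySolution L κ D A ρ w) {t : ℝ} (ht : 0 ≤ t) :
    AEStronglyMeasurable (sliceEntropy L ε ρ t) μ :=
  aestronglyMeasurable_integral_comp (h.measurable t ht)
    (ψ := fun r => (r + ε * splay d L) * Real.log ((r + ε * splay d L) / splay d L))
    ((measurable_id.add_const _).mul
      (Real.measurable_log.comp ((measurable_id.add_const _).div_const _)))

/-- The comparison of the two entropies, uniformly in `ξ`. -/
lemma entropy_bounds (h : IsFamilySolution L κ D A ρ w) (hL : 0 < L) (hε : 0 < ε)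
    (hD : MemSobolev L 2 ⊤ D) : ∀ᵐ ξ ∂μ, ∀ t ≥ 0,
      0 ≤ relEntropy L (fun x => ρ t x ξ) ∧
      relEntropy L (fun x => ρ t x ξ) ≤ sliceEntropy L ε ρ t ξ - ε * Real.log ε ∧
      sliceEntropy L ε ρ t ξ ≤ relEntropy L (fun x => ρ t x ξ) + (ε + ε ^ 2) ∧
      (∫ x, |ρ t x ξ - splay d L| ∂(vol d L)) ^ 2 ≤ 2 * relEntropy L (fun x => ρ t x ξ) ∧
      ∫ x, |ρ t x ξ - splay d L| ∂(vol d L) ≤ 2 := by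
  filter_upwards [h.slice] with ξ hs t ht
  have hc := hs.continuous_at ht
  have h0 := hs.nonneg t ht
  have h1 := hs.mass hL hD ht
  have e1 := le_regEntropy_sub_relEntropy hL hε hc h0
  have e2 := regEntropy_sub_relEntropy_le hL hε hc h0 h1
  refine ⟨relEntropy_nonneg hL hc h0 h1, by linarith, by linarith, pinsker hL hc h0 h1,
    integral_abs_sub_splay_le hL (integrable_vol_of_continuous hc)
      (Eventually.of_forall h0) h1⟩

/-- By `entropy_bounds` the two entropies differ by a bounded function, and `μ` is finite. -/
lemma integrable_sliceEntropy_iff (h : IsFamilySolution L κ D A ρ w) (hL : 0 < L) (hε : 0 < ε)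
    (hD : MemSobolev L 2 ⊤ D) {t : ℝ} (ht : 0 ≤ t) :
    Integrable (sliceEntropy L ε ρ t) μ ↔ Integrable (fun ξ => relEntropy L (fun x => ρ t x ξ)) μ := by
  have hb := h.entropy_bounds hL hε hD
  have hdiff : Integrable (fun ξ => sliceEntropy L ε ρ t ξ - relEntropy L (fun x => ρ t x ξ)) μ := by
    refine Integrable.of_bound (C := |ε * Real.log ε| + (ε + ε ^ 2))
      ((h.aestronglyMeasurable_sliceEntropy ht).sub (h.aestronglyMeasurable_relEntropy ht)) ?_
    filter_upwards [hb] with ξ hξ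
    obtain ⟨-, h1, h2, -⟩ := hξ t ht
    have := neg_abs_le (ε * Real.log ε)
    have := abs_nonneg (ε * Real.log ε)
    rw [Real.norm_eq_abs]
    exact abs_le.2 ⟨by nlinarith, by linarith⟩
  constructor
  · intro h1
    refine (h1.sub hdiff).congr (Eventually.of_forall fun ξ => ?_)
    simp
  · intro h1
    refine (hdiff.add h1).congr (Eventually.of_forall fun ξ => ?_)
    simp

/-- The distance `‖ρ(t, ·, ξ) - ρ_∞‖_{L^1(U)}` as an element of `L^∞`. -/
lemma exists_distLp (h : IsFamilySolution L κ D A ρ w) (hL : 0 < L)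
    (hD : MemSobolev L 2 ⊤ D) {t : ℝ} (ht : 0 ≤ t) : ∃ G : Lp ℝ ⊤ μ,
      G =ᵐ[μ] fun ξ => ∫ x, |ρ t x ξ - splay d L| ∂(vol d L) := by
  have hmem : MemLp (fun ξ => ∫ x, |ρ t x ξ - splay d L| ∂(vol d L)) ⊤ μ := by
    refine memLp_top_of_bound (aestronglyMeasurable_integral_comp (h.measurable t ht)
      (ψ := fun r => |r - splay d L|) (by fun_prop)) 2 ?_
    filter_upwards [h.entropy_bounds hL one_pos hD] with ξ hξ
    rw [Real.norm_of_nonneg (integral_nonneg fun x => abs_nonneg _)]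
    exact (hξ t ht).2.2.2.2
  exact ⟨hmem.toLp _, hmem.coeFn_toLp⟩

/-- The upper bound for the entropy production at time `t`. -/
noncomputable def _root_.McKeanVlasov.rateBound (L κ ε : ℝ) (D : E d → ℝ) (A : POperator μ)
    (ρ : ℝ → E d → Ω → ℝ) (t : ℝ) (G : Lp ℝ ⊤ μ) (ξ : Ω) : ℝ :=
  -(4 * Real.pi ^ 2 / L ^ 2) * (sliceEntropy L ε ρ t ξ - (1 + ε) * Real.log (1 + ε)) +
    κ * normLaplacian L D * ((G ξ + 2 * √ε) * A G ξ)

/-- The upper bound for the entropy production, uniformly in time. -/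
noncomputable def _root_.McKeanVlasov.rateMajorant (L κ ε : ℝ) (D : E d → ℝ) (A : POperator μ)
    (ξ : Ω) : ℝ :=
  4 * Real.pi ^ 2 / L ^ 2 * ((1 + ε) * Real.log (1 + ε) - ε * Real.log ε) +
    κ * normLaplacian L D * ((2 + 2 * √ε) * (2 * degree A ξ))

lemma _root_.McKeanVlasov.integrable_rateMajorant (L κ ε : ℝ) (D : E d → ℝ) (A : POperator μ) :
    Integrable (rateMajorant L κ ε D A) μ :=
  (integrable_const _).add ((((integrable_degree A).const_mul _).const_mul _).const_mul _)

/-- The slice estimate with `s = ρ_∞ A1(ξ)`. The second bound forgets time by means of `G ≤ 2` and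
`sliceEntropy ≥ ε log ε`. -/
lemma entropyRate_le (h : IsFamilySolution L κ D A ρ w) (hA : IsGraphop A) (hL : 0 < L)
    (hκ : 0 ≤ κ) (hε : 0 < ε) (hD : MemSobolev L 2 ⊤ D) {t : ℝ} (ht : 0 < t) {G : Lp ℝ ⊤ μ}
    (hG : G =ᵐ[μ] fun ξ => ∫ x, |ρ t x ξ - splay d L| ∂(vol d L)) :
    ∀ᵐ ξ ∂μ, entropyRate L ε (fun t x => ρ t x ξ) t ≤ rateBound L κ ε D A ρ t G ξ ∧
      rateBound L κ ε D A ρ t G ξ ≤ rateMajorant L κ ε D A ξ := by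
  have hΛ : 0 ≤ κ * normLaplacian L D := mul_nonneg hκ ENNReal.toReal_nonneg
  have himg := hA.integral_abs_image_sub_le (h.measurable t ht.le) (h.measurable_image t ht)
    (h.image t ht) (by
      filter_upwards [h.slice] with ξ hs
      exact integrable_vol_of_continuous (hs.continuous_at ht.le))
    (by
      filter_upwards [h.slice] with ξ hs
      exact hs.integrable t ht) hG
  have hb := h.entropy_bounds hL hε hD
  have hdeg := hA.image_le_degree (G := G) (C := 2) (by
    filter_upwards [hb, hG] with ξ h1 h2
    rw [h2]
    exact (h1 t ht.le).2.2.2.2)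
  have hc : 0 < 4 * Real.pi ^ 2 / L ^ 2 := by positivity
  filter_upwards [h.slice, himg, hG, hb, hdeg] with ξ hs hi hGξ hbξ hd
  obtain ⟨b1, b2, b3, b4, b5⟩ := hbξ t ht.le
  have hG0 : 0 ≤ G ξ := by rw [hGξ]; exact integral_nonneg fun x => abs_nonneg _
  have hAG0 : 0 ≤ A G ξ := le_trans (integral_nonneg fun x => abs_nonneg _) hi
  have hse := Real.sqrt_nonneg ε
  constructor
  · refine (hs.entropyRate_le hL hκ hε hD (splay d L * degree A ξ) ht).trans ?_
    unfold rateBound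
    rw [hGξ] at hG0 ⊢
    refine add_le_add le_rfl (mul_le_mul_of_nonneg_left ?_ hΛ)
    exact mul_le_mul_of_nonneg_left hi (by positivity)
  · unfold rateBound rateMajorant
    refine add_le_add ?_ (mul_le_mul_of_nonneg_left ?_ hΛ)
    · nlinarith
    · refine mul_le_mul ?_ hd hAG0 (by positivity)
      rw [hGξ]
      linarith

/-- The entropy of almost every slice grows at most linearly. -/
lemma sliceEntropy_sub_le (h : IsFamilySolution L κ D A ρ w) (hA : IsGraphop A) (hL : 0 < L)
    (hκ : 0 ≤ κ) (hε : 0 < ε) (hD : MemSobolev L 2 ⊤ D) :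
    ∀ᵐ ξ ∂μ, ∀ s ≥ 0, ∀ t ≥ s,
      sliceEntropy L ε ρ t ξ - sliceEntropy L ε ρ s ξ ≤ rateMajorant L κ ε D A ξ * (t - s) := by
  have hrat : ∀ᵐ ξ ∂μ, ∀ q : ℚ, 0 < (q : ℝ) →
      entropyRate L ε (fun t x => ρ t x ξ) q ≤ rateMajorant L κ ε D A ξ := by
    rw [ae_all_iff]
    intro q
    by_cases hq : 0 < (q : ℝ)
    · obtain ⟨G, hG⟩ := h.exists_distLp hL hD hq.le
      filter_upwards [h.entropyRate_le hA hL hκ hε hD hq hG] with ξ h1 _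
      exact h1.1.trans h1.2
    · exact Eventually.of_forall fun ξ hq' => absurd hq' hq
  filter_upwards [hrat, h.slice] with ξ hξ hs
  have hrate : ∀ t > 0, entropyRate L ε (fun t x => ρ t x ξ) t ≤ rateMajorant L κ ε D A ξ :=
    fun t ht => le_of_forall_rat (hs.continuousOn_entropyRate hL hε) hξ ht
  have hder : ∀ t > 0, HasDerivAt
      (fun t => sliceEntropy L ε ρ t ξ - rateMajorant L κ ε D A ξ * t)
      (entropyRate L ε (fun t x => ρ t x ξ) t - rateMajorant L κ ε D A ξ) t := by
    intro t ht
    exact ((hs.hasDerivAt_regEntropy hL hε ht).sub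
      ((hasDerivAt_id t).const_mul (rateMajorant L κ ε D A ξ))).congr_deriv (by simp)
  have hanti : AntitoneOn (fun t => sliceEntropy L ε ρ t ξ - rateMajorant L κ ε D A ξ * t)
      (Ici 0) := by
    refine antitoneOn_of_deriv_nonpos (convex_Ici 0)
      ((hs.continuousOn_regEntropy hL hε).sub (by fun_prop)) ?_ ?_
    · rw [interior_Ici]
      exact fun t ht => (hder t ht).differentiableAt.differentiableWithinAt
    · rw [interior_Ici]
      intro t ht
      rw [(hder t ht).deriv]
      linarith [hrate t ht]
  intro s hs0 t hst
  have := hanti (mem_Ici.2 hs0) (mem_Ici.2 (hs0.le.trans hst)) hst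
  simp only at this
  linarith

/-- Linear growth from above and `ε log ε` from below combine into one majorant for all times in
`[0, T]`, as dominated convergence in `t` requires. -/
lemma abs_sliceEntropy_le (h : IsFamilySolution L κ D A ρ w) (hA : IsGraphop A) (hL : 0 < L)
    (hκ : 0 ≤ κ) (hε : 0 < ε) (hD : MemSobolev L 2 ⊤ D) (T : ℝ) :
    ∀ᵐ ξ ∂μ, ∀ t ∈ Icc 0 T, ‖sliceEntropy L ε ρ t ξ‖ ≤
      |sliceEntropy L ε ρ 0 ξ| + |rateMajorant L κ ε D A ξ| * T + |ε * Real.log ε| := by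
  filter_upwards [h.sliceEntropy_sub_le hA hL hκ hε hD, h.entropy_bounds hL hε hD] with ξ h1 h2
  intro t ht
  obtain ⟨b1, b2, -⟩ := h2 t ht.1
  have h3 := h1 0 le_rfl t ht.1
  rw [sub_zero] at h3
  have h4 : rateMajorant L κ ε D A ξ * t ≤ |rateMajorant L κ ε D A ξ| * T :=
    mul_le_mul (le_abs_self _) ht.2 ht.1 (abs_nonneg _)
  have h5 : 0 ≤ |rateMajorant L κ ε D A ξ| * T :=
    mul_nonneg (abs_nonneg _) (ht.1.trans ht.2)
  have h6 := neg_abs_le (ε * Real.log ε)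
  have h7 := abs_nonneg (ε * Real.log ε)
  have h8 := le_abs_self (sliceEntropy L ε ρ 0 ξ)
  have h9 := abs_nonneg (sliceEntropy L ε ρ 0 ξ)
  rw [Real.norm_eq_abs]
  exact abs_le.2 ⟨by linarith, by linarith⟩

lemma integrable_majorant (h : IsFamilySolution L κ D A ρ w) (hL : 0 < L) (hε : 0 < ε)
    (hD : MemSobolev L 2 ⊤ D) (T : ℝ) : Integrable (fun ξ => |sliceEntropy L ε ρ 0 ξ| +
      |rateMajorant L κ ε D A ξ| * T + |ε * Real.log ε|) μ :=
  ((((h.integrable_sliceEntropy_iff hL hε hD le_rfl).2 h.initial).abs).add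
    ((integrable_rateMajorant L κ ε D A).abs.mul_const T)).add (integrable_const _)

lemma integrable_sliceEntropy (h : IsFamilySolution L κ D A ρ w) (hA : IsGraphop A) (hL : 0 < L)
    (hκ : 0 ≤ κ) (hε : 0 < ε) (hD : MemSobolev L 2 ⊤ D) {t : ℝ} (ht : 0 ≤ t) :
    Integrable (sliceEntropy L ε ρ t) μ := by
  refine Integrable.mono' (h.integrable_majorant hL hε hD t)
    (h.aestronglyMeasurable_sliceEntropy ht) ?_
  filter_upwards [h.abs_sliceEntropy_le hA hL hκ hε hD t] with ξ hξ
  exact hξ t ⟨ht, le_rfl⟩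

lemma continuousOn_avgEntropy (h : IsFamilySolution L κ D A ρ w) (hA : IsGraphop A) (hL : 0 < L)
    (hκ : 0 ≤ κ) (hε : 0 < ε) (hD : MemSobolev L 2 ⊤ D) (T : ℝ) :
    ContinuousOn (avgEntropy L ε μ ρ) (Icc 0 T) := by
  refine continuousOn_of_dominated
    (fun t ht => h.aestronglyMeasurable_sliceEntropy ht.1) (fun t ht => ?_)
    (h.integrable_majorant hL hε hD T) ?_
  · filter_upwards [h.abs_sliceEntropy_le hA hL hκ hε hD T] with ξ hξ
    exact hξ t ht
  · filter_upwards [h.slice] with ξ hs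
    exact (hs.continuousOn_regEntropy hL hε).mono Icc_subset_Ici_self

lemma integrable_rateBound (h : IsFamilySolution L κ D A ρ w) (hA : IsGraphop A) (hL : 0 < L)
    (hκ : 0 ≤ κ) (hε : 0 < ε) (hD : MemSobolev L 2 ⊤ D) {t : ℝ} (ht : 0 ≤ t) (G : Lp ℝ ⊤ μ) :
    Integrable (rateBound L κ ε D A ρ t G) μ := by
  refine (((h.integrable_sliceEntropy hA hL hκ hε hD ht).sub (integrable_const _)).const_mul
    _).add (Integrable.const_mul ?_ _)
  simp only [add_mul]
  exact (integrable_mul_image G G).add ((L1.integrable_coeFn (A G)).const_mul _)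

/-- The upper right derivative of the averaged entropy. -/
lemma frequently_slope_lt (h : IsFamilySolution L κ D A ρ w) (hA : IsGraphop A) (hL : 0 < L)
    (hκ : 0 ≤ κ) (hε : 0 < ε) (hD : MemSobolev L 2 ⊤ D) {t : ℝ} (ht : 0 < t) {G : Lp ℝ ⊤ μ}
    (hG : G =ᵐ[μ] fun ξ => ∫ x, |ρ t x ξ - splay d L| ∂(vol d L)) {r : ℝ}
    (hr : ∫ ξ, rateBound L κ ε D A ρ t G ξ ∂μ < r) :
    ∃ᶠ z in 𝓝[>] t, (z - t)⁻¹ * (avgEntropy L ε μ ρ z - avgEntropy L ε μ ρ t) < r := by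
  set u := rateBound L κ ε D A ρ t G with hu
  set B := rateMajorant L κ ε D A with hB
  have hui : Integrable u μ := h.integrable_rateBound hA hL hκ hε hD ht.le G
  have hBi : Integrable B μ := integrable_rateMajorant L κ ε D A
  have hki := fun {s : ℝ} (hs : 0 ≤ s) => h.integrable_sliceEntropy hA hL hκ hε hD hs
  let σ : ℝ → Ω → ℝ := fun z ξ => (z - t)⁻¹ * (sliceEntropy L ε ρ z ξ - sliceEntropy L ε ρ t ξ)
  have hσi : ∀ z > t, Integrable (σ z) μ := fun z hz =>
    ((hki (ht.le.trans (le_of_lt hz))).sub (hki ht.le)).const_mul _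
  -- The slopes have an integrable bound from above only. The maximum with `u` supplies one from
  -- below, and it converges to `u` because the limiting slope is at most `u`.
  have hlim : Tendsto (fun z => ∫ ξ, max (σ z ξ) (u ξ) ∂μ) (𝓝[>] t) (𝓝 (∫ ξ, u ξ ∂μ)) := by
    refine tendsto_integral_filter_of_dominated_convergence (fun ξ => |B ξ| + |u ξ|) ?_ ?_
      (hBi.abs.add hui.abs) ?_
    · filter_upwards [self_mem_nhdsWithin] with z hz
      exact ((hσi z hz).sup hui).1
    · filter_upwards [self_mem_nhdsWithin] with z hz
      filter_upwards [h.sliceEntropy_sub_le hA hL hκ hε hD] with ξ hξ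
      have hzt : 0 < z - t := sub_pos.2 hz
      have h1 : σ z ξ ≤ B ξ := by
        have := hξ t ht.le z (le_of_lt hz)
        change (z - t)⁻¹ * _ ≤ _
        rw [inv_mul_le_iff₀ hzt, mul_comm]
        exact this
      rw [Real.norm_eq_abs]
      refine abs_le.2 ⟨?_, ?_⟩
      · have := le_max_right (σ z ξ) (u ξ)
        have := neg_abs_le (u ξ)
        have := abs_nonneg (B ξ)
        linarith
      · refine max_le ?_ ?_
        · have := le_abs_self (B ξ)
          have := abs_nonneg (u ξ)
          linarith
        · have := le_abs_self (u ξ)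
          have := abs_nonneg (B ξ)
          linarith
    · filter_upwards [h.slice, h.entropyRate_le hA hL hκ hε hD ht hG] with ξ hs hξ
      have h1 := (hasDerivAt_iff_tendsto_slope.1 (hs.hasDerivAt_regEntropy hL hε ht)).mono_left
        (nhdsWithin_mono t fun z (hz : t < z) => ne_of_gt hz)
      have h2 := h1.max (tendsto_const_nhds (x := u ξ))
      rw [max_eq_right hξ.1] at h2
      exact h2
  refine Eventually.frequently ?_
  filter_upwards [hlim.eventually_lt_const hr, self_mem_nhdsWithin] with z hz hzt
  refine lt_of_le_of_lt ?_ hz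
  unfold avgEntropy
  rw [← integral_sub (hki (ht.le.trans (le_of_lt hzt))) (hki ht.le), ← integral_const_mul]
  exact integral_mono (hσi z hzt) ((hσi z hzt).sup hui) fun ξ => le_max_left _ _

end IsFamilySolution

/-- The error term of the regularized entropy estimate. -/
noncomputable def decayError (L κ ε Λ n a : ℝ) : ℝ :=
  4 * Real.pi ^ 2 / L ^ 2 * ((1 + ε) * Real.log (1 + ε)) - 2 * (κ * Λ * n) * (ε * Real.log ε) +
    κ * Λ * (4 * √ε * a)

namespace IsFamilySolution

variable {κ ε : ℝ} {D : E d → ℝ} {A : POperator μ} {ρ w : ℝ → E d → Ω → ℝ}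

/-- The numerical radius turns `∫ G · AG` into `n(A) ∫ G²`, and Pinsker's inequality turns `G²` into
twice the entropy. The remaining terms vanish with `ε` and are collected in `decayError`. -/
lemma integral_rateBound_le (h : IsFamilySolution L κ D A ρ w) (hA : IsGraphop A)
    (hA2 : MemB A 2 2) (hL : 0 < L) (hκ : 0 ≤ κ) (hε : 0 < ε) (hD : MemSobolev L 2 ⊤ D) {t : ℝ}
    (ht : 0 ≤ t) {G : Lp ℝ ⊤ μ}
    (hG : G =ᵐ[μ] fun ξ => ∫ x, |ρ t x ξ - splay d L| ∂(vol d L)) :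
    ∫ ξ, rateBound L κ ε D A ρ t G ξ ∂μ ≤
      -(4 * Real.pi ^ 2 / L ^ 2 - 2 * κ * normLaplacian L D * numericalRadius A hA2) *
        avgEntropy L ε μ ρ t +
      decayError L κ ε (normLaplacian L D) (numericalRadius A hA2) (∫ ξ, degree A ξ ∂μ) := by
  have hΛ : 0 ≤ κ * normLaplacian L D := mul_nonneg hκ ENNReal.toReal_nonneg
  have hn := hA.numericalRadius_nonneg hA2
  have hki := h.integrable_sliceEntropy hA hL hκ hε hD ht
  have hAGi : Integrable (A G) μ := L1.integrable_coeFn (A G)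
  have hb := h.entropy_bounds hL hε hD
  have hsq : ∫ ξ, G ξ ^ 2 ∂μ ≤ 2 * avgEntropy L ε μ ρ t - 2 * (ε * Real.log ε) := by
    have h1 : ∫ ξ, (2 * sliceEntropy L ε ρ t ξ - 2 * (ε * Real.log ε)) ∂μ =
        2 * avgEntropy L ε μ ρ t - 2 * (ε * Real.log ε) := by
      rw [integral_sub (hki.const_mul 2) (integrable_const _), integral_const_mul]
      simp [avgEntropy]
    rw [← h1]
    refine integral_mono_of_nonneg (Eventually.of_forall fun ξ => sq_nonneg _)
      ((hki.const_mul 2).sub (integrable_const _)) ?_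
    filter_upwards [hb, hG] with ξ h1 h2
    obtain ⟨b1, b2, b3, b4, b5⟩ := h1 t ht
    simp only [h2]
    linarith
  have hdeg : ∫ ξ, A G ξ ∂μ ≤ 2 * ∫ ξ, degree A ξ ∂μ := by
    rw [← integral_const_mul]
    refine integral_mono_ae hAGi ((integrable_degree A).const_mul 2) ?_
    refine hA.image_le_degree ?_
    filter_upwards [hb, hG] with ξ h1 h2
    rw [h2]
    exact (h1 t ht).2.2.2.2
  have hGAG := integral_mul_image_le hA2 G
  have hexp : ∫ ξ, rateBound L κ ε D A ρ t G ξ ∂μ =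
      -(4 * Real.pi ^ 2 / L ^ 2) * (avgEntropy L ε μ ρ t - (1 + ε) * Real.log (1 + ε)) +
      κ * normLaplacian L D * ((∫ ξ, G ξ * A G ξ ∂μ) + 2 * √ε * ∫ ξ, A G ξ ∂μ) := by
    unfold rateBound
    simp only [add_mul]
    rw [integral_add, integral_const_mul, integral_const_mul, integral_sub hki
      (integrable_const _), integral_add (integrable_mul_image G G) (hAGi.const_mul _),
      integral_const_mul]
    · simp [avgEntropy]
    · exact (hki.sub (integrable_const _)).const_mul _
    · exact ((integrable_mul_image G G).add (hAGi.const_mul _)).const_mul _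
  rw [hexp]
  have h1 : (∫ ξ, G ξ * A G ξ ∂μ) + 2 * √ε * ∫ ξ, A G ξ ∂μ ≤
      numericalRadius A hA2 * (2 * avgEntropy L ε μ ρ t - 2 * (ε * Real.log ε)) +
        2 * √ε * (2 * ∫ ξ, degree A ξ ∂μ) :=
    add_le_add (hGAG.trans (mul_le_mul_of_nonneg_left hsq hn))
      (mul_le_mul_of_nonneg_left hdeg (by positivity))
  have h2 := mul_le_mul_of_nonneg_left h1 hΛ
  unfold decayError
  nlinarith

/-- Exponential decay of the regularized entropy, up to an error. -/
lemma avgEntropy_le (h : IsFamilySolution L κ D A ρ w) (hA : IsGraphop A)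
    (hA2 : MemB A 2 2) (hL : 0 < L) (hκ : 0 ≤ κ) (hε : 0 < ε) (hD : MemSobolev L 2 ⊤ D) {α : ℝ}
    (hα : α = 4 * Real.pi ^ 2 / L ^ 2 - 2 * κ * normLaplacian L D * numericalRadius A hA2)
    (hα0 : 0 < α) {t : ℝ} (ht : 0 < t) :
    avgEntropy L ε μ ρ t ≤ avgEntropy L ε μ ρ 0 * Real.exp (-α * t) +
      decayError L κ ε (normLaplacian L D) (numericalRadius A hA2) (∫ ξ, degree A ξ ∂μ) / -α *
        (Real.exp (-α * t) - 1) := by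
  set K := avgEntropy L ε μ ρ with hK
  set err := decayError L κ ε (normLaplacian L D) (numericalRadius A hA2) (∫ ξ, degree A ξ ∂μ)
    with herr
  have hcont : ContinuousOn K (Icc 0 t) := h.continuousOn_avgEntropy hA hL hκ hε hD t
  have hG : ∀ s : ℝ, ∃ G : Lp ℝ ⊤ μ, 0 < s →
      G =ᵐ[μ] fun ξ => ∫ x, |ρ s x ξ - splay d L| ∂(vol d L) := by
    intro s
    by_cases hs : 0 < s
    · obtain ⟨G, hG⟩ := h.exists_distLp hL hD hs.le
      exact ⟨G, fun _ => hG⟩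
    · exact ⟨0, fun hs' => absurd hs' hs⟩
  choose G hG using hG
  -- The equation holds only at positive times, so Grönwall starts at `δ > 0`; continuity of the
  -- averaged entropy at `0` permits `δ → 0`.
  have hgron : ∀ δ ∈ Ioo 0 t, K t ≤ K δ * Real.exp (-α * (t - δ)) +
      err / -α * (Real.exp (-α * (t - δ)) - 1) := by
    intro δ hδ
    have h1 := le_gronwallBound_of_liminf_deriv_right_le (f := K) (δ := K δ) (K := -α) (ε := err)
      (a := δ) (b := t) (f' := fun s => ∫ ξ, rateBound L κ ε D A ρ s (G s) ξ ∂μ)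
      (hcont.mono (Icc_subset_Icc_left hδ.1.le))
      (fun s hs r hr => h.frequently_slope_lt hA hL hκ hε hD (hδ.1.trans_le hs.1)
        (hG s (hδ.1.trans_le hs.1)) hr) le_rfl
      (fun s hs => by
        rw [hα]
        exact h.integral_rateBound_le hA hA2 hL hκ hε hD (hδ.1.le.trans hs.1)
          (hG s (hδ.1.trans_le hs.1)))
      t ⟨hδ.2.le, le_rfl⟩
    rwa [gronwallBound_of_K_ne_0 (neg_ne_zero.2 hα0.ne')] at h1
  have hKlim : Tendsto K (𝓝[>] 0) (𝓝 (K 0)) := by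
    have h1 : ContinuousWithinAt K (Icc 0 t) 0 := hcont 0 ⟨le_rfl, ht.le⟩
    refine h1.mono_left ?_
    rw [← nhdsWithin_Ioc_eq_nhdsGT ht]
    exact nhdsWithin_mono _ Ioc_subset_Icc_self
  have hexp : Tendsto (fun δ : ℝ => Real.exp (-α * (t - δ))) (𝓝[>] 0)
      (𝓝 (Real.exp (-α * (t - 0)))) :=
    (Continuous.tendsto (by fun_prop) 0).mono_left nhdsWithin_le_nhds
  have hlim := (hKlim.mul hexp).add ((hexp.sub_const 1).const_mul (err / -α))
  rw [sub_zero] at hlim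
  exact ge_of_tendsto hlim (by
    filter_upwards [Ioo_mem_nhdsGT ht] with δ hδ
    exact hgron δ hδ)

lemma finiteEntropy (h : IsFamilySolution L κ D A ρ w) (hA : IsGraphop A) (hL : 0 < L)
    (hκ : 0 ≤ κ) (hD : MemSobolev L 2 ⊤ D) {t : ℝ} (ht : 0 ≤ t) : FiniteEntropy L μ (ρ t) := by
  refine finiteEntropy_of_integrable hL (h.measurable t ht) ?_
    ((h.integrable_sliceEntropy_iff hL one_pos hD ht).1
      (h.integrable_sliceEntropy hA hL hκ one_pos hD ht))
  filter_upwards [h.slice] with ξ hs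
  exact ⟨hs.continuous_at ht, hs.nonneg t ht⟩

/-- Exponential decay of the entropy. -/
lemma entropy_le (h : IsFamilySolution L κ D A ρ w) (hA : IsGraphop A)
    (hA2 : MemB A 2 2) (hL : 0 < L) (hκ : 0 ≤ κ) (hD : MemSobolev L 2 ⊤ D) {α : ℝ}
    (hα : α = 4 * Real.pi ^ 2 / L ^ 2 - 2 * κ * normLaplacian L D * numericalRadius A hA2)
    (hα0 : 0 < α) {t : ℝ} (ht : 0 < t) :
    entropy L μ (ρ t) ≤ Real.exp (-α * t) * entropy L μ (ρ 0) := by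
  set a := ∫ ξ, degree A ξ ∂μ with ha
  set Λ := normLaplacian L D with hΛ
  set n := numericalRadius A hA2 with hn
  have hrel : ∀ s ≥ 0, Integrable (fun ξ => relEntropy L (fun x => ρ s x ξ)) μ := fun s hs =>
    (h.integrable_sliceEntropy_iff hL one_pos hD hs).1
      (h.integrable_sliceEntropy hA hL hκ one_pos hD hs)
  have key : ∀ ε > 0, entropy L μ (ρ t) ≤ (entropy L μ (ρ 0) + (ε + ε ^ 2)) * Real.exp (-α * t) +
      decayError L κ ε Λ n a / -α * (Real.exp (-α * t) - 1) - ε * Real.log ε := by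
    intro ε hε
    have hb := h.entropy_bounds hL hε hD
    have h1 : entropy L μ (ρ t) ≤ avgEntropy L ε μ ρ t - ε * Real.log ε := by
      have hi := h.integrable_sliceEntropy hA hL hκ hε hD ht.le
      have e1 : ∫ ξ, (sliceEntropy L ε ρ t ξ - ε * Real.log ε) ∂μ =
          avgEntropy L ε μ ρ t - ε * Real.log ε := by
        rw [integral_sub hi (integrable_const _)]
        simp [avgEntropy]
      rw [← e1]
      refine integral_mono_ae (hrel t ht.le) (hi.sub (integrable_const _)) ?_
      filter_upwards [hb] with ξ hξ
      exact (hξ t ht.le).2.1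
    have h2 : avgEntropy L ε μ ρ 0 ≤ entropy L μ (ρ 0) + (ε + ε ^ 2) := by
      have hi := h.integrable_sliceEntropy hA hL hκ hε hD le_rfl
      have e1 : ∫ ξ, (relEntropy L (fun x => ρ 0 x ξ) + (ε + ε ^ 2)) ∂μ =
          entropy L μ (ρ 0) + (ε + ε ^ 2) := by
        rw [integral_add (hrel 0 le_rfl) (integrable_const _)]
        simp [entropy, relEntropy]
      rw [← e1]
      refine integral_mono_ae hi ((hrel 0 le_rfl).add (integrable_const _)) ?_
      filter_upwards [hb] with ξ hξ
      exact (hξ 0 le_rfl).2.2.1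
    have h3 := h.avgEntropy_le hA hA2 hL hκ hε hD hα hα0 ht
    have h4 := mul_le_mul_of_nonneg_right h2 (Real.exp_pos (-α * t)).le
    linarith
  -- For `ε → 0` the bound is continuous and every error term vanishes; `ε log ε` has the value `0`
  -- at `ε = 0`.
  have hlog : Continuous fun ε : ℝ => ε * Real.log ε := Real.continuous_mul_log
  have hlog1 : ContinuousAt (fun ε : ℝ => Real.log (1 + ε)) 0 :=
    ContinuousAt.log (by fun_prop) (by norm_num)
  have herr : ContinuousAt (fun ε : ℝ => decayError L κ ε Λ n a) 0 := by
    unfold decayError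
    have := hlog.continuousAt (x := 0)
    fun_prop
  have hrhs : ContinuousAt (fun ε : ℝ => (entropy L μ (ρ 0) + (ε + ε ^ 2)) * Real.exp (-α * t) +
      decayError L κ ε Λ n a / -α * (Real.exp (-α * t) - 1) - ε * Real.log ε) 0 := by
    have := hlog.continuousAt (x := 0)
    fun_prop
  have hlim := hrhs.tendsto.mono_left (nhdsWithin_le_nhds (s := Ioi 0))
  have h1 := ge_of_tendsto hlim (eventually_nhdsWithin_of_forall fun ε hε => key ε hε)
  refine h1.trans_eq ?_
  simp [decayError]
  ring

end IsFamilySolution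

/-- The initial density supplies unit mass at time zero, and Fubini turns finite entropy on `U × Ω`
into integrability of the slice entropies. -/
lemma IsClassicalSolution.exists_family {κ : ℝ} {D : E d → ℝ} {A : POperator μ}
    {ρ₀ : E d → Ω → ℝ} {ρ : ℝ → E d → Ω → ℝ} (h : IsClassicalSolution L κ D A ρ₀ ρ)
    (hρ₀ : IsAdmissible L μ ρ₀) (hH : FiniteEntropy L μ ρ₀) :
    (∃ w, IsFamilySolution L κ D A ρ w) ∧ entropy L μ (ρ 0) = entropy L μ ρ₀ := by
  obtain ⟨w, hw1, hw2, hw3, hw4⟩ := h.equation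
  have hrel : ∀ᵐ ξ ∂μ, relEntropy L (fun x => ρ 0 x ξ) = relEntropy L (fun x => ρ₀ x ξ) := by
    filter_upwards [h.initial] with ξ hξ
    refine integral_congr_ae ?_
    filter_upwards [hξ] with x hx
    rw [hx]
  refine ⟨⟨w, h.measurable, hw1, hw2, ?_, ?_⟩, integral_congr_ae hrel⟩
  · filter_upwards [h.periodic, h.nonneg, h.initial, h.continuous, h.contDiff, h.continuous_deriv,
      hw3, hw4, hρ₀.density] with ξ h1 h2 h3 h4 h5 h6 h7 h8 h9
    exact ⟨h1, h2, by rw [integral_congr_ae h3]; exact h9.2.2, h4, h5, h6, h7, h8⟩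
  · exact (Integrable.integral_prod_right hH).congr (by
      filter_upwards [hrel] with ξ hξ
      exact hξ.symm)

end Decay
end McKeanVlasov

/-! ### The decay theorem. -/

theorem theorem3p1 {d : ℕ} {L κ : ℝ} (hL : 0 < L) (hκ : 0 < κ)
    {Ω : Type*} [TopologicalSpace Ω] [MeasurableSpace Ω] [BorelSpace Ω]
    (μ : MeasureTheory.Measure Ω) [MeasureTheory.IsProbabilityMeasure μ] [μ.IsOpenPosMeasure]
    (D : McKeanVlasov.E d → ℝ) (hD : McKeanVlasov.MemSobolev L 2 ⊤ D)
    (A : McKeanVlasov.POperator μ) (hA : McKeanVlasov.IsGraphop A)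
    (hA2 : McKeanVlasov.MemB A 2 2)
    (ρ₀ : McKeanVlasov.E d → Ω → ℝ) (hρ₀ : McKeanVlasov.IsAdmissible L μ ρ₀)
    (hH : McKeanVlasov.FiniteEntropy L μ ρ₀)
    -- `κ < 2π² / (L² ‖ΔD‖_∞ n(A))`, where the bound is `∞` if the denominator vanishes
    (hsmall : κ * (L ^ 2 * McKeanVlasov.normLaplacian L D * McKeanVlasov.numericalRadius A hA2)
      < 2 * Real.pi ^ 2)
    (ρ : ℝ → McKeanVlasov.E d → Ω → ℝ)
    (hρ : McKeanVlasov.IsClassicalSolution L κ D A ρ₀ ρ)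
    (α : ℝ) (hα : α = 4 * Real.pi ^ 2 / L ^ 2
      - 2 * κ * McKeanVlasov.normLaplacian L D * McKeanVlasov.numericalRadius A hA2) :
    0 < α ∧ ∀ t ≥ 0, McKeanVlasov.FiniteEntropy L μ (ρ t) ∧
      McKeanVlasov.entropy L μ (ρ t) ≤ Real.exp (-α * t) * McKeanVlasov.entropy L μ ρ₀ := by
  have hα0 : 0 < α := by
    have h1 : α = 2 / L ^ 2 * (2 * Real.pi ^ 2 - κ * (L ^ 2 * McKeanVlasov.normLaplacian L D *
        McKeanVlasov.numericalRadius A hA2)) := by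
      rw [hα]
      field_simp
      ring
    rw [h1]
    exact mul_pos (by positivity) (sub_pos.2 hsmall)
  obtain ⟨⟨w, hw⟩, h0⟩ := hρ.exists_family hρ₀ hH
  refine ⟨hα0, fun t ht => ⟨hw.finiteEntropy hA hL hκ.le hD ht, ?_⟩⟩
  rw [← h0]
  rcases ht.eq_or_lt with rfl | ht
  · simp
  · exact hw.entropy_le hA hA2 hL hκ.le hD hα hα0 ht
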